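/- Let $n\ge 0$ and let $k$ be a field whose characteristic does not divide $n!$ (that is, $n!\neq 0$ in $k$; for instance, any field of characteristic $0$). For $\sigma\in S_n$ put $\sigma(0)=0$ and $\mathrm{Peak}(\sigma)=\{i\in[n-1] : \sigma(i-1)<\sigma(i)>\sigma(i+1)\}$. A set of integers is sparse if it contains no two consecutive integers. For sparse $F\subseteq[n-1]$ let $P_F=\sum_{\mathrm{Peak}(\sigma)=F}\sigma\in kS_n$, let $\overline F=\{i\in[n-1] : i\in F,\text{ or both } i-1,i+1\in F\}$, and put $$Q_F=\sum_{G\supseteq F}P_G,\qquad O_F=\sum_{G\subseteq[n-1]\setminus F}P_G,\qquad \overline O_F=\sum_{G\subseteq[n-1]\setminus\overline F}P_G,$$ the sums being over sparse subsets $G$ of $[n-1]$. The peak algebra $\mathfrak P_n$ is the linear span of the elements $P_F$ ($F\subseteq[n-1]$ sparse); it is a unital subalgebra of $kS_n$. An almost-odd composition of $n$ is a sequence $\gamma=(b_0,b_1,\dots,b_m)$ of integers with sum $n$ such that $b_0\ge 0$ is even and $b_1,\dots,b_m\geq 1$ are odd; we write $k(\gamma)=m$ and $\gamma^t=(b_0,b_{t(1)},\dots,b_{t(m)})$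 for a permutation $t$ of $[m]$. There is exactly one sparse $F\subseteq[n-1]$ with $$\{b_0,\,b_0+b_1,\,\dots,\,b_0+\cdots+b_{m-1}\}=[0,n-1]\setminus\bigl(F\cup(F-1)\bigr),$$ and we set $Q_\gamma=Q_F$, $O_\gamma=O_F$, $\overline O_\gamma=\overline O_F$ for this $F$. **Theorem.** The Jacobson radical of $\mathfrak P_n$ is linearly spanned by each of the following three families: $$\text{(a) } \overline O_\gamma-\overline O_{\gamma^t},\qquad \text{(b) } Q_\gamma-Q_{\gamma^t},\qquad \text{(c) } O_\gamma-O_{\gamma^t},$$ where in each case $\gamma$ runs over all almost-odd compositions of $n$ and $t$ over all permutations of $[k(\gamma)]$. -/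

import Mathlib

namespace PeakAlg

/-- The value `σ(i)` of a permutation of `[n]` in one-line notation, with the convention
`σ(0) = 0`. Positions and values are counted from `1`, whereas `Fin n` counts from `0`;
positions `i > n` get the unused value `0`. -/
def value {n : ℕ} (σ : Equiv.Perm (Fin n)) (i : ℕ) : ℕ :=
  if h : 1 ≤ i ∧ i ≤ n then (σ ⟨i - 1, by omega⟩ : ℕ) + 1 else 0

/-- `Peak(σ) = {i ∈ [n-1] | σ(i-1) < σ(i) > σ(i+1)}`, where `σ(0) = 0`. -/
def peak {n : ℕ} (σ : Equiv.Perm (Fin n)) : Finset ℕ :=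
  (Finset.Icc 1 (n - 1)).filter
    fun i => value σ (i - 1) < value σ i ∧ value σ (i + 1) < value σ i

/-- A set is sparse if it does not contain two consecutive integers. -/
def IsSparse (F : Finset ℕ) : Prop := ∀ i ∈ F, i + 1 ∉ F

instance (F : Finset ℕ) : Decidable (IsSparse F) :=
  inferInstanceAs (Decidable (∀ i ∈ F, i + 1 ∉ F))

/-- The sparse subsets of `[n-1]`. -/
def sparseSubsets (n : ℕ) : Finset (Finset ℕ) :=
  (Finset.Icc 1 (n - 1)).powerset.filter fun F => IsSparse F

section Bases

variable (k : Type*) [Field k] (n : ℕ)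

/-- `P_F`: the sum in `k S_n` of all permutations with peak set `F`. -/
noncomputable def P (F : Finset ℕ) : MonoidAlgebra k (Equiv.Perm (Fin n)) :=
  ∑ σ ∈ (Finset.univ : Finset (Equiv.Perm (Fin n))).filter (fun σ => peak σ = F),
    MonoidAlgebra.of k (Equiv.Perm (Fin n)) σ

/-- The underlying space of the peak algebra: the span of the `P_F`, `F` a sparse subset of
`[n-1]`. -/
noncomputable def peakSpace : Submodule k (MonoidAlgebra k (Equiv.Perm (Fin n))) :=
  Submodule.span k {x | ∃ F ∈ sparseSubsets n, x = P k n F}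

/-- `Q_F = ∑ P_G` over the sparse subsets `G` of `[n-1]` with `F ⊆ G`. -/
noncomputable def Q (F : Finset ℕ) : MonoidAlgebra k (Equiv.Perm (Fin n)) :=
  ∑ G ∈ (sparseSubsets n).filter (fun G => F ⊆ G), P k n G

/-- `O_F = ∑ P_G` over the sparse subsets `G` of `[n-1]` with `G ⊆ [n-1] \ F`. -/
noncomputable def O (F : Finset ℕ) : MonoidAlgebra k (Equiv.Perm (Fin n)) :=
  ∑ G ∈ (sparseSubsets n).filter (fun G => G ⊆ Finset.Icc 1 (n - 1) \ F), P k n G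

/-- `M̄ = {i ∈ [n-1] | i ∈ M, or both i - 1 ∈ M and i + 1 ∈ M}`, for `M ⊆ [n-1]`. -/
def bar (M : Finset ℕ) : Finset ℕ :=
  (Finset.Icc 1 (n - 1)).filter fun i => i ∈ M ∨ (i - 1 ∈ M ∧ i + 1 ∈ M)

/-- `Ō_F = ∑ P_G` over the sparse subsets `G` of `[n-1]` with `G ⊆ [n-1] \ F̄`. -/
noncomputable def OBar (F : Finset ℕ) : MonoidAlgebra k (Equiv.Perm (Fin n)) :=
  ∑ G ∈ (sparseSubsets n).filter (fun G => G ⊆ Finset.Icc 1 (n - 1) \ bar n F), P k n G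

end Bases

/-- An almost-odd composition `(b_0, b_1, …, b_k)` of `n`: `b_0 ≥ 0` is even, `b_1, …, b_k` are
odd (hence positive), and the sum is `n`. Here `head = b_0`, `len = k` and `parts i = b_{i+1}`. -/
structure AlmostOddComp (n : ℕ) where
  head : ℕ
  len : ℕ
  parts : Fin len → ℕ
  head_even : Even head
  parts_odd : ∀ i, Odd (parts i)
  sum_eq : head + ∑ i, parts i = n

namespace AlmostOddComp

variable {n : ℕ}

/-- `γ^t = (b_0, b_{t(1)}, …, b_{t(k)})`. -/
def permute (γ : AlmostOddComp n) (t : Equiv.Perm (Fin γ.len)) : AlmostOddComp n where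
  head := γ.head
  len := γ.len
  parts := fun i => γ.parts (t i)
  head_even := γ.head_even
  parts_odd := fun i => γ.parts_odd (t i)
  sum_eq := by rw [Equiv.sum_comp t γ.parts]; exact γ.sum_eq

/-- The partial sum `b_0 + b_1 + ⋯ + b_i`, for `0 ≤ i < k`. -/
def psum (γ : AlmostOddComp n) (i : Fin γ.len) : ℕ :=
  γ.head + ∑ j ∈ Finset.univ.filter (fun j => j < i), γ.parts j

/-- `J(γ) = {b_0, b_0 + b_1, …, b_0 + b_1 + ⋯ + b_{k-1}}`, a subset of `[0, n-1]`. -/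
def J (γ : AlmostOddComp n) : Finset ℕ := Finset.univ.image γ.psum

/-- The sparse subset `F` of `[n-1]` that corresponds to `γ`, that is, the only one with
`J(γ) = [0, n-1] \ (F ∪ (F - 1))` (see `sparseSet_mem`, `J_eq` and `sparseSet_unique`).
It is obtained from the maximal intervals of `[0, n-1] \ J(γ)` by deleting every other element,
starting with the first one of each interval. -/
def sparseSet (γ : AlmostOddComp n) : Finset ℕ :=
  (Finset.range n).filter fun m =>
    (m < γ.head ∧ Odd m) ∨
      ∃ i, γ.psum i < m ∧ m < γ.psum i + γ.parts i ∧ Even (m - γ.psum i)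

/-- `Q_γ = Q_F` for the sparse subset `F` that corresponds to `γ`. -/
noncomputable def Q (k : Type*) [Field k] (γ : AlmostOddComp n) :
    MonoidAlgebra k (Equiv.Perm (Fin n)) := PeakAlg.Q k n γ.sparseSet

/-- `O_γ = O_F` for the sparse subset `F` that corresponds to `γ`. -/
noncomputable def O (k : Type*) [Field k] (γ : AlmostOddComp n) :
    MonoidAlgebra k (Equiv.Perm (Fin n)) := PeakAlg.O k n γ.sparseSet

/-- `Ō_γ = Ō_F` for the sparse subset `F` that corresponds to `γ`. -/
noncomputable def OBar (k : Type*) [Field k] (γ : AlmostOddComp n) :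
    MonoidAlgebra k (Equiv.Perm (Fin n)) := PeakAlg.OBar k n γ.sparseSet

theorem psum_add_le (γ : AlmostOddComp n) {i j : Fin γ.len} (h : i < j) :
    γ.psum i + γ.parts i ≤ γ.psum j := by
  have hs : insert i (Finset.univ.filter (fun l => l < i)) ⊆
      Finset.univ.filter (fun l => l < j) := by
    intro l hl
    simp only [Finset.mem_insert, Finset.mem_filter, Finset.mem_univ, true_and] at hl ⊢
    rcases hl with rfl | hl
    · exact h
    · exact hl.trans h
  have := Finset.sum_le_sum_of_subset (f := γ.parts) hs
  rw [Finset.sum_insert (by simp)] at this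
  unfold psum
  omega

theorem head_le_psum (γ : AlmostOddComp n) (i : Fin γ.len) : γ.head ≤ γ.psum i :=
  Nat.le_add_right _ _

theorem psum_add_le_n (γ : AlmostOddComp n) (i : Fin γ.len) :
    γ.psum i + γ.parts i ≤ n := by
  have := Finset.sum_le_sum_of_subset (f := γ.parts)
    (Finset.subset_univ (insert i (Finset.univ.filter (fun l => l < i))))
  rw [Finset.sum_insert (by simp)] at this
  have h2 := γ.sum_eq
  unfold psum
  omega

theorem head_le_n (γ : AlmostOddComp n) : γ.head ≤ n := by
  have := γ.sum_eq
  omega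

/-- The intervals `[0, b_0)` and `[b_0 + ⋯ + b_i, b_0 + ⋯ + b_{i+1})` cover `[0, n-1]`. -/
theorem cover (γ : AlmostOddComp n) {m : ℕ} (hm : m < n) :
    m < γ.head ∨ ∃ i, γ.psum i ≤ m ∧ m < γ.psum i + γ.parts i := by
  by_contra! hc
  obtain ⟨h0, h1⟩ := hc
  have key : ∀ j (hj : j ≤ γ.len),
      γ.head + ∑ l ∈ Finset.univ.filter (fun l : Fin γ.len => (l : ℕ) < j), γ.parts l ≤ m := by
    intro j
    induction j with
    | zero => intro _; simpa using h0
    | succ j ih =>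
      intro hj
      have h2 := h1 ⟨j, hj⟩ (by simpa [psum, Fin.lt_def] using ih (by omega))
      have hs : Finset.univ.filter (fun l : Fin γ.len => (l : ℕ) < j + 1) =
          insert (⟨j, hj⟩ : Fin γ.len)
            (Finset.univ.filter (fun l : Fin γ.len => l < ⟨j, hj⟩)) := by
        ext l
        simp only [Finset.mem_insert, Finset.mem_filter, Finset.mem_univ, true_and, Fin.lt_def,
          Fin.ext_iff]
        omega
      rw [hs, Finset.sum_insert (by simp)]
      unfold psum at h2
      omega
  have := key γ.len le_rfl
  have hs : Finset.univ.filter (fun l : Fin γ.len => (l : ℕ) < γ.len) = Finset.univ := by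
    ext l; simp
  rw [hs, γ.sum_eq] at this
  omega

theorem block_unique (γ : AlmostOddComp n) {i j : Fin γ.len} {m : ℕ}
    (hi : γ.psum i ≤ m) (hi' : m < γ.psum i + γ.parts i)
    (hj : γ.psum j ≤ m) (hj' : m < γ.psum j + γ.parts j) : i = j := by
  rcases lt_trichotomy i j with h | h | h
  · have := γ.psum_add_le h; omega
  · exact h
  · have := γ.psum_add_le h; omega

theorem mem_sparseSet (γ : AlmostOddComp n) (m : ℕ) :
    m ∈ γ.sparseSet ↔ (m < γ.head ∧ Odd m) ∨
      ∃ i, γ.psum i < m ∧ m < γ.psum i + γ.parts i ∧ Even (m - γ.psum i) := by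
  unfold sparseSet
  simp only [Finset.mem_filter, Finset.mem_range, and_iff_right_iff_imp]
  rintro (⟨h, -⟩ | ⟨i, -, h, -⟩)
  · exact h.trans_le γ.head_le_n
  · exact h.trans_le (γ.psum_add_le_n i)

theorem mem_sparseSet_head (γ : AlmostOddComp n) {m : ℕ} (h : m < γ.head) :
    m ∈ γ.sparseSet ↔ Odd m := by
  rw [mem_sparseSet]
  constructor
  · rintro (⟨-, h'⟩ | ⟨i, hi, -⟩)
    · exact h'
    · have := γ.head_le_psum i; omega
  · exact fun h' => Or.inl ⟨h, h'⟩

theorem mem_sparseSet_block (γ : AlmostOddComp n) {m : ℕ} {i : Fin γ.len}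
    (hi : γ.psum i ≤ m) (hi' : m < γ.psum i + γ.parts i) :
    m ∈ γ.sparseSet ↔ γ.psum i < m ∧ Even (m - γ.psum i) := by
  rw [mem_sparseSet]
  constructor
  · rintro (⟨h, -⟩ | ⟨j, h1, h2, h3⟩)
    · have := γ.head_le_psum i; omega
    · obtain rfl := γ.block_unique hi hi' h1.le h2
      exact ⟨h1, h3⟩
  · exact fun h => Or.inr ⟨i, h.1, hi', h.2⟩

theorem mem_J_block (γ : AlmostOddComp n) {m : ℕ} {i : Fin γ.len}
    (hi : γ.psum i ≤ m) (hi' : m < γ.psum i + γ.parts i) :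
    m ∈ γ.J ↔ m = γ.psum i := by
  unfold J
  simp only [Finset.mem_image, Finset.mem_univ, true_and]
  constructor
  · rintro ⟨j, rfl⟩
    obtain ⟨c, hc⟩ := γ.parts_odd j
    rw [γ.block_unique hi hi' le_rfl (by omega)]
  · rintro rfl
    exact ⟨i, rfl⟩

/-- The last element of a block is followed by an element of `J(γ)` or by `n`. -/
theorem not_mem_sparseSet_of_block_end (γ : AlmostOddComp n) {m : ℕ}
    (h : m = γ.head ∨ ∃ i, m = γ.psum i + γ.parts i) : m ∉ γ.sparseSet := by
  intro hm
  have hle : ∀ i, γ.psum i < m → m < γ.psum i + γ.parts i → False := by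
    intro i h1 h2
    rcases h with rfl | ⟨j, rfl⟩
    · have := γ.head_le_psum i; omega
    · rcases lt_trichotomy i j with h | h | h
      · have := γ.psum_add_le h; omega
      · subst h; omega
      · have := γ.psum_add_le h; omega
  rw [mem_sparseSet] at hm
  rcases hm with ⟨h1, -⟩ | ⟨i, h1, h2, -⟩
  · rcases h with rfl | ⟨j, rfl⟩
    · omega
    · have := γ.head_le_psum j; omega
  · exact hle i h1 h2

/-- `sparseSet γ` is a sparse subset of `[n-1]`. -/
theorem sparseSet_mem (γ : AlmostOddComp n) : γ.sparseSet ∈ sparseSubsets n := by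
  unfold sparseSubsets
  rw [Finset.mem_filter, Finset.mem_powerset]
  constructor
  · intro m hm
    have hn : m < n := by
      unfold sparseSet at hm
      simpa using (Finset.mem_filter.1 hm).1
    rw [mem_sparseSet] at hm
    rw [Finset.mem_Icc]
    rcases hm with ⟨-, c, hc⟩ | ⟨i, hi, -⟩ <;> omega
  · intro m hm hm'
    have h1 := hm
    rw [mem_sparseSet] at h1
    rcases h1 with ⟨h, ho⟩ | ⟨i, h1, h2, h3⟩
    · rcases (by omega : m + 1 < γ.head ∨ m + 1 = γ.head) with h' | h'
      · rw [mem_sparseSet_head γ h'] at hm'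
        obtain ⟨a, ha⟩ := ho
        obtain ⟨b, hb⟩ := hm'
        omega
      · exact γ.not_mem_sparseSet_of_block_end (Or.inl h') hm'
    · rcases (by omega : m + 1 < γ.psum i + γ.parts i ∨ m + 1 = γ.psum i + γ.parts i) with h' | h'
      · rw [mem_sparseSet_block γ (by omega) h'] at hm'
        obtain ⟨a, ha⟩ := h3
        obtain ⟨b, hb⟩ := hm'.2
        omega
      · exact γ.not_mem_sparseSet_of_block_end (Or.inr ⟨i, h'⟩) hm'

/-- `J(γ) = [0, n-1] \ (F ∪ (F - 1))` for `F = sparseSet γ`. -/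
theorem J_eq (γ : AlmostOddComp n) :
    γ.J = Finset.range n \ (γ.sparseSet ∪ γ.sparseSet.image (fun m => m - 1)) := by
  have hsub := (Finset.mem_filter.1 γ.sparseSet_mem).1
  rw [Finset.mem_powerset] at hsub
  have him : ∀ m, m ∈ γ.sparseSet.image (fun m => m - 1) ↔ m + 1 ∈ γ.sparseSet := by
    intro m
    simp only [Finset.mem_image]
    constructor
    · rintro ⟨a, ha, rfl⟩
      have := Finset.mem_Icc.1 (hsub ha)
      rwa [Nat.sub_add_cancel this.1]
    · exact fun h => ⟨m + 1, h, rfl⟩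
  ext m
  simp only [Finset.mem_sdiff, Finset.mem_range, Finset.mem_union, him]
  by_cases hm : m < n
  swap
  · simp only [hm, false_and, iff_false]
    unfold J
    simp only [Finset.mem_image, Finset.mem_univ, true_and, not_exists]
    intro i hi
    have := γ.psum_add_le_n i
    obtain ⟨c, hc⟩ := γ.parts_odd i
    omega
  simp only [hm, true_and, not_or]
  rcases γ.cover hm with h | ⟨i, h1, h2⟩
  · have hJ : m ∉ γ.J := by
      unfold J
      simp only [Finset.mem_image, Finset.mem_univ, true_and, not_exists]
      intro i hi
      have := γ.head_le_psum i
      omega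
    simp only [hJ, false_iff, not_and, not_not, mem_sparseSet_head γ h, Nat.not_odd_iff_even]
    rintro ⟨a, ha⟩
    obtain ⟨b, hb⟩ := γ.head_even
    rw [mem_sparseSet_head γ (by omega)]
    exact ⟨a, by omega⟩
  · rw [mem_J_block γ h1 h2, mem_sparseSet_block γ h1 h2]
    obtain ⟨c, hc⟩ := γ.parts_odd i
    rcases (by omega : m + 1 < γ.psum i + γ.parts i ∨ m + 1 = γ.psum i + γ.parts i) with h' | h'
    · rw [mem_sparseSet_block γ (by omega) h']
      simp only [Nat.even_iff]
      omega
    · have := γ.not_mem_sparseSet_of_block_end (Or.inr ⟨i, h'⟩)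
      simp only [this, not_false_eq_true, and_true, Nat.even_iff]
      omega

/-- `sparseSet γ` is the only sparse subset `F` of `[n-1]` with
`J(γ) = [0, n-1] \ (F ∪ (F - 1))`. -/
theorem sparseSet_unique (γ : AlmostOddComp n) {G : Finset ℕ} (hG : G ∈ sparseSubsets n)
    (h : γ.J = Finset.range n \ (G ∪ G.image (fun m => m - 1))) : G = γ.sparseSet := by
  have aux : ∀ A B : Finset ℕ, A ∈ sparseSubsets n → B ∈ sparseSubsets n →
      Finset.range n \ (A ∪ A.image (fun m => m - 1)) =
        Finset.range n \ (B ∪ B.image (fun m => m - 1)) → A ⊆ B := by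
    intro A B hA hB hAB
    obtain ⟨hA1, hA2⟩ := Finset.mem_filter.1 hA
    obtain ⟨hB1, hB2⟩ := Finset.mem_filter.1 hB
    rw [Finset.mem_powerset] at hA1 hB1
    have him : ∀ C : Finset ℕ, C ⊆ Finset.Icc 1 (n - 1) → ∀ m,
        m ∈ C.image (fun m => m - 1) ↔ m + 1 ∈ C := by
      intro C hC m
      simp only [Finset.mem_image]
      constructor
      · rintro ⟨a, ha, rfl⟩
        have := Finset.mem_Icc.1 (hC ha)
        rwa [Nat.sub_add_cancel this.1]
      · exact fun h => ⟨m + 1, h, rfl⟩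
    have key : ∀ m, m < n → ((m ∈ A ∨ m + 1 ∈ A) ↔ (m ∈ B ∨ m + 1 ∈ B)) := by
      intro m hm
      have := Finset.ext_iff.1 hAB m
      simp only [Finset.mem_sdiff, Finset.mem_range, Finset.mem_union, him A hA1, him B hB1, hm,
        true_and] at this
      exact not_iff_not.1 this
    have lt : ∀ C : Finset ℕ, C ⊆ Finset.Icc 1 (n - 1) → ∀ m ∈ C, m < n := by
      intro C hC m hm
      have := Finset.mem_Icc.1 (hC hm)
      omega
    have main : ∀ d m, n - m ≤ d → m ∈ A → m ∈ B := by
      intro d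
      induction d with
      | zero => intro m hd hm; have := lt A hA1 m hm; omega
      | succ d ih =>
        intro m hd hm
        by_contra hmB
        have h1 : m + 1 ∈ B := ((key m (lt A hA1 m hm)).1 (Or.inl hm)).resolve_left hmB
        have h2 : m + 1 + 1 ∈ A :=
          ((key (m + 1) (lt B hB1 _ h1)).2 (Or.inl h1)).resolve_left (hA2 m hm)
        have h3 := lt A hA1 _ h2
        exact hB2 _ h1 (ih (m + 1 + 1) (by omega) h2)
    exact fun m hm => main _ m le_rfl hm
  have e := h.symm.trans γ.J_eq
  exact (aux _ _ hG γ.sparseSet_mem e).antisymm (aux _ _ γ.sparseSet_mem hG e.symm)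

end AlmostOddComp

/-- The Jacobson radical of a subalgebra `A` of `k S_n`, as a subspace of `k S_n`. -/
noncomputable def radicalSpace {k : Type*} [Field k] {n : ℕ}
    (A : Subalgebra k (MonoidAlgebra k (Equiv.Perm (Fin n)))) :
    Submodule k (MonoidAlgebra k (Equiv.Perm (Fin n))) :=
  ((Ring.jacobson A).restrictScalars k).map A.val.toLinearMap

end PeakAlg

/-!
The argument works inside `k S_n` with sums over signed words, which make the multiplication of the
peak algebra explicit, and then reduces the families `Q` and `O` to `Ō` by pure algebra.

**Product rule.** A word in letters `(b, ±)`, for `b` in an ordered set of blocks, and one more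
letter for the head, has a sorting permutation: positions are listed letter by letter, those of a
negative letter backwards. The sum `X c` of the sorting permutations of all words with block sizes
`c` is the image of a basis element of the descent algebra of type `B`. Sorting twice is sorting by
pairs of letters (`sortPerm_mul`), so `X c * X d` is the sum of `X e` over the matrices `e` with
margins `c` and `d` (`X_mul_X`). Counting the words with a given sorting permutation shows that
`X c` is, for `m` nonempty blocks, `2 ^ m` times the sum of the permutations whose peaks are at the
block starts or directly after them (`X_eq`). For an almost-odd composition `γ` this sum
is `Ō_γ`, that is, `X_γ = 2 ^ m • Ō_γ` (`AlmostOddComp.X_eq_smul_OBar`).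

**Radical.** Filter the peak algebra by the number of blocks. Each block of `d` contributes at
least one nonzero entry to a matrix `e`, so the filtration consists of left ideals; modulo more
blocks, `X c` acts on `X d` by the number of ways of merging the blocks of `d`, with signs, into
those of `c` (`X_mul_X_sub_mem`). This number does not depend on the order of the blocks of `c`.
Hence the differences `Ō_γ - Ō_{γ^t}` raise the filtration, and they lie in the radical
(`differenceSpace_le_radicalSpace`). Conversely, an element of the radical is, modulo differences, a
combination of the `Ō_ρ` over inequivalent representatives `ρ`. If it were nonzero, then for a
shortest `ρ` that occurs it would act on `X_ρ`, modulo more blocks, by a scalar that involves only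
the term of `ρ`; this scalar is nonzero because the number of self-couplings of `ρ` is `2 ^ m` times
the order of a subgroup of a symmetric group on at most `n` letters, which divides `n!`
(`card_couplings_self_ne_zero`). Since an element of the radical acts by no nonzero scalar, `X_ρ`
would be a combination of sums with more blocks; but the coefficient at `Q_ρ` vanishes on those and
not on `X_ρ` (`AlmostOddComp.X_notMem_filtration`). For `n ≤ 1`, where `2` may be zero in `k`, the
algebra is one-dimensional.

**The three families.** Let `N` and `y` be operators on sequences that depend on a set `G`: the
shift by one, and the shift by two restricted at `s` to the `G` that contain `s + 1`. The elements
`Q_γ`, `O_γ` and `Ō_γ` are the images under one linear map of products `h_{c} x_{a₁} ⋯ x_{aₘ}`,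
where `γ = (2c, 2a₁ + 1, …, 2aₘ + 1)` and `x_a = N h_a`, with `h_a` equal to `y ^ a`, to
`(N² - y) ^ a`, and to the component `z_{2a}` of degree `2a` of `(1 - N + y)⁻¹`, respectively. The
span of the differences is the product of the right module generated by the `h_a` with the
commutator ideal of the algebra generated by the `x_a`, so it is determined by these two
(`permDiff_le`), and they are the same for the three choices (`permDiff_sub_eq`,
`permDiff_geomSeq_eq`). The same operators show that the `Ō_γ` span the peak algebra
(`peakSpace_le_span_OBar`).
-/

namespace PeakAlg

/-! ### Sorting permutations of signed words -/

/-- The position of the cell in row `a` and column `b` when the rows of a table with `L` columns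
are read alternately from left to right (even rows) and from right to left (odd rows). -/
def snake (L a b : ℕ) : ℕ := if Even a then a * L + b else a * L + (L - 1 - b)

theorem snake_lt_snake_of_row_lt {L a a' b b' : ℕ} (hb : b < L) (h : a < a') :
    snake L a b < snake L a' b' := by
  have h1 : (a + 1) * L ≤ a' * L := Nat.mul_le_mul_right L h
  have h2 : (a + 1) * L = a * L + L := by ring
  unfold snake
  split_ifs <;> omega

theorem snake_lt_snake_even {L a b b' : ℕ} (ha : Even a) :
    snake L a b < snake L a b' ↔ b < b' := by
  simp [snake, ha]

theorem snake_lt_snake_odd {L a b b' : ℕ} (hb : b < L) (hb' : b' < L) (ha : ¬ Even a) :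
    snake L a b < snake L a b' ↔ b' < b := by
  simp only [snake, ha, if_false]
  omega

theorem snake_lt_snake_iff {L a a' b b' : ℕ} (hb : b < L) (hb' : b' < L) :
    snake L a b < snake L a' b' ↔
      a < a' ∨ a = a' ∧ (Even a ∧ b < b' ∨ ¬ Even a ∧ b' < b) := by
  rcases lt_trichotomy a a' with h | rfl | h
  · simp [snake_lt_snake_of_row_lt hb h, h]
  · by_cases ha : Even a
    · simp [snake_lt_snake_even ha, ha]
    · simp [snake_lt_snake_odd hb hb' ha, ha]
  · have := snake_lt_snake_of_row_lt (b' := b) hb' h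
    constructor
    · intro; omega
    · rintro (h' | ⟨h', -⟩) <;> omega

theorem snake_inj {L a a' b b' : ℕ} (hb : b < L) (hb' : b' < L)
    (h : snake L a b = snake L a' b') : a = a' ∧ b = b' := by
  have h1 := snake_lt_snake_iff (a := a) (a' := a') hb hb'
  have h2 := snake_lt_snake_iff (a := a') (a' := a) hb' hb
  rw [h] at h1 h2
  simp only [lt_self_iff_false, false_iff, not_or, not_and] at h1 h2
  have e : a = a' := by omega
  refine ⟨e, ?_⟩
  subst e
  by_cases ha : Even a
  · have := (h1.2 rfl).1 ha; have := (h2.2 rfl).1 ha; omega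
  · have := (h1.2 rfl).2 ha; have := (h2.2 rfl).2 ha; omega

theorem even_snake {L a b : ℕ} (hL : Odd L) (hb : b < L) :
    Even (snake L a b) ↔ (Even a ↔ Even b) := by
  obtain ⟨c, rfl⟩ := hL
  unfold snake
  split_ifs with ha
  · simp [Nat.even_add, ha]
  · have : Even (2 * c + 1 - 1 - b) ↔ Even b := by
      rw [Nat.even_iff, Nat.even_iff]; omega
    rw [Nat.even_add, this, Nat.even_mul]
    simp [ha]

section SortPerm

variable {n : ℕ}

/-- Comparison of these keys orders the positions `i` by the letter `f i`; positions with the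
same even letter keep their order, those with the same odd letter are reversed. -/
def sortKey (f : Fin n → ℕ) (i : Fin n) : ℕ := snake n (f i) i

theorem sortKey_lt_iff (f : Fin n → ℕ) (i j : Fin n) :
    sortKey f i < sortKey f j ↔
      f i < f j ∨ f i = f j ∧ (Even (f i) ∧ i < j ∨ ¬ Even (f i) ∧ j < i) := by
  unfold sortKey
  rw [snake_lt_snake_iff i.2 j.2]
  simp only [Fin.lt_def]

/-- The permutation whose one-line notation lists the positions `i` by increasing `f i`, the
positions of an even letter from left to right, those of an odd letter from right to left. -/
def sortPerm (f : Fin n → ℕ) : Equiv.Perm (Fin n) := Tuple.sort (sortKey f)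

theorem sortKey_injective (f : Fin n → ℕ) : Function.Injective (sortKey f) := by
  intro i j h
  exact Fin.ext (snake_inj i.2 j.2 h).2

theorem sortKey_sortPerm_strictMono (f : Fin n → ℕ) : StrictMono (sortKey f ∘ sortPerm f) :=
  (Tuple.monotone_sort (sortKey f)).strictMono_of_injective
    ((sortKey_injective f).comp (sortPerm f).injective)

theorem eq_sortPerm_iff (f : Fin n → ℕ) (w : Equiv.Perm (Fin n)) :
    sortPerm f = w ↔ StrictMono (sortKey f ∘ w) := by
  constructor
  · rintro rfl
    exact sortKey_sortPerm_strictMono f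
  · intro h
    have := Tuple.unique_monotone (sortKey_sortPerm_strictMono f).monotone h.monotone
    ext i
    exact congrArg _ (sortKey_injective f (congrFun this i))

theorem sortPerm_congr {f g : Fin n → ℕ}
    (h : ∀ i j, sortKey f i < sortKey f j ↔ sortKey g i < sortKey g j) :
    sortPerm f = sortPerm g := by
  rw [eq_sortPerm_iff]
  intro i j hij
  exact (h _ _).2 (sortKey_sortPerm_strictMono g hij)

/-- Sorting by `g`, then the result by `f`, is sorting by the pairs of letters. -/
theorem sortPerm_mul (f g : Fin n → ℕ) {L : ℕ} (hL : Odd L) (hg : ∀ i, g i < L) :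
    sortPerm g * sortPerm f =
      sortPerm (fun i => snake L (f ((sortPerm g)⁻¹ i)) (g i)) := by
  symm
  rw [eq_sortPerm_iff]
  intro p q hpq
  have h1 := sortKey_sortPerm_strictMono f hpq
  simp only [Function.comp] at h1
  have h2 : ∀ i j, sortKey g (sortPerm g i) < sortKey g (sortPerm g j) ↔ i < j := fun i j =>
    (sortKey_sortPerm_strictMono g).lt_iff_lt
  simp only [Function.comp, Equiv.Perm.mul_apply]
  generalize sortPerm f p = i at *
  generalize sortPerm f q = j at *
  have e : ∀ i, (sortPerm g)⁻¹ (sortPerm g i) = i := fun i => Equiv.symm_apply_apply _ i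
  have hi := h2 i j
  have hj := h2 j i
  rw [sortKey_lt_iff] at h1 hi hj ⊢
  simp only [e]
  have h3 := hg (sortPerm g i)
  have h4 := hg (sortPerm g j)
  generalize g (sortPerm g i) = a at *
  generalize g (sortPerm g j) = b at *
  rcases h1 with h1 | ⟨h1, h1'⟩
  · exact Or.inl (snake_lt_snake_of_row_lt h3 h1)
  · rw [← h1, even_snake hL h3]
    by_cases hev : Even (f i)
    · simp only [hev, true_and, not_true_eq_false, false_and, or_false, true_iff] at h1' ⊢
      rw [snake_lt_snake_even hev]
      rcases hi.2 h1' with h | ⟨rfl, h⟩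
      · exact Or.inl h
      · exact Or.inr ⟨rfl, h⟩
    · simp only [hev, false_and, not_false_eq_true, true_and, false_or, false_iff, not_not]
        at h1' ⊢
      rw [snake_lt_snake_odd h3 h4 hev]
      rcases hj.2 h1' with h | ⟨rfl, h⟩
      · exact Or.inl h
      · exact Or.inr ⟨rfl, h.symm⟩
end SortPerm

/-! ### Sums over signed words with prescribed block sizes -/

/-- Letters over a set `B` of blocks: the letter `none` of the head block, and for each block `b`
a negative letter `(b, false)` and a positive letter `(b, true)`. -/
abbrev Letter (B : Type) := Option (B × Bool)

/-- The block of a letter, `none` being the head block. -/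
def Letter.block {B : Type} (x : Letter B) : Option B := x.map Prod.fst

@[simp] theorem Letter.block_none {B : Type} : Letter.block (none : Letter B) = none := rfl

@[simp] theorem Letter.block_some {B : Type} (b : B) (s : Bool) :
    Letter.block (some (b, s)) = some b := rfl

/-- The place of a letter in the alphabet, when the blocks are ordered by `pos` after the head
block, and the negative letter of a block directly precedes the positive one. Odd codes are the
negative letters. -/
def code {B : Type} (pos : B → ℕ) : Letter B → ℕ
  | none => 0
  | some (b, false) => 2 * pos b + 1
  | some (b, true) => 2 * pos b + 2

@[simp] theorem code_none {B : Type} (pos : B → ℕ) : code pos none = 0 := rfl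

@[simp] theorem code_neg {B : Type} (pos : B → ℕ) (b : B) :
    code pos (some (b, false)) = 2 * pos b + 1 := rfl

@[simp] theorem code_pos {B : Type} (pos : B → ℕ) (b : B) :
    code pos (some (b, true)) = 2 * pos b + 2 := rfl

theorem code_injective {B : Type} {pos : B → ℕ} (h : Function.Injective pos) :
    Function.Injective (code pos) := by
  rintro (_ | ⟨b, _ | _⟩) (_ | ⟨b', _ | _⟩) hx <;> simp at hx ⊢ <;>
    first | exact h (by omega) | omega

/-- The number of positions of a word whose letter lies in the block `b`. -/
def blockCount {n : ℕ} {B : Type} [DecidableEq B] (f : Fin n → Letter B) (b : B) : ℕ :=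
  (Finset.univ.filter fun i => (f i).block = some b).card

/-- The words of length `n` whose number of letters in each block `b` is `c b`. -/
def words (n : ℕ) {B : Type} [Fintype B] [DecidableEq B] (c : B → ℕ) :
    Finset (Fin n → Letter B) :=
  Finset.univ.filter fun f => ∀ b, blockCount f b = c b

/-- The sum of the sorting permutations of the signed words with block sizes `c`. These are the
images in `k S_n` of the standard basis elements of the descent algebra of type `B`. -/
noncomputable def X (k : Type*) [Field k] (n : ℕ) {B : Type} [Fintype B] [DecidableEq B]
    (pos c : B → ℕ) : MonoidAlgebra k (Equiv.Perm (Fin n)) :=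
  ∑ f ∈ words n c, MonoidAlgebra.of k (Equiv.Perm (Fin n)) (sortPerm (code pos ∘ f))

section Product

variable {B B' : Type}

/-- The blocks of the product of two alphabets: a block of the second alphabet, paired with the
head of the first, or a block of the first alphabet paired with a letter of the second. -/
abbrev ProdBlock (B' B : Type) := B ⊕ B' × Letter B

/-- Pairs of letters, the row from `B'` and the column from `B`, as letters over `ProdBlock B' B`.
In a negative row the columns are read backwards, which negates the column letter. -/
def pairLetter : Letter B' × Letter B → Letter (ProdBlock B' B)
  | (none, none) => none
  | (none, some (j, t)) => some (Sum.inl j, t)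
  | (some (i, s), none) => some (Sum.inr (i, none), s)
  | (some (i, true), some (j, t)) => some (Sum.inr (i, some (j, true)), t)
  | (some (i, false), some (j, t)) => some (Sum.inr (i, some (j, false)), !t)

/-- The pair of letters behind a letter over `ProdBlock B' B`. -/
def unpairLetter : Letter (ProdBlock B' B) → Letter B' × Letter B
  | none => (none, none)
  | some (Sum.inl j, t) => (none, some (j, t))
  | some (Sum.inr (i, none), s) => (some (i, s), none)
  | some (Sum.inr (i, some (j, true)), t) => (some (i, true), some (j, t))
  | some (Sum.inr (i, some (j, false)), t) => (some (i, false), some (j, !t))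

/-- The bijection between pairs of letters and letters over the product blocks. -/
def letterProdEquiv : Letter B' × Letter B ≃ Letter (ProdBlock B' B) where
  toFun := pairLetter
  invFun := unpairLetter
  left_inv := by
    rintro ⟨_ | ⟨i, _ | _⟩, _ | ⟨j, t⟩⟩ <;> simp [pairLetter, unpairLetter]
  right_inv := by
    rintro (_ | ⟨j | ⟨i, _ | ⟨j, _ | _⟩⟩, t⟩) <;> simp [pairLetter, unpairLetter]

/-- The order of the product blocks, for `L` columns. It is chosen so that the code of a pair of
letters is its place in the snake reading of the table of pairs, see `code_pairLetter`. -/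
def prodPos (L : ℕ) (pos' : B' → ℕ) (pos : B → ℕ) : ProdBlock B' B → ℕ
  | Sum.inl j => pos j
  | Sum.inr (i, none) => L * (pos' i + 1) - 1
  | Sum.inr (i, some (j, true)) => L * (pos' i + 1) + pos j
  | Sum.inr (i, some (j, false)) => L * (pos' i + 1) - pos j - 2

theorem code_pairLetter {L : ℕ} {pos' : B' → ℕ} {pos : B → ℕ} (hL : Odd L)
    (h : ∀ x, code pos x < L) (x : Letter B') (y : Letter B) :
    code (prodPos L pos' pos) (pairLetter (x, y)) = snake L (code pos' x) (code pos y) := by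
  have hL1 : 1 ≤ L := hL.pos
  rcases x with _ | ⟨i, s⟩
  · rcases y with _ | ⟨j, _ | _⟩ <;> simp [pairLetter, snake, prodPos]
  · have h1 : L ≤ L * (pos' i + 1) := Nat.le_mul_of_pos_right _ (by omega)
    have ev : Even (2 * pos' i + 2) := by simp [parity_simps]
    have od : ¬ Even (2 * pos' i + 1) := by simp
    have e1 : (2 * pos' i + 2) * L = 2 * (L * (pos' i + 1)) := by ring
    have e2 : (2 * pos' i + 1) * L + L = 2 * (L * (pos' i + 1)) := by ring
    rcases y with _ | ⟨j, t⟩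
    · rcases s with _ | _
      · simp only [pairLetter, code_neg, prodPos, snake, od, if_false, code_none]
        omega
      · simp only [pairLetter, code_pos, prodPos, snake, ev, if_true, code_none]
        omega
    · have h2 := h (some (j, true))
      rcases s with _ | _ <;> rcases t with _ | _ <;>
        simp only [pairLetter, code_pos, code_neg, prodPos, snake, od, ev, if_true, if_false,
          Bool.not_true, Bool.not_false] at h2 ⊢ <;> omega

theorem prodPos_injective {L : ℕ} {pos' : B' → ℕ} {pos : B → ℕ} (hL : Odd L)
    (h : ∀ x, code pos x < L) (h' : Function.Injective pos') (hp : Function.Injective pos) :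
    Function.Injective (prodPos L pos' pos) := by
  intro b c hbc
  have key : ∀ z, code (prodPos L pos' pos) z =
      snake L (code pos' (unpairLetter z).1) (code pos (unpairLetter z).2) := by
    intro z
    rw [← code_pairLetter hL h]
    exact congrArg _ (letterProdEquiv.apply_symm_apply z).symm
  have e : code (prodPos L pos' pos) (some (b, true)) =
      code (prodPos L pos' pos) (some (c, true)) := by simp [hbc]
  rw [key, key] at e
  obtain ⟨e1, e2⟩ := snake_inj (h _) (h _) e
  have := letterProdEquiv.symm.injective
    (Prod.ext (code_injective h' e1) (code_injective hp e2) :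
      unpairLetter (some (b, true)) = unpairLetter (some (c, true)))
  simpa using this

variable [DecidableEq B] [DecidableEq B']

/-- The sizes of the blocks of the rows. -/
def rowSum [Fintype B] (e : ProdBlock B' B → ℕ) (i : B') : ℕ := ∑ x, e (Sum.inr (i, x))

/-- The sizes of the blocks of the columns. -/
def colSum [Fintype B'] (e : ProdBlock B' B → ℕ) (j : B) : ℕ :=
  e (Sum.inl j) + ∑ i, ∑ s, e (Sum.inr (i, some (j, s)))

theorem blockCount_fst [Fintype B] {n : ℕ} (h : Fin n → Letter (ProdBlock B' B)) (i : B') :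
    blockCount (fun p => (unpairLetter (h p)).1) i = rowSum (blockCount h) i := by
  unfold blockCount rowSum
  rw [← Finset.card_biUnion]
  · congr 1
    ext p
    simp only [Finset.mem_filter, Finset.mem_univ, true_and, Finset.mem_biUnion]
    rcases h p with (_ | ⟨j | ⟨i, _ | ⟨j, _ | _⟩⟩, t⟩) <;> simp [unpairLetter]
  · intro x _ y _ hxy
    rw [Function.onFun, Finset.disjoint_left]
    intro p hp hq
    simp only [Finset.mem_filter, Finset.mem_univ, true_and] at hp hq
    simp [hp] at hq
    exact hxy hq

theorem blockCount_snd [Fintype B'] {n : ℕ} (h : Fin n → Letter (ProdBlock B' B)) (j : B) :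
    blockCount (fun p => (unpairLetter (h p)).2) j = colSum (blockCount h) j := by
  unfold blockCount colSum
  simp_rw [← Finset.sum_product']
  rw [← Finset.card_biUnion, ← Finset.card_union_of_disjoint]
  · congr 1
    ext p
    simp only [Finset.mem_filter, Finset.mem_univ, true_and, Finset.mem_biUnion, Finset.mem_union,
      Finset.mem_product]
    rcases h p with (_ | ⟨j | ⟨i, _ | ⟨j, _ | _⟩⟩, t⟩) <;> simp [unpairLetter]
  · rw [Finset.disjoint_left]
    intro p hp hq
    simp only [Finset.mem_filter, Finset.mem_univ, true_and, Finset.mem_biUnion] at hp hq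
    simp [hp] at hq
  · intro x _ y _ hxy
    rw [Function.onFun, Finset.disjoint_left]
    intro p hp hq
    simp only [Finset.mem_filter, Finset.mem_univ, true_and] at hp hq
    simp [hp] at hq
    exact hxy (Prod.ext hq.1 hq.2)

/-- The matrices of block sizes with given row and column sums. -/
def matrices [Fintype B] [Fintype B'] (n : ℕ) (d : B' → ℕ) (c : B → ℕ) :
    Finset (ProdBlock B' B → ℕ) :=
  (Fintype.piFinset fun _ => Finset.range (n + 1)).filter
    fun e => (∀ i, rowSum e i = d i) ∧ ∀ j, colSum e j = c j

theorem blockCount_comp_perm {n : ℕ} (f : Fin n → Letter B) (w : Equiv.Perm (Fin n)) (b : B) :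
    blockCount (fun i => f (w i)) b = blockCount f b := by
  unfold blockCount
  rw [← Finset.card_map w.toEmbedding]
  congr 1
  ext i
  simp only [Finset.mem_map_equiv, Finset.mem_filter, Finset.mem_univ, true_and,
    Equiv.apply_symm_apply]

/-- The product rule of the descent algebra of type `B`, in `k S_n`. Both sides are sums over pairs
of words, read as one word over pairs of letters; `letterProdEquiv` turns these pairs into letters
over `ProdBlock B' B` in a way that respects the order and the signs. -/
theorem X_mul_X [Fintype B] [Fintype B'] (k : Type*) [Field k] (n : ℕ) {L : ℕ} (pos c : B → ℕ)
    (pos' d : B' → ℕ) (hL : Odd L) (h : ∀ x, code pos x < L) :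
    X k n pos c * X k n pos' d =
      ∑ e ∈ matrices n d c, X k n (prodPos L pos' pos) e := by
  -- for a fixed `g`, permuting the letters of `f` along the sorting of `g` permutes `words n d`
  have h1 : X k n pos c * X k n pos' d = ∑ g ∈ words n c, ∑ f ∈ words n d,
      MonoidAlgebra.of k _ (sortPerm (fun i => snake L (code pos' (f i)) (code pos (g i)))) := by
    unfold X
    rw [Finset.sum_mul_sum]
    refine Finset.sum_congr rfl fun g _ => ?_
    refine Finset.sum_nbij' (fun f i => f ((sortPerm (code pos ∘ g))⁻¹ i))
      (fun f i => f (sortPerm (code pos ∘ g) i)) ?_ ?_ ?_ ?_ ?_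
    · intro f hf
      simp only [words, Finset.mem_filter, Finset.mem_univ, true_and] at hf ⊢
      intro b
      rw [← hf b, ← blockCount_comp_perm f (sortPerm (code pos ∘ g))⁻¹]
    · intro f hf
      simp only [words, Finset.mem_filter, Finset.mem_univ, true_and] at hf ⊢
      intro b
      rw [← hf b, ← blockCount_comp_perm f (sortPerm (code pos ∘ g))]
    · intro f _; simp
    · intro f _; simp
    · intro f _
      rw [← map_mul, sortPerm_mul _ (code pos ∘ g) hL (fun i => h (g i))]
      rfl
  have h2 : ∑ e ∈ matrices n d c, X k n (prodPos L pos' pos) e =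
      ∑ w ∈ (Finset.univ : Finset (Fin n → Letter (ProdBlock B' B))).filter
        (fun w => blockCount w ∈ matrices n d c),
        MonoidAlgebra.of k _ (sortPerm (code (prodPos L pos' pos) ∘ w)) := by
    rw [← Finset.sum_fiberwise_of_maps_to (t := matrices n d c) (g := blockCount)
      (by intro w hw; exact (Finset.mem_filter.1 hw).2)]
    refine Finset.sum_congr rfl fun e he => ?_
    unfold X
    refine Finset.sum_congr ?_ fun _ _ => rfl
    ext w
    simp only [words, Finset.mem_filter, Finset.mem_univ, true_and, ← funext_iff]
    constructor
    · rintro rfl; exact ⟨he, rfl⟩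
    · exact fun hw => hw.2
  rw [h1, h2, ← Finset.sum_product']
  refine Finset.sum_nbij' (fun q p => pairLetter (q.2 p, q.1 p))
    (fun w => (fun p => (unpairLetter (w p)).2, fun p => (unpairLetter (w p)).1)) ?_ ?_ ?_ ?_ ?_
  · rintro ⟨g, f⟩ hq
    simp only [words, Finset.mem_product, Finset.mem_filter, Finset.mem_univ, true_and, matrices,
      Fintype.mem_piFinset, Finset.mem_range] at hq ⊢
    refine ⟨fun b => ?_, fun i => ?_, fun j => ?_⟩
    · exact Nat.lt_succ_of_le ((Finset.card_le_univ _).trans (by simp))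
    · rw [← blockCount_fst, ← hq.2 i]
      congr 1
      ext1 p
      exact congrArg Prod.fst (letterProdEquiv.symm_apply_apply (f p, g p))
    · rw [← blockCount_snd, ← hq.1 j]
      congr 1
      ext1 p
      exact congrArg Prod.snd (letterProdEquiv.symm_apply_apply (f p, g p))
  · intro w hw
    simp only [words, Finset.mem_product, Finset.mem_filter, Finset.mem_univ, true_and, matrices,
      Fintype.mem_piFinset, Finset.mem_range] at hw ⊢
    refine ⟨fun j => ?_, fun i => ?_⟩
    · rw [← hw.2.2 j, blockCount_snd]
    · rw [← hw.2.1 i, blockCount_fst]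
  · rintro ⟨g, f⟩ _
    refine Prod.ext ?_ ?_
    · ext1 p
      exact congrArg Prod.snd (letterProdEquiv.symm_apply_apply (f p, g p))
    · ext1 p
      exact congrArg Prod.fst (letterProdEquiv.symm_apply_apply (f p, g p))
  · intro w _
    ext1 p
    exact letterProdEquiv.apply_symm_apply (w p)
  · rintro ⟨g, f⟩ _
    simp only [Function.comp_def, code_pairLetter hL h]

end Product

/-- An odd bound for the codes of the letters. -/
theorem exists_odd_bound {B : Type} [Fintype B] (pos : B → ℕ) :
    ∃ L, Odd L ∧ ∀ x, code pos x < L := by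
  refine ⟨2 * (∑ b, pos b) + 3, ⟨(∑ b, pos b) + 1, by ring⟩, ?_⟩
  have h : ∀ b, pos b ≤ ∑ b, pos b := fun b =>
    Finset.single_le_sum (fun _ _ => Nat.zero_le _) (Finset.mem_univ b)
  rintro (_ | ⟨b, _ | _⟩)
  · simp
  · have := h b
    simp only [code_neg]; omega
  · have := h b
    simp only [code_pos]; omega

/-! ### The filtration by the number of blocks -/

section Relabel

variable {B B' : Type} {n : ℕ}

theorem code_map_lt_iff {pos : B → ℕ} {pos' : B' → ℕ} {ι : B' → B}
    (hι : ∀ a b, pos (ι a) < pos (ι b) ↔ pos' a < pos' b) (x y : Letter B') :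
    code pos (x.map (Prod.map ι id)) < code pos (y.map (Prod.map ι id)) ↔
      code pos' x < code pos' y := by
  rcases x with _ | ⟨a, _ | _⟩ <;> rcases y with _ | ⟨b, _ | _⟩ <;> simp <;>
    (have h1 := hι a b; have h2 := hι b a; omega)

theorem even_code_map {pos : B → ℕ} {pos' : B' → ℕ} {ι : B' → B} (x : Letter B') :
    Even (code pos (x.map (Prod.map ι id))) ↔ Even (code pos' x) := by
  rcases x with _ | ⟨a, _ | _⟩ <;> simp [parity_simps]

variable [Fintype B] [Fintype B'] [DecidableEq B] [DecidableEq B']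

/-- Blocks of size `0` may be dropped, and only the relative order of the blocks matters. -/
theorem X_relabel (k : Type*) [Field k] {pos e : B → ℕ} {pos' d : B' → ℕ} (ι : B' → B)
    (hp : Function.Injective pos') (hι : ∀ a b, pos (ι a) < pos (ι b) ↔ pos' a < pos' b)
    (he : ∀ a, e (ι a) = d a) (h0 : ∀ b, b ∉ Set.range ι → e b = 0) :
    X k n pos e = X k n pos' d := by
  have hinj : Function.Injective ι := by
    intro a b hab
    have h1 := hι a b
    have h2 := hι b a
    rw [hab] at h1 h2
    exact hp (by omega)
  have hblock : ∀ (x : Letter B') (a : B'),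
      Letter.block (x.map (Prod.map ι id) : Letter B) = some (ι a) ↔ x.block = some a := by
    rintro (_ | ⟨b, s⟩) a
    · simp
    · simp [hinj.eq_iff]
  symm
  unfold X
  refine Finset.sum_bij (fun f _ i => (f i).map (Prod.map ι id)) ?_ ?_ ?_ ?_
  · intro f hf
    simp only [words, Finset.mem_filter, Finset.mem_univ, true_and] at hf ⊢
    intro b
    by_cases hb : b ∈ Set.range ι
    · obtain ⟨a, rfl⟩ := hb
      rw [he, ← hf a]
      simp only [blockCount, hblock]
    · rw [h0 b hb]
      rw [blockCount, Finset.card_eq_zero, Finset.filter_eq_empty_iff]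
      intro i _ hi
      rcases hx : f i with _ | ⟨a, s⟩
      · simp [hx] at hi
      · simp [hx] at hi
        exact hb ⟨a, hi⟩
  · intro f _ g _ hfg
    ext1 i
    exact Option.map_injective (hinj.prodMap Function.injective_id) (congrFun hfg i)
  · intro g hg
    simp only [words, Finset.mem_filter, Finset.mem_univ, true_and] at hg
    have hex : ∀ i, ∃ x : Letter B', x.map (Prod.map ι id) = g i := by
      intro i
      rcases hx : g i with _ | ⟨b, s⟩
      · exact ⟨none, rfl⟩
      · by_cases hb : b ∈ Set.range ι
        · obtain ⟨a, rfl⟩ := hb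
          exact ⟨some (a, s), rfl⟩
        · have h1 := hg b
          rw [h0 b hb, blockCount, Finset.card_eq_zero, Finset.filter_eq_empty_iff] at h1
          exact absurd (by simp [hx]) (h1 (Finset.mem_univ i))
    choose f hf using hex
    refine ⟨f, ?_, funext hf⟩
    simp only [words, Finset.mem_filter, Finset.mem_univ, true_and]
    intro a
    rw [← he a, ← hg (ι a)]
    simp only [blockCount, ← hf, hblock]
  · intro f _
    congr 1
    refine sortPerm_congr fun i j => ?_
    have h1 := code_map_lt_iff hι (f i) (f j)
    have h2 := code_map_lt_iff hι (f j) (f i)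
    have h3 := even_code_map (pos := pos) (pos' := pos') (ι := ι) (f i)
    simp only [sortKey_lt_iff, Function.comp]
    rw [← h3, ← h1]
    have : code pos' (f i) = code pos' (f j) ↔
      code pos ((f i).map (Prod.map ι id)) = code pos ((f j).map (Prod.map ι id)) := by omega
    rw [this]

theorem sum_blockCount_le (f : Fin n → Letter B) : ∑ b, blockCount f b ≤ n := by
  unfold blockCount
  rw [← Finset.card_biUnion]
  · exact (Finset.card_le_univ _).trans (by simp)
  · intro x _ y _ hxy
    rw [Function.onFun, Finset.disjoint_left]
    intro p hp hq
    simp only [Finset.mem_filter, Finset.mem_univ, true_and] at hp hq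
    simp [hp] at hq
    exact hxy hq

theorem X_eq_zero (k : Type*) [Field k] (pos : B → ℕ) {c : B → ℕ} (h : n < ∑ b, c b) :
    X k n pos c = 0 := by
  unfold X
  rw [Finset.sum_eq_zero]
  intro f hf
  simp only [words, Finset.mem_filter, Finset.mem_univ, true_and] at hf
  have := sum_blockCount_le f
  simp only [hf] at this
  omega

end Relabel

/-- The span of the elements `X k n pos c` with at least `m` blocks, all of them nonempty. -/
noncomputable def filtration (k : Type*) [Field k] (n m : ℕ) :
    Submodule k (MonoidAlgebra k (Equiv.Perm (Fin n))) :=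
  Submodule.span k {x | ∃ (B : Type) (_ : Fintype B) (_ : DecidableEq B) (pos c : B → ℕ),
    Function.Injective pos ∧ (∀ b, 0 < c b) ∧ m ≤ Fintype.card B ∧ x = X k n pos c}

section Filtration

variable (k : Type*) [Field k] (n : ℕ) {B B' : Type} [Fintype B] [Fintype B'] [DecidableEq B]
  [DecidableEq B']

theorem filtration_antitone {m m' : ℕ} (h : m ≤ m') : filtration k n m' ≤ filtration k n m := by
  refine Submodule.span_mono ?_
  rintro x ⟨B, i1, i2, pos, c, h1, h2, h3, h4⟩
  exact ⟨B, i1, i2, pos, c, h1, h2, h.trans h3, h4⟩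

theorem filtration_eq_bot {m : ℕ} (h : n < m) : filtration k n m = ⊥ := by
  rw [filtration, Submodule.span_eq_bot]
  rintro x ⟨B, i1, i2, pos, c, h1, h2, h3, rfl⟩
  refine X_eq_zero k pos ?_
  have : ∑ b : B, 1 ≤ ∑ b, c b := Finset.sum_le_sum fun b _ => h2 b
  simp at this
  omega

theorem X_mem_filtration_of_support {m : ℕ} {pos : B → ℕ} (hp : Function.Injective pos)
    (e : B → ℕ) (hm : m ≤ (Finset.univ.filter fun b => e b ≠ 0).card) :
    X k n pos e ∈ filtration k n m := by
  have : X k n pos e = X k n (fun b : {b // e b ≠ 0} => pos b) (fun b => e b) := by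
    refine X_relabel k Subtype.val (hp.comp Subtype.val_injective) (fun _ _ => Iff.rfl)
      (fun _ => rfl) ?_
    intro b hb
    by_contra h
    exact hb ⟨⟨b, h⟩, rfl⟩
  rw [this]
  refine Submodule.subset_span ⟨_, inferInstance, inferInstance, _, _,
    hp.comp Subtype.val_injective, fun b => Nat.pos_of_ne_zero b.2, ?_, rfl⟩
  rwa [Fintype.card_subtype]

/-- The ways of merging the blocks of sizes `d`, each with a sign or into the head, to obtain
blocks of sizes `c`. -/
def couplings (d : B' → ℕ) (c : B → ℕ) : Finset (B' → Letter B) :=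
  Finset.univ.filter fun φ =>
    ∀ j, ∑ i ∈ Finset.univ.filter (fun i => (φ i).block = some j), d i = c j

/-- The matrix with one nonzero entry `d i` in each row `i`, in the column `φ i`. -/
def couplingMatrix (d : B' → ℕ) (φ : B' → Letter B) : ProdBlock B' B → ℕ
  | Sum.inl _ => 0
  | Sum.inr (i, x) => if x = φ i then d i else 0

omit [Fintype B'] [DecidableEq B'] in
theorem rowSum_couplingMatrix (d : B' → ℕ) (φ : B' → Letter B) (i : B') :
    rowSum (couplingMatrix d φ) i = d i := by
  simp [rowSum, couplingMatrix]

omit [Fintype B] [DecidableEq B'] in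
theorem colSum_couplingMatrix (d : B' → ℕ) (φ : B' → Letter B) (j : B) :
    colSum (couplingMatrix d φ) j =
      ∑ i ∈ Finset.univ.filter (fun i => (φ i).block = some j), d i := by
  simp only [colSum, couplingMatrix, zero_add]
  rw [Finset.sum_filter]
  refine Finset.sum_congr rfl fun i _ => ?_
  rcases φ i with _ | ⟨b, _ | _⟩ <;> simp [eq_comm]

/-- A matrix with nonzero rows has a nonzero entry in each row, and exactly one of them only if it
is a `couplingMatrix`. -/
theorem le_card_support_of_mem_matrices {d : B' → ℕ} {c : B → ℕ} {e : ProdBlock B' B → ℕ}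
    (hd : ∀ i, 0 < d i) (he : e ∈ matrices n d c) :
    Fintype.card B' ≤ (Finset.univ.filter fun b => e b ≠ 0).card ∧
      ((∃ φ ∈ couplings d c, e = couplingMatrix d φ) ∨
        Fintype.card B' + 1 ≤ (Finset.univ.filter fun b => e b ≠ 0).card) := by
  simp only [matrices, Finset.mem_filter] at he
  obtain ⟨-, hrow, hcol⟩ := he
  have hex : ∀ i, ∃ x, e (Sum.inr (i, x)) ≠ 0 := by
    intro i
    by_contra! h
    have := hrow i
    rw [rowSum, Finset.sum_eq_zero (fun x _ => h x)] at this
    exact (hd i).ne this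
  choose φ hφ using hex
  set S : Finset (ProdBlock B' B) := Finset.univ.image fun i => Sum.inr (i, φ i) with hS
  have hScard : S.card = Fintype.card B' := by
    rw [hS, Finset.card_image_of_injective _ (fun i j h => (Prod.ext_iff.1 (Sum.inr.inj h)).1)]
    rfl
  have hSsub : S ⊆ Finset.univ.filter fun b => e b ≠ 0 := by
    intro b hb
    obtain ⟨i, -, rfl⟩ := Finset.mem_image.1 hb
    simp [hφ i]
  refine ⟨hScard ▸ Finset.card_le_card hSsub, ?_⟩
  by_cases heq : S = Finset.univ.filter fun b => e b ≠ 0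
  · left
    have h0 : ∀ b, b ∉ S → e b = 0 := by
      intro b hb
      rw [heq] at hb
      simpa using hb
    have hrow' : ∀ i x, x ≠ φ i → e (Sum.inr (i, x)) = 0 := by
      intro i x hx
      refine h0 _ fun h => ?_
      obtain ⟨i', -, h⟩ := Finset.mem_image.1 h
      simp only [Sum.inr.injEq, Prod.mk.injEq] at h
      obtain ⟨rfl, rfl⟩ := h
      exact hx rfl
    have he : e = couplingMatrix d φ := by
      ext b
      rcases b with j | ⟨i, x⟩
      · refine h0 _ fun h => ?_
        obtain ⟨i', -, h⟩ := Finset.mem_image.1 h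
        simp at h
      · simp only [couplingMatrix]
        split_ifs with hx
        · subst hx
          rw [← hrow i, rowSum, Finset.sum_eq_single (φ i) (fun x _ hx => hrow' i x hx) (by simp)]
        · exact hrow' i x hx
    refine ⟨φ, ?_, he⟩
    simp only [couplings, Finset.mem_filter, Finset.mem_univ, true_and]
    intro j
    rw [← colSum_couplingMatrix, ← he, hcol]
  · right
    have := Finset.card_lt_card (hSsub.ssubset_of_ne heq)
    omega

/-- Only the order of the blocks of `d` survives in the place of the blocks of the matrix. -/
theorem X_couplingMatrix {L : ℕ} {pos : B → ℕ} {pos' : B' → ℕ} (h : ∀ x, code pos x < L)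
    (hp' : Function.Injective pos') (d : B' → ℕ) (φ : B' → Letter B) :
    X k n (prodPos L pos' pos) (couplingMatrix d φ) = X k n pos' d := by
  refine X_relabel k (fun i => Sum.inr (i, φ i)) hp' ?_ (by simp [couplingMatrix]) ?_
  · have key : ∀ i j : B', pos' i < pos' j →
        prodPos L pos' pos (Sum.inr (i, φ i)) < prodPos L pos' pos (Sum.inr (j, φ j)) := by
      intro i j hij
      have h1 : L * (pos' i + 1) + L ≤ L * (pos' j + 1) := by
        calc L * (pos' i + 1) + L = L * (pos' i + 1 + 1) := by ring
          _ ≤ _ := Nat.mul_le_mul_left L (by omega)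
      have h0 := h none
      have hx : ∀ b, 2 * pos b + 2 < L := fun b => h (some (b, true))
      have aux : ∀ x : Letter B, prodPos L pos' pos (Sum.inr (i, x)) < L * (pos' i + 1) + L / 2 := by
        rintro (_ | ⟨b, _ | _⟩) <;> simp only [prodPos]
        · simp at h0
          have : 0 < L * (pos' i + 1) := by positivity
          omega
        · have := hx b; omega
        · have := hx b; omega
      have aux' : ∀ x : Letter B, L * (pos' i + 1) + L / 2 ≤ prodPos L pos' pos (Sum.inr (j, x)) := by
        rintro (_ | ⟨b, _ | _⟩) <;> simp only [prodPos]
        · simp at h0; omega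
        · have := hx b; omega
        · have := hx b; omega
      exact (aux _).trans_le (aux' _)
    intro i j
    refine ⟨fun hlt => ?_, key i j⟩
    rcases lt_trichotomy (pos' i) (pos' j) with h | h | h
    · exact h
    · obtain rfl := hp' h
      exact absurd hlt (lt_irrefl _)
    · exact absurd hlt (key j i h).not_gt
  · rintro (j | ⟨i, x⟩) hb
    · rfl
    · simp only [couplingMatrix]
      rw [if_neg]
      rintro rfl
      exact hb ⟨i, rfl⟩

/-- Modulo more blocks, left multiplication by `X c` acts on `X d` as a scalar. -/
theorem X_mul_X_sub_mem {pos c : B → ℕ} {pos' d : B' → ℕ}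
    (hp : Function.Injective pos) (hp' : Function.Injective pos') (hd : ∀ i, 0 < d i) :
    X k n pos c * X k n pos' d - ((couplings d c).card : k) • X k n pos' d ∈
      filtration k n (Fintype.card B' + 1) := by
  classical
  by_cases hn : n < ∑ i, d i
  · rw [X_eq_zero k pos' hn]; simp
  obtain ⟨L, hL, hb⟩ := exists_odd_bound pos
  have hlead : ∀ φ ∈ couplings d c, couplingMatrix d φ ∈ matrices n d c := by
    intro φ hφ
    simp only [couplings, Finset.mem_filter, Finset.mem_univ, true_and] at hφ
    simp only [matrices, Finset.mem_filter, Fintype.mem_piFinset, Finset.mem_range,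
      rowSum_couplingMatrix, colSum_couplingMatrix, hφ, implies_true, and_true]
    have : ∀ i, d i < n + 1 := fun i =>
      Nat.lt_succ_of_le ((Finset.single_le_sum (fun _ _ => Nat.zero_le _)
        (Finset.mem_univ i)).trans (not_lt.1 hn))
    rintro (j | ⟨i, x⟩) <;> simp only [couplingMatrix]
    · omega
    · have := this i
      split_ifs <;> omega
  have hinj : Set.InjOn (couplingMatrix (B := B) d) (couplings d c : Set (B' → Letter B)) := by
    intro φ _ ψ _ h
    ext1 i
    by_contra hne
    have := congrFun h (Sum.inr (i, φ i))
    simp only [couplingMatrix, if_true, if_neg hne] at this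
    exact (hd i).ne' this
  rw [X_mul_X k n pos c pos' d hL hb,
    ← Finset.sum_sdiff (s₁ := (couplings d c).image (couplingMatrix d)) (by
      intro e he
      obtain ⟨φ, hφ, rfl⟩ := Finset.mem_image.1 he
      exact hlead φ hφ),
    Finset.sum_image hinj]
  simp only [X_couplingMatrix k n hb hp', Finset.sum_const, ← Nat.cast_smul_eq_nsmul k,
    add_sub_cancel_right]
  refine Submodule.sum_mem _ fun e he => ?_
  rw [Finset.mem_sdiff] at he
  refine X_mem_filtration_of_support k n (prodPos_injective hL hb hp' hp) e ?_
  refine (le_card_support_of_mem_matrices n hd he.1).2.resolve_left ?_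
  rintro ⟨φ, hφ, rfl⟩
  exact he.2 (Finset.mem_image_of_mem _ hφ)

/-- Left multiplication does not lower the number of blocks: each row of a matrix in the product
rule has a nonzero entry. -/
theorem X_mul_X_mem {pos c : B → ℕ} {pos' d : B' → ℕ}
    (hp : Function.Injective pos) (hp' : Function.Injective pos') (hd : ∀ i, 0 < d i) :
    X k n pos c * X k n pos' d ∈ filtration k n (Fintype.card B') := by
  obtain ⟨L, hL, hb⟩ := exists_odd_bound pos
  rw [X_mul_X k n pos c pos' d hL hb]
  exact Submodule.sum_mem _ fun e he => X_mem_filtration_of_support k n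
    (prodPos_injective hL hb hp' hp) e (le_card_support_of_mem_matrices n hd he).1

/-- The filtration consists of left ideals of its first term. -/
theorem filtration_mul_mem {m : ℕ} {x y : MonoidAlgebra k (Equiv.Perm (Fin n))}
    (hx : x ∈ filtration k n 0) (hy : y ∈ filtration k n m) : x * y ∈ filtration k n m := by
  refine Submodule.span_induction₂ (p := fun x y _ _ => x * y ∈ filtration k n m)
    ?_ ?_ ?_ ?_ ?_ ?_ ?_ hx hy
  · rintro x y ⟨B, _, _, pos, c, h1, h2, h3, rfl⟩ ⟨B', _, _, pos', d, h1', h2', h3', rfl⟩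
    exact filtration_antitone k n h3' (X_mul_X_mem k n h1 h1' h2')
  · intros; simp
  · intros; simp
  · intro x y z _ _ _ h h'; rw [add_mul]; exact add_mem h h'
  · intro x y z _ _ _ h h'; rw [mul_add]; exact add_mem h h'
  · intro r x y _ _ h; rw [smul_mul_assoc]; exact Submodule.smul_mem _ _ h
  · intro r x y _ _ h; rw [mul_smul_comm]; exact Submodule.smul_mem _ _ h

end Filtration

section Couplings

variable {B B' : Type} [Fintype B] [Fintype B'] [DecidableEq B] [DecidableEq B']

theorem card_couplings_comp_perm (d : B' → ℕ) (c : B → ℕ) (t : Equiv.Perm B) :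
    (couplings d fun j => c (t j)).card = (couplings d c).card := by
  have hb : ∀ (t : Equiv.Perm B) (x : Letter B) (j : B),
      Letter.block (x.map (Prod.map t id) : Letter B) = some j ↔ x.block = some (t.symm j) := by
    rintro t (_ | ⟨b, s⟩) j
    · simp
    · simp [Equiv.eq_symm_apply]
  refine Finset.card_nbij' (fun φ i => (φ i).map (Prod.map t id))
    (fun φ i => (φ i).map (Prod.map t.symm id)) ?_ ?_ ?_ ?_
  · intro φ hφ
    simp only [couplings, Finset.coe_filter, Set.mem_ofPred_eq, Finset.mem_univ, true_and, hb]
      at hφ ⊢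
    intro j
    rw [hφ, Equiv.apply_symm_apply]
  · intro φ hφ
    simp only [couplings, Finset.coe_filter, Set.mem_ofPred_eq, Finset.mem_univ, true_and, hb,
      Equiv.symm_symm] at hφ ⊢
    intro j
    exact hφ (t j)
  · intro φ _
    ext1 i
    rcases h : φ i with _ | ⟨b, s⟩ <;> simp [h]
  · intro φ _
    ext1 i
    rcases h : φ i with _ | ⟨b, s⟩ <;> simp [h]

/-- Every block of `c` is obtained from some block of `d`. -/
theorem exists_injective_of_mem_couplings {d : B' → ℕ} {c : B → ℕ} (hc : ∀ j, 0 < c j)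
    {φ : B' → Letter B} (hφ : φ ∈ couplings d c) :
    ∃ σ : B → B', Function.Injective σ ∧ ∀ j, (φ (σ j)).block = some j := by
  simp only [couplings, Finset.mem_filter, Finset.mem_univ, true_and] at hφ
  have hex : ∀ j, ∃ i, (φ i).block = some j := by
    intro j
    by_contra! h
    have := hφ j
    rw [Finset.filter_eq_empty_iff.2 (fun i _ => h i), Finset.sum_empty] at this
    exact (hc j).ne this
  choose σ hσ using hex
  refine ⟨σ, fun a b h => ?_, hσ⟩
  have := (hσ a).symm.trans ((congrArg (fun i => (φ i).block) h).trans (hσ b))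
  simpa using this

theorem card_le_of_couplings_nonempty {d : B' → ℕ} {c : B → ℕ} (hc : ∀ j, 0 < c j)
    (h : (couplings d c).Nonempty) : Fintype.card B ≤ Fintype.card B' := by
  obtain ⟨φ, hφ⟩ := h
  obtain ⟨σ, hσ, -⟩ := exists_injective_of_mem_couplings hc hφ
  exact Fintype.card_le_of_injective σ hσ

/-- With equally many blocks, a coupling is a signed bijection that preserves the sizes. -/
theorem exists_equiv_of_mem_couplings {d : B' → ℕ} {c : B → ℕ} (hc : ∀ j, 0 < c j)
    (hcard : Fintype.card B = Fintype.card B') {φ : B' → Letter B} (hφ : φ ∈ couplings d c) :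
    ∃ σ : B ≃ B', (∀ j, (φ (σ j)).block = some j) ∧ ∀ j, d (σ j) = c j := by
  obtain ⟨σ, hσ, hb⟩ := exists_injective_of_mem_couplings hc hφ
  have hbij : Function.Bijective σ := (Fintype.bijective_iff_injective_and_card σ).2 ⟨hσ, hcard⟩
  refine ⟨Equiv.ofBijective σ hbij, hb, fun j => ?_⟩
  simp only [couplings, Finset.mem_filter, Finset.mem_univ, true_and] at hφ
  rw [← hφ j]
  have : Finset.univ.filter (fun i => (φ i).block = some j) = {σ j} := by
    ext i
    simp only [Finset.mem_filter, Finset.mem_univ, true_and, Finset.mem_singleton]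
    constructor
    · intro h
      obtain ⟨j', rfl⟩ := hbij.2 i
      rw [hb j'] at h
      simp only [Option.some.injEq] at h
      rw [h]
    · rintro rfl; exact hb j
  rw [this, Finset.sum_singleton]
  rfl

/-- The permutations of the blocks that preserve the sizes. -/
def sizeStabilizer (d : B → ℕ) : Subgroup (Equiv.Perm B) where
  carrier := {t | ∀ j, d (t j) = d j}
  mul_mem' := by
    intro s t hs ht j
    rw [Equiv.Perm.mul_apply, hs, ht]
  one_mem' := fun _ => rfl
  inv_mem' := by
    intro t ht j
    have := ht (t⁻¹ j)
    rw [show t (t⁻¹ j) = j from Equiv.apply_symm_apply t j] at this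
    exact this.symm

theorem card_couplings_self {d : B → ℕ} (hd : ∀ j, 0 < d j) :
    (couplings d d).card = Nat.card (sizeStabilizer d) * 2 ^ Fintype.card B := by
  classical
  have e : (couplings d d).card = Nat.card (sizeStabilizer d × (B → Bool)) := by
    rw [Nat.card_eq_fintype_card]
    symm
    refine Finset.card_bij (fun q _ i => some ((q.1 : Equiv.Perm B) i, q.2 i)) ?_ ?_ ?_
    · rintro ⟨⟨t, ht⟩, s⟩ -
      simp only [couplings, Finset.mem_filter, Finset.mem_univ, true_and, Letter.block_some,
        Option.some.injEq]
      intro j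
      have : Finset.univ.filter (fun i => t i = j) = {t.symm j} := by
        ext i
        simp [Equiv.eq_symm_apply]
      rw [this, Finset.sum_singleton, ← ht, Equiv.apply_symm_apply]
    · rintro ⟨⟨t, ht⟩, s⟩ - ⟨⟨t', ht'⟩, s'⟩ - h
      have h1 : ∀ i, t i = t' i ∧ s i = s' i := fun i => by simpa using congrFun h i
      obtain rfl : t = t' := Equiv.ext fun i => (h1 i).1
      obtain rfl : s = s' := funext fun i => (h1 i).2
      rfl
    · intro φ hφ
      obtain ⟨σ, hσ, hdσ⟩ := exists_equiv_of_mem_couplings hd rfl hφ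
      refine ⟨⟨⟨σ.symm, fun j => ?_⟩, fun i => ((φ i).map Prod.snd).getD true⟩,
        Finset.mem_univ _, ?_⟩
      · rw [← hdσ, Equiv.apply_symm_apply]
      · ext1 i
        obtain ⟨j, rfl⟩ := σ.surjective i
        have := hσ j
        rcases h : φ (σ j) with _ | ⟨b, s⟩
        · simp [h] at this
        · simp [h] at this
          simp [h, this]
  rw [e, Nat.card_prod]
  simp

/-- `X d` acts on its own class by a nonzero scalar: a stabilizer in a symmetric group on at most
`n` letters has order dividing `n!`. -/
theorem card_couplings_self_ne_zero {k : Type*} [Field k] {n : ℕ} (h2 : (2 : k) ≠ 0)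
    (hn : (n.factorial : k) ≠ 0) {d : B → ℕ} (hd : ∀ j, 0 < d j) (hsum : ∑ j, d j ≤ n) :
    ((couplings d d).card : k) ≠ 0 := by
  have hB : Fintype.card B ≤ n := by
    have : ∑ b : B, 1 ≤ ∑ b, d b := Finset.sum_le_sum fun b _ => hd b
    simp at this
    omega
  have hdvd : Nat.card (sizeStabilizer d) ∣ n.factorial := by
    refine (Subgroup.card_subgroup_dvd_card _).trans ?_
    rw [Nat.card_perm, Nat.card_eq_fintype_card]
    exact Nat.factorial_dvd_factorial hB
  obtain ⟨q, hq⟩ := hdvd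
  rw [card_couplings_self hd]
  push_cast
  refine mul_ne_zero (fun h => hn ?_) (pow_ne_zero _ h2)
  rw [hq]
  push_cast
  rw [h, zero_mul]

end Couplings

/-! ### Signed words and peak sets -/

/-- The sum of the permutations all of whose peaks lie in `J ∪ (J + 1)`. -/
noncomputable def V (k : Type*) [Field k] (n : ℕ) (J : Finset ℕ) :
    MonoidAlgebra k (Equiv.Perm (Fin n)) :=
  ∑ w ∈ (Finset.univ : Finset (Equiv.Perm (Fin n))).filter
    (fun w => ∀ i ∈ peak w, i ∈ J ∨ i - 1 ∈ J), MonoidAlgebra.of k (Equiv.Perm (Fin n)) w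

theorem value_succ {n : ℕ} (w : Equiv.Perm (Fin n)) (p : Fin n) :
    value w (p + 1) = (w p : ℕ) + 1 := by
  unfold value
  rw [dif_pos ⟨by omega, by omega⟩]
  rfl

theorem value_zero {n : ℕ} (w : Equiv.Perm (Fin n)) : value w 0 = 0 := by
  simp [value]

/-- Between an ascent and a later descent there is a peak. -/
theorem exists_peak_between {n : ℕ} (w : Equiv.Perm (Fin n)) {x y : ℕ} (hxy : x ≤ y) (hy : y < n)
    (hx : value w x < value w (x + 1)) (hd : value w (y + 1) < value w y) :
    ∃ i ∈ peak w, x < i ∧ i ≤ y := by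
  have hex : ∃ z, x ≤ z ∧ value w (z + 1) < value w z := ⟨y, hxy, hd⟩
  classical
  obtain ⟨h1, h2⟩ := Nat.find_spec hex
  have h3 : Nat.find hex ≤ y := Nat.find_min' hex ⟨hxy, hd⟩
  have h4 := fun m => Nat.find_min hex (m := m)
  generalize Nat.find hex = z at *
  have hxz : x < z := by
    rcases h1.lt_or_eq with h | rfl
    · exact h
    · omega
  refine ⟨z, ?_, hxz, h3⟩
  simp only [peak, Finset.mem_filter, Finset.mem_Icc]
  refine ⟨by omega, ?_, h2⟩
  have h5 := h4 (z - 1) (by omega)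
  rw [Nat.sub_add_cancel (by omega)] at h5
  have h6 : ¬ value w z < value w (z - 1) := fun h => h5 ⟨by omega, h⟩
  refine lt_of_le_of_ne (not_lt.1 h6) fun he => ?_
  by_cases hz : z = 1
  · subst hz
    have := value_succ w ⟨0, by omega⟩
    simp [value_zero] at he this
    omega
  · have e1 := value_succ w ⟨z - 2, by omega⟩
    have e2 := value_succ w ⟨z - 1, by omega⟩
    simp only at e1 e2
    rw [show z - 2 + 1 = z - 1 by omega] at e1
    rw [show z - 1 + 1 = z by omega] at e2
    have : w ⟨z - 2, by omega⟩ = w ⟨z - 1, by omega⟩ := Fin.ext (by omega)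
    have := Fin.ext_iff.1 (w.injective this)
    simp at this
    omega

theorem strictMono_of_lt_next {n : ℕ} {φ : Fin n → ℕ}
    (h : ∀ p q : Fin n, (p : ℕ) + 1 = q → φ p < φ q) : StrictMono φ := by
  have key : ∀ d : ℕ, ∀ p q : Fin n, (p : ℕ) + d + 1 = q → φ p < φ q := by
    intro d
    induction d with
    | zero => intro p q hpq; exact h p q hpq
    | succ d ih =>
      intro p q hpq
      exact (ih p ⟨p + d + 1, by omega⟩ rfl).trans (h _ _ (by simp only; omega))
  intro p q hpq
  exact key (q - p - 1) p q (by rw [Fin.lt_def] at hpq; omega)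

theorem mem_iff_lt_card_of_lower {n : ℕ} {S : Finset (Fin n)}
    (hS : ∀ p q, p ≤ q → q ∈ S → p ∈ S) (p : Fin n) : p ∈ S ↔ (p : ℕ) < S.card := by
  constructor
  · intro hp
    have : Finset.Iic p ⊆ S := fun q hq => hS q p (Finset.mem_Iic.1 hq) hp
    have := Finset.card_le_card this
    rw [Fin.card_Iic] at this
    omega
  · intro hp
    by_contra hc
    have : S ⊆ Finset.Iio p := fun q hq => by
      rw [Finset.mem_Iio]
      by_contra hpq
      exact hc (hS p q (not_lt.1 hpq) hq)
    have := Finset.card_le_card this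
    rw [Fin.card_Iio] at this
    omega

section Blocks

variable {B : Type} [Fintype B] {n : ℕ} {pos c : B → ℕ}

/-- The total size of the blocks from the place `x` on. -/
def tailSize (pos c : B → ℕ) (x : ℕ) : ℕ := ∑ b ∈ Finset.univ.filter (fun b => x ≤ pos b), c b

/-- The number of positions before the block `b`. -/
def blockStart (n : ℕ) (pos c : B → ℕ) (b : B) : ℕ := n - tailSize pos c (pos b)

theorem tailSize_antitone (pos c : B → ℕ) : Antitone (tailSize pos c) := by
  intro x y hxy
  refine Finset.sum_le_sum_of_subset fun b hb => ?_
  simp only [Finset.mem_filter, Finset.mem_univ, true_and] at hb ⊢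
  omega

theorem tailSize_zero (pos c : B → ℕ) : tailSize pos c 0 = ∑ b, c b := by
  simp [tailSize]

theorem tailSize_pos [DecidableEq B] (hp : Function.Injective pos) (b : B) :
    tailSize pos c (pos b) = c b + tailSize pos c (pos b + 1) := by
  unfold tailSize
  have : Finset.univ.filter (fun b' => pos b ≤ pos b') =
      insert b (Finset.univ.filter (fun b' => pos b + 1 ≤ pos b')) := by
    ext b'
    simp only [Finset.mem_filter, Finset.mem_univ, true_and, Finset.mem_insert]
    constructor
    · intro h
      rcases h.lt_or_eq with h | h
      · exact Or.inr h
      · exact Or.inl (hp h.symm)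
    · rintro (rfl | h) <;> omega
  rw [this, Finset.sum_insert (by simp)]

theorem exists_block_of_tailSize_ne {x : ℕ}
    (h : tailSize pos c x ≠ tailSize pos c (x + 1)) : ∃ b, pos b = x := by
  by_contra! hne
  refine h (Finset.sum_congr ?_ fun _ _ => rfl)
  ext b
  simp only [Finset.mem_filter, Finset.mem_univ, true_and]
  have := hne b
  omega

open Classical in
/-- The block of the position `p`, for blocks of sizes `c`. -/
noncomputable def blockAt (n : ℕ) (pos c : B → ℕ) (p : ℕ) : Option B :=
  if h : ∃ b, blockStart n pos c b ≤ p ∧ p < n - tailSize pos c (pos b + 1) then some h.choose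
  else none

theorem blockAt_eq_some (hp : Function.Injective pos) {p : ℕ} {b : B} :
    blockAt n pos c p = some b ↔
      blockStart n pos c b ≤ p ∧ p < n - tailSize pos c (pos b + 1) := by
  have uniq : ∀ b b', blockStart n pos c b ≤ p → p < n - tailSize pos c (pos b' + 1) →
      pos b ≤ pos b' := by
    intro b b' h h'
    by_contra hlt
    have := tailSize_antitone pos c (show pos b' + 1 ≤ pos b by omega)
    unfold blockStart at h
    omega
  unfold blockAt
  constructor
  · intro h
    split_ifs at h with hex
    simp only [Option.some.injEq] at h
    rw [← h]
    exact hex.choose_spec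
  · intro h
    have hex : ∃ b, blockStart n pos c b ≤ p ∧ p < n - tailSize pos c (pos b + 1) := ⟨b, h⟩
    rw [dif_pos hex]
    have := hex.choose_spec
    exact congrArg some (hp (le_antisymm (uniq _ _ this.1 h.2) (uniq _ _ h.1 this.2)))

theorem blockAt_eq_none (hp : Function.Injective pos) {p : ℕ} (hpn : p < n) :
    blockAt n pos c p = none ↔ p < n - tailSize pos c 0 := by
  constructor
  · intro h
    by_contra hle
    have hbig : ∃ M, ∀ b, pos b < M :=
      ⟨(∑ b, pos b) + 1, fun b => Nat.lt_succ_of_le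
        (Finset.single_le_sum (fun _ _ => Nat.zero_le _) (Finset.mem_univ b))⟩
    obtain ⟨M, hM⟩ := hbig
    have hMz : tailSize pos c M = 0 := by
      unfold tailSize
      rw [Finset.filter_eq_empty_iff.2 fun b _ => by have := hM b; omega, Finset.sum_empty]
    have hex : ∃ x, p < n - tailSize pos c x := ⟨M, by omega⟩
    classical
    have h1 := Nat.find_spec hex
    have h2 := fun m => Nat.find_min hex (m := m)
    generalize Nat.find hex = x at *
    rcases x with _ | x
    · exact hle h1
    · have h3 := h2 x (by omega)
      obtain ⟨b, rfl⟩ := exists_block_of_tailSize_ne (pos := pos) (c := c) (x := x)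
        (by intro he; rw [he] at h3; exact h3 h1)
      have := (blockAt_eq_some (n := n) (c := c) hp).2 ⟨not_lt.1 h3, h1⟩
      rw [h] at this
      simp at this
  · intro h
    rcases hb : blockAt n pos c p with _ | b
    · rfl
    · have := ((blockAt_eq_some hp).1 hb).1
      have h2 := tailSize_antitone pos c (Nat.zero_le (pos b))
      unfold blockStart at this
      omega

/-- The place of a block, the head being at `0`. -/
def blockIndex (pos : B → ℕ) : Option B → ℕ
  | none => 0
  | some b => pos b + 1

omit [Fintype B] in
theorem blockIndex_injective (hp : Function.Injective pos) :
    Function.Injective (blockIndex pos) := by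
  rintro (_ | b) (_ | b') h <;> simp [blockIndex] at h ⊢
  exact hp h

theorem blockIndex_blockAt_mono (hp : Function.Injective pos) {p q : ℕ} (hpq : p ≤ q)
    (hq : q < n) : blockIndex pos (blockAt n pos c p) ≤ blockIndex pos (blockAt n pos c q) := by
  rcases h1 : blockAt n pos c p with _ | b
  · simp [blockIndex]
  · have h1' := (blockAt_eq_some hp).1 h1
    rcases h2 : blockAt n pos c q with _ | b'
    · rw [blockAt_eq_none hp hq] at h2
      have h3 := (blockAt_eq_none (c := c) hp (hpq.trans_lt hq)).2 (by omega)
      rw [h1] at h3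
      simp at h3
    · have h2' := (blockAt_eq_some hp).1 h2
      simp only [blockIndex]
      by_contra hlt
      have := tailSize_antitone pos c (show pos b' + 1 ≤ pos b by omega)
      unfold blockStart at h1'
      omega

variable [DecidableEq B]

theorem blockAt_blockStart (hp : Function.Injective pos) (hc : ∀ b, 0 < c b)
    (hsum : ∑ b, c b ≤ n) (b : B) : blockAt n pos c (blockStart n pos c b) = some b := by
  rw [blockAt_eq_some hp]
  refine ⟨le_rfl, ?_⟩
  have h1 := tailSize_pos (c := c) hp b
  have h2 := hc b
  have h3 := tailSize_antitone pos c (Nat.zero_le (pos b))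
  rw [tailSize_zero] at h3
  unfold blockStart
  omega

/-- A position opens a block exactly if its block differs from that of the preceding position. -/
theorem mem_starts_iff (hp : Function.Injective pos) (hc : ∀ b, 0 < c b)
    (hsum : ∑ b, c b ≤ n) {p : ℕ} (hpn : p + 1 < n) :
    p + 1 ∈ Finset.univ.image (blockStart n pos c) ↔
      blockAt n pos c p ≠ blockAt n pos c (p + 1) := by
  simp only [Finset.mem_image, Finset.mem_univ, true_and]
  constructor
  · rintro ⟨b, hb⟩ he
    rw [← hb, blockAt_blockStart hp hc hsum, blockAt_eq_some hp] at he
    omega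
  · intro hne
    by_contra! h
    apply hne
    rcases hq : blockAt n pos c (p + 1) with _ | b
    · have := blockIndex_blockAt_mono (c := c) hp (show p ≤ p + 1 by omega) hpn
      rw [hq] at this
      exact blockIndex_injective hp (by simpa [blockIndex] using this)
    · rw [blockAt_eq_some hp] at hq ⊢
      have := h b
      omega

/-- The block of a sorted word at each position is determined by the block sizes. -/
theorem block_eq_blockAt (hp : Function.Injective pos) {f : Fin n → Letter B}
    (hf : f ∈ words n c) {w : Equiv.Perm (Fin n)} (hw : sortPerm (code pos ∘ f) = w) (p : Fin n) :
    (f (w p)).block = blockAt n pos c p := by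
  simp only [words, Finset.mem_filter, Finset.mem_univ, true_and] at hf
  have hsm := (eq_sortPerm_iff _ _).1 hw
  have hidx : ∀ x y : Letter B, code pos x ≤ code pos y →
      blockIndex pos x.block ≤ blockIndex pos y.block := by
    rintro (_ | ⟨b, _ | _⟩) (_ | ⟨b', _ | _⟩) <;> simp [blockIndex] <;> omega
  have hmono : ∀ p q, p ≤ q →
      blockIndex pos (f (w p)).block ≤ blockIndex pos (f (w q)).block := by
    intro p q hpq
    rcases hpq.lt_or_eq with h | rfl
    · have h1 := hsm h
      simp only [Function.comp, sortKey_lt_iff] at h1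
      exact hidx _ _ (by omega)
    · exact le_rfl
  have hcard : ∀ x, (Finset.univ.filter fun p => blockIndex pos (f (w p)).block < x + 1).card =
      n - tailSize pos c x := by
    intro x
    have h1 : (Finset.univ.filter fun p => ¬ blockIndex pos (f (w p)).block < x + 1).card =
        tailSize pos c x := by
      have : Finset.univ.filter (fun p => ¬ blockIndex pos (f (w p)).block < x + 1) =
          (Finset.univ.filter (fun b => x ≤ pos b)).biUnion
            (fun b => Finset.univ.filter fun p => (f (w p)).block = some b) := by
        ext p
        simp only [Finset.mem_filter, Finset.mem_univ, true_and, Finset.mem_biUnion, not_lt]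
        rcases (f (w p)).block with _ | b <;> simp [blockIndex]
      rw [this, Finset.card_biUnion]
      · refine Finset.sum_congr rfl fun b _ => ?_
        rw [← hf b, ← blockCount_comp_perm f w]
        rfl
      · intro a _ b _ hab
        rw [Function.onFun, Finset.disjoint_left]
        intro p h h'
        simp only [Finset.mem_filter, Finset.mem_univ, true_and] at h h'
        rw [h] at h'
        exact hab (Option.some.inj h')
    have h2 := Finset.card_filter_add_card_filter_not (s := (Finset.univ : Finset (Fin n)))
      (fun p => blockIndex pos (f (w p)).block < x + 1)
    rw [h1, Finset.card_univ, Fintype.card_fin] at h2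
    omega
  have hlt : ∀ x, blockIndex pos (f (w p)).block < x + 1 ↔ (p : ℕ) < n - tailSize pos c x := by
    intro x
    rw [← hcard x, ← mem_iff_lt_card_of_lower]
    · simp
    · intro p q hpq hq
      simp only [Finset.mem_filter, Finset.mem_univ, true_and] at hq ⊢
      exact (hmono p q hpq).trans_lt hq
  rcases hb : (f (w p)).block with _ | b
  · symm
    rw [blockAt_eq_none hp p.2, ← hlt 0, hb]
    simp [blockIndex]
  · symm
    have h1 := hlt (pos b)
    have h2 := hlt (pos b + 1)
    rw [hb] at h1 h2
    simp only [blockIndex] at h1 h2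
    rw [blockAt_eq_some hp, blockStart]
    omega

/-- The signs allowed at the position `p` of a sorted signed word with sorting permutation `w`. An
ascent inside a block forces a positive sign at the later of its two positions, a descent inside a
block forces a negative sign at the earlier one, and the letters of the head count as positive. -/
def SignAllowed (w : Equiv.Perm (Fin n)) (β : ℕ → Option B) (p : Fin n) (s : Bool) : Prop :=
  (β p = none → s = true) ∧ (∀ q : Fin n, (q : ℕ) + 1 = p → β q = β p → w q < w p → s = true) ∧
    ∀ q : Fin n, (p : ℕ) + 1 = q → β q = β p → w q < w p → s = false

open Classical in
/-- The words with a given sorting permutation are counted position by position: the blocks are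
known from the block sizes, and the condition on the sign at a position does not involve the other
signs. -/
theorem card_words_filter (hp : Function.Injective pos) (hsum : ∑ b, c b ≤ n)
    (w : Equiv.Perm (Fin n)) :
    ((words n c).filter fun f => sortPerm (code pos ∘ f) = w).card =
      ∏ p : Fin n, (Finset.univ.filter
        (SignAllowed w (blockAt n pos c) p)).card := by
  rw [← Fintype.card_piFinset]
  symm
  have hsorted : ∀ (f : Fin n → Letter B), sortPerm (code pos ∘ f) = w ↔
      ∀ p q : Fin n, (p : ℕ) + 1 = q → (code pos (f (w p)) < code pos (f (w q)) ∨
        code pos (f (w p)) = code pos (f (w q)) ∧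
        (Even (code pos (f (w p))) ∧ w p < w q ∨ ¬ Even (code pos (f (w p))) ∧ w q < w p)) := by
    intro f
    rw [eq_sortPerm_iff]
    constructor
    · intro h p q hpq
      have := h (show p < q by rw [Fin.lt_def]; omega)
      simpa only [Function.comp, sortKey_lt_iff] using this
    · intro h
      refine strictMono_of_lt_next fun p q hpq => ?_
      simpa only [Function.comp, sortKey_lt_iff] using h p q hpq
  have hcode : ∀ (o o' : Option B) (s s' : Bool), blockIndex pos o < blockIndex pos o' →
      code pos (o.map fun b => (b, s)) < code pos (o'.map fun b => (b, s')) := by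
    rintro (_ | b) (_ | b') (_ | _) (_ | _) h <;> simp [blockIndex] at h ⊢ <;> omega
  refine Finset.card_bij (fun ε _ i => (blockAt n pos c (w⁻¹ i : Fin n)).map
    fun b => (b, ε (w⁻¹ i))) ?_ ?_ ?_
  · intro ε hε
    simp only [Fintype.mem_piFinset, Finset.mem_filter, Finset.mem_univ, true_and] at hε
    have ew : ∀ p, w⁻¹ (w p) = p := fun p => Equiv.symm_apply_apply w p
    rw [Finset.mem_filter, hsorted]
    constructor
    · simp only [words, Finset.mem_filter, Finset.mem_univ, true_and]
      intro b
      rw [← blockCount_comp_perm _ w]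
      simp only [ew, blockCount]
      have : ∀ p : Fin n, Letter.block ((blockAt n pos c p).map fun b => (b, ε p)) =
          blockAt n pos c p := by
        intro p
        rcases blockAt n pos c p <;> rfl
      simp only [this, blockAt_eq_some hp]
      have h1 := tailSize_pos (c := c) hp b
      have h3 := tailSize_antitone pos c (Nat.zero_le (pos b))
      rw [tailSize_zero] at h3
      rw [← Finset.card_map Fin.valEmbedding]
      have : (Finset.univ.filter fun p : Fin n => blockStart n pos c b ≤ p ∧
          (p : ℕ) < n - tailSize pos c (pos b + 1)).map Fin.valEmbedding =
          Finset.Ico (blockStart n pos c b) (n - tailSize pos c (pos b + 1)) := by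
        ext x
        simp only [Finset.mem_map, Finset.mem_filter, Finset.mem_univ, true_and,
          Fin.valEmbedding_apply, Finset.mem_Ico]
        constructor
        · rintro ⟨p, h, rfl⟩; exact h
        · intro h; exact ⟨⟨x, by omega⟩, h, rfl⟩
      rw [this, Nat.card_Ico, blockStart]
      omega
    · intro p q hpq
      simp only [ew]
      have hm := blockIndex_blockAt_mono (c := c) hp (show (p : ℕ) ≤ q by omega) q.2
      rcases hm.lt_or_eq with h | h
      · exact Or.inl (hcode _ _ _ _ h)
      · have hb := blockIndex_injective hp h
        obtain ⟨a1, a2, a3⟩ := hε p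
        obtain ⟨b1, b2, b3⟩ := hε q
        have c1 := b2 p hpq hb
        have c2 := a3 q hpq hb.symm
        have hne : w p ≠ w q := fun h => by
          have := Fin.ext_iff.1 (w.injective h); omega
        rw [← hb] at b1 ⊢
        rcases lt_or_gt_of_ne hne with hlt | hgt
        · have := c1 hlt
          rcases hx : blockAt n pos c p with _ | b
          · simp [hlt]
          · rcases hs : ε p with _ | _ <;> simp [this, hlt, parity_simps]
        · have := c2 hgt
          rcases hx : blockAt n pos c p with _ | b
          · have := a1 hx
            simp_all
          · rcases hs : ε q with _ | _ <;> simp [this, hgt]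
  · intro ε hε ε' hε' h
    simp only [Fintype.mem_piFinset, Finset.mem_filter, Finset.mem_univ, true_and] at hε hε'
    ext1 p
    have h1 := congrFun h (w p)
    simp only [show w⁻¹ (w p) = p from Equiv.symm_apply_apply w p] at h1
    rcases hx : blockAt n pos c p with _ | b
    · rw [(hε p).1 hx, (hε' p).1 hx]
    · simpa [hx] using h1
  · intro f hf
    rw [Finset.mem_filter] at hf
    obtain ⟨hfw, hs⟩ := hf
    have hblock := block_eq_blockAt hp hfw hs
    rw [hsorted] at hs
    have hfe : ∀ p, f (w p) = (blockAt n pos c p).map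
        fun b => (b, ((f (w p)).map Prod.snd).getD true) := by
      intro p
      rw [← hblock p]
      rcases f (w p) with _ | ⟨b, s⟩ <;> rfl
    refine ⟨fun p => ((f (w p)).map Prod.snd).getD true, ?_, ?_⟩
    · simp only [Fintype.mem_piFinset, Finset.mem_filter, Finset.mem_univ, true_and]
      intro p
      refine ⟨?_, ?_, ?_⟩
      · intro h
        rw [← hblock] at h
        rcases hx : f (w p) with _ | ⟨b, s⟩
        · rfl
        · simp [hx] at h
      · intro q hq hb hlt
        have h1 := hs q p hq
        rw [← hblock, ← hblock] at hb
        rcases hx : f (w q) with _ | ⟨b, _ | _⟩ <;> rcases hy : f (w p) with _ | ⟨b', _ | _⟩ <;>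
          simp [hx, hy, parity_simps, hlt.not_gt] at h1 hb ⊢ <;> subst hb <;> omega
      · intro q hq hb hlt
        have h1 := hs p q hq
        rw [← hblock, ← hblock] at hb
        rcases hx : f (w p) with _ | ⟨b, _ | _⟩ <;> rcases hy : f (w q) with _ | ⟨b', _ | _⟩ <;>
          simp [hx, hy, parity_simps, hlt.not_gt] at h1 hb ⊢ <;> subst hb <;> omega
    · ext1 i
      have := hfe (w⁻¹ i)
      simp only [show w (w⁻¹ i) = i from Equiv.apply_symm_apply w i] at this ⊢
      exact this.symm

open Classical in
/-- The positions of a nonempty block where both signs are allowed are the valleys of `w`; there is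
one for each block if `w` has no peak inside a block. -/
theorem prod_card_signAllowed (hp : Function.Injective pos) (hc : ∀ b, 0 < c b)
    (hsum : ∑ b, c b ≤ n) (w : Equiv.Perm (Fin n)) :
    ∏ p : Fin n, (Finset.univ.filter (SignAllowed w (blockAt n pos c) p)).card =
      if ∀ i ∈ peak w, i ∈ Finset.univ.image (blockStart n pos c) ∨
        i - 1 ∈ Finset.univ.image (blockStart n pos c) then 2 ^ Fintype.card B else 0 := by
  set J := Finset.univ.image (blockStart n pos c)
  have hstart : ∀ p q : Fin n, (p : ℕ) + 1 = q →
      ((q : ℕ) ∈ J ↔ blockAt n pos c p ≠ blockAt n pos c q) := by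
    intro p q hpq
    rw [← hpq]
    exact mem_starts_iff hp hc hsum (hpq ▸ q.2)
  have hval : ∀ p : Fin n, value w ((p : ℕ) + 1) = (w p : ℕ) + 1 := value_succ w
  split_ifs with hpk
  · set β := blockAt n pos c with hβ
    let Free : Fin n → Prop := fun p => β p ≠ none ∧
      (∀ q : Fin n, (q : ℕ) + 1 = p → β q = β p → ¬ w q < w p) ∧
      ∀ q : Fin n, (p : ℕ) + 1 = q → β q = β p → ¬ w q < w p
    have hJβ : ∀ i ∈ J, ∃ b, i = blockStart n pos c b ∧ β i = some b := by
      intro i hi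
      obtain ⟨b, -, rfl⟩ := Finset.mem_image.1 hi
      exact ⟨b, rfl, blockAt_blockStart hp hc hsum b⟩
    have hhead : ∀ y, y < n → β y = none → ¬ value w (y + 1) < value w y := by
      intro y hy h0 hd
      obtain ⟨i, hi, h1, h2⟩ := exists_peak_between w (Nat.zero_le y) hy
        (by rw [value_zero, hval ⟨0, by omega⟩]; omega) hd
      have hJ0 : ∀ i ≤ y, i ∉ J := by
        intro i hi hiJ
        obtain ⟨b, -, hb⟩ := hJβ i hiJ
        have := blockIndex_blockAt_mono (c := c) hp hi hy
        rw [← hβ, hb, h0] at this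
        simp [blockIndex] at this
      rcases hpk i hi with h | h
      · exact hJ0 i h2 h
      · exact hJ0 (i - 1) (by omega) h
    have hinner : ∀ a y, a < y → y < n → β a = β y → value w (a + 1) < value w (a + 2) →
        ¬ value w (y + 1) < value w y := by
      intro a y hay hy hb ha hd
      obtain ⟨i, hi, h1, h2⟩ := exists_peak_between w (x := a + 1) hay hy ha hd
      have hJ0 : ∀ i, a < i → i ≤ y → i ∉ J := by
        intro i h1 h2 hiJ
        obtain ⟨b, hs, hb'⟩ := hJβ i hiJ
        have m1 := blockIndex_blockAt_mono (c := c) hp h1.le (h2.trans_lt hy)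
        have m2 := blockIndex_blockAt_mono (c := c) hp h2 hy
        have : β a = some b := by
          rw [← hb']
          refine blockIndex_injective hp (le_antisymm m1 ?_)
          rw [hb]
          exact m2
        have := ((blockAt_eq_some hp).1 this).1
        omega
      rcases hpk i hi with h | h
      · exact hJ0 i (by omega) h2 h
      · exact hJ0 (i - 1) (by omega) (by omega) h
    have hcard : ∀ p, (Finset.univ.filter (SignAllowed w β p)).card =
        if Free p then 2 else 1 := by
      intro p
      split_ifs with hfree
      · have : Finset.univ.filter (SignAllowed w β p) = Finset.univ := by
          rw [Finset.filter_eq_self]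
          intro s _
          exact ⟨fun h => absurd h hfree.1, fun q h1 h2 h3 => absurd h3 (hfree.2.1 q h1 h2),
            fun q h1 h2 h3 => absurd h3 (hfree.2.2 q h1 h2)⟩
        rw [this]
        rfl
      · -- a position cannot be forced to be both positive and negative: this would be a peak
        -- inside a block
        by_cases hdesc : ∃ q : Fin n, (p : ℕ) + 1 = q ∧ β q = β p ∧ w q < w p
        · obtain ⟨r, hr1, hr2, hr3⟩ := hdesc
          have hd : value w ((r : ℕ) + 1) < value w r := by
            have := hval p
            rw [hr1] at this
            rw [hval r, this]
            omega
          have : Finset.univ.filter (SignAllowed w β p) = {false} := by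
            ext s
            simp only [Finset.mem_filter, Finset.mem_univ, true_and, Finset.mem_singleton]
            constructor
            · exact fun h => h.2.2 r hr1 hr2 hr3
            · rintro rfl
              refine ⟨fun h0 => ?_, fun q hq1 hq2 hq3 => ?_, fun _ _ _ _ => rfl⟩
              · exact (hhead r r.2 (hr2.trans h0) hd).elim
              · refine (hinner q r (by omega) r.2 (hq2.trans hr2.symm) ?_ hd).elim
                rw [show (q : ℕ) + 2 = p + 1 by omega, hval q, hval p]
                omega
          rw [this, Finset.card_singleton]
        · push Not at hdesc
          have : Finset.univ.filter (SignAllowed w β p) = {true} := by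
            ext s
            simp only [Finset.mem_filter, Finset.mem_univ, true_and, Finset.mem_singleton]
            constructor
            · rintro ⟨a1, a2, -⟩
              by_cases h0 : β p = none
              · exact a1 h0
              · by_contra hs
                exact hfree ⟨h0, fun q hq1 hq2 hq3 => hs (a2 q hq1 hq2 hq3),
                  fun q hq1 hq2 => not_lt.2 (hdesc q hq1 hq2)⟩
            · rintro rfl
              exact ⟨fun _ => rfl, fun _ _ _ _ => rfl,
                fun q hq1 hq2 hq3 => absurd hq3 (not_lt.2 (hdesc q hq1 hq2))⟩
          rw [this, Finset.card_singleton]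
    rw [Finset.prod_congr rfl fun p _ => hcard p, Finset.prod_ite, Finset.prod_const,
      Finset.prod_const_one, mul_one]
    congr 1
    have hle : ∀ p q : Fin n, Free p → Free q → β p = β q → ¬ p < q := by
      intro p q hfp hfq hpq hlt
      rw [Fin.lt_def] at hlt
      have hm : ∀ x, (p : ℕ) ≤ x → x ≤ q → β x = β p := by
        intro x h1 h2
        refine blockIndex_injective hp (le_antisymm ?_ ?_)
        · rw [hpq]; exact blockIndex_blockAt_mono hp h2 q.2
        · exact blockIndex_blockAt_mono hp h1 (h2.trans_lt q.2)
      set r : Fin n := ⟨p + 1, by omega⟩ with hr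
      set t : Fin n := ⟨q - 1, by omega⟩ with ht
      have hvr := hval r
      have hvt := hval t
      have h1 := hfp.2.2 r rfl (hm _ (by simp only [hr]; omega) (by simp only [hr]; omega))
      have h2 := hfq.2.1 t (by simp only [ht]; omega)
        ((hm _ (by simp only [ht]; omega) (by simp only [ht]; omega)).trans hpq)
      have h1' : w r ≠ w p := fun h => by
        have := Fin.ext_iff.1 (w.injective h)
        simp only [hr] at this
        omega
      have h2' : w t ≠ w q := fun h => by
        have := Fin.ext_iff.1 (w.injective h)
        simp only [ht] at this
        omega
      rw [show (t : ℕ) + 1 = q by simp only [ht]; omega] at hvt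
      rw [Fin.lt_def] at h1 h2
      rw [Ne, Fin.ext_iff] at h1' h2'
      have hvp := hval p
      have hvq := hval q
      refine hinner p q hlt q.2 hpq ?_ (by omega)
      rw [show (r : ℕ) + 1 = p + 2 from rfl] at hvr
      omega
    -- the minimum of `w` on a block is a position without forced sign
    have hex : ∀ b, ∃ p : Fin n, Free p ∧ β p = some b := by
      intro b
      have hs := blockAt_blockStart hp hc hsum b
      have hsn := ((blockAt_eq_some hp).1 hs).2
      obtain ⟨p, hpm, hmin⟩ := Finset.exists_min_image
        (Finset.univ.filter fun p : Fin n => β p = some b) w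
        ⟨⟨blockStart n pos c b, by omega⟩, by simpa using hs⟩
      simp only [Finset.mem_filter, Finset.mem_univ, true_and] at hpm hmin
      refine ⟨p, ⟨by simp [hpm], fun q _ h => ?_, fun q _ h => ?_⟩, hpm⟩
      · exact not_lt.2 (hmin q (h.trans hpm))
      · exact not_lt.2 (hmin q (h.trans hpm))
    choose g hg1 hg2 using hex
    rw [← Finset.card_univ]
    symm
    refine Finset.card_bij (fun b _ => g b) ?_ ?_ ?_
    · intro b _
      simpa using hg1 b
    · intro b _ b' _ h
      have := hg2 b
      rw [h, hg2 b'] at this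
      exact (Option.some.inj this).symm
    · intro p hfp
      rw [Finset.mem_filter] at hfp
      rcases hb : β p with _ | b
      · exact absurd hb hfp.2.1
      · refine ⟨b, Finset.mem_univ _, ?_⟩
        have e : β (g b) = β p := (hg2 b).trans hb.symm
        rcases lt_trichotomy (g b) p with h | h | h
        · exact absurd h (hle _ _ (hg1 b) hfp.2 e)
        · exact h
        · exact absurd h (hle _ _ hfp.2 (hg1 b) e.symm)
  · push Not at hpk
    obtain ⟨i, hi, h1, h2⟩ := hpk
    simp only [peak, Finset.mem_filter, Finset.mem_Icc] at hi
    obtain ⟨hi1, hi2, hi3⟩ := hi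
    set p : Fin n := ⟨i - 1, by omega⟩ with hpdef
    set r : Fin n := ⟨i, by omega⟩ with hrdef
    have hpr : (p : ℕ) + 1 = r := by simp only [hpdef, hrdef]; omega
    have e1 := hval p
    have e2 := hval r
    have ei : (p : ℕ) + 1 = i := hpr
    rw [ei] at e1
    have er : (r : ℕ) = i := rfl
    rw [er] at e2
    have hb1 : blockAt n pos c p = blockAt n pos c r := by
      by_contra h
      exact h1 ((hstart p r hpr).2 h)
    have hdesc : w r < w p := by rw [Fin.lt_def]; omega
    refine Finset.prod_eq_zero (Finset.mem_univ p) ?_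
    rw [Finset.card_eq_zero, Finset.filter_eq_empty_iff]
    rintro s - ⟨a1, a2, a3⟩
    have a3' := a3 r hpr hb1.symm hdesc
    subst a3'
    rcases hb : blockAt n pos c p with _ | b
    · simp at a1
      exact a1 hb
    · by_cases hp0 : (p : ℕ) = 0
      · refine h2 (Finset.mem_image.2 ⟨b, Finset.mem_univ _, ?_⟩)
        have := ((blockAt_eq_some hp).1 hb).1
        omega
      · set q : Fin n := ⟨i - 2, by omega⟩ with hqdef
        have hqp : (q : ℕ) + 1 = p := by simp only [hqdef]; omega
        have e3 := hval q
        rw [hqp, show (p : ℕ) = i - 1 by omega] at e3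
        have hb2 : blockAt n pos c q = blockAt n pos c p := by
          by_contra h
          refine h2 ?_
          have := (hstart q p hqp).2 h
          rwa [show (p : ℕ) = i - 1 by omega] at this
        have := a2 q hqp hb2 (by rw [Fin.lt_def]; omega)
        simp at this

/-- A permutation `w` is the sorting permutation of `2 ^ m` words with `m` blocks if each peak of
`w` is at a block start or directly after one, and of none otherwise. -/
theorem X_eq (k : Type*) [Field k] (hp : Function.Injective pos) (hc : ∀ b, 0 < c b)
    (hsum : ∑ b, c b ≤ n) : X k n pos c =
      (2 : k) ^ Fintype.card B • V k n (Finset.univ.image (blockStart n pos c)) := by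
  classical
  unfold X V
  rw [← Finset.sum_fiberwise (words n c) (fun f => sortPerm (code pos ∘ f)), Finset.smul_sum,
    Finset.sum_filter]
  refine Finset.sum_congr rfl fun w _ => ?_
  rw [Finset.sum_congr rfl (g := fun _ => MonoidAlgebra.of k (Equiv.Perm (Fin n)) w)
    (by intro f hf; rw [(Finset.mem_filter.1 hf).2]), Finset.sum_const,
    ← Nat.cast_smul_eq_nsmul k, card_words_filter hp hsum,
    prod_card_signAllowed hp hc hsum]
  split_ifs <;> simp

end Blocks

/-! ### Differences of permuted products in an algebra -/

section PermDiff

variable {k R : Type*} [Field k] [Ring R] [Algebra k R]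

/-- The span of the differences between `h c * x a₁ * ⋯ * x aₘ` and the products with the factors
`x aᵢ` permuted. -/
def permDiff (k : Type*) {R : Type*} [Field k] [Ring R] [Algebra k R] (h x : ℕ → R) :
    Submodule k R :=
  Submodule.span k {r | ∃ (c : ℕ) (l l' : List ℕ), l.Perm l' ∧
    r = h c * (l.map x).prod - h c * (l'.map x).prod}

/-- The right module generated by the `h c` over the algebra generated by the `x c`. -/
def headModule (k : Type*) {R : Type*} [Field k] [Ring R] [Algebra k R] (h x : ℕ → R) :
    Submodule k R :=
  Submodule.span k {r | ∃ c, ∃ t ∈ Algebra.adjoin k (Set.range x), r = h c * t}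

theorem mul_mem_headModule {h x : ℕ → R} {r t : R} (hr : r ∈ headModule k h x)
    (ht : t ∈ Algebra.adjoin k (Set.range x)) : r * t ∈ headModule k h x := by
  induction hr using Submodule.span_induction with
  | mem r hr =>
    obtain ⟨c, u, hu, rfl⟩ := hr
    exact Submodule.subset_span ⟨c, u * t, mul_mem hu ht, mul_assoc _ _ _⟩
  | zero => simp
  | add r s _ _ h1 h2 => rw [add_mul]; exact add_mem h1 h2
  | smul a r _ h1 => rw [smul_mul_assoc]; exact Submodule.smul_mem _ _ h1

theorem adjoin_range_induction {x : ℕ → R} {p : R → Prop}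
    (hw : ∀ l : List ℕ, p (l.map x).prod) (h0 : p 0) (ha : ∀ r s, p r → p s → p (r + s))
    (hs : ∀ (a : k) r, p r → p (a • r)) {t : R} (ht : t ∈ Algebra.adjoin k (Set.range x)) :
    p t := by
  rw [← Subalgebra.mem_toSubmodule, Algebra.adjoin_eq_span] at ht
  induction ht using Submodule.span_induction with
  | mem t ht =>
    obtain ⟨l, hl, rfl⟩ := Submonoid.exists_list_of_mem_closure ht
    have : ∃ l' : List ℕ, l = l'.map x := by
      clear ht
      induction l with
      | nil => exact ⟨[], rfl⟩
      | cons a l ih =>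
        obtain ⟨l', hl'⟩ := ih fun y hy => hl y (List.mem_cons_of_mem _ hy)
        obtain ⟨b, hb⟩ := hl a List.mem_cons_self
        exact ⟨b :: l', by simp [hb, hl']⟩
    obtain ⟨l', rfl⟩ := this
    exact hw l'
  | zero => exact h0
  | add r s _ _ h1 h2 => exact ha r s h1 h2
  | smul a r _ h1 => exact hs a r h1

/-- The span `permDiff` only depends on the algebra generated by the `x c` and the module generated
by the `h c`: it consists of the products of the latter with the commutator ideal of the former. -/
theorem permDiff_le {h x h' x' : ℕ → R} (hh : ∀ c, h' c ∈ headModule k h x)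
    (hx : ∀ c, x' c ∈ Algebra.adjoin k (Set.range x)) :
    permDiff k h' x' ≤ permDiff k h x := by
  set T := Algebra.adjoin k (Set.range x)
  have hDT : ∀ r ∈ permDiff k h x, ∀ t ∈ T, r * t ∈ permDiff k h x := by
    intro r hr t ht
    refine adjoin_range_induction (p := fun t => r * t ∈ permDiff k h x) ?_ (by simp)
      (fun _ _ h1 h2 => by rw [mul_add]; exact add_mem h1 h2)
      (fun a _ h1 => by rw [mul_smul_comm]; exact Submodule.smul_mem _ _ h1) ht
    intro w
    induction hr using Submodule.span_induction with
    | mem r hr =>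
      obtain ⟨c, l, l', hl, rfl⟩ := hr
      exact Submodule.subset_span ⟨c, l ++ w, l' ++ w, hl.append_right w, by
        simp only [List.map_append, List.prod_append]; noncomm_ring⟩
    | zero => simp
    | add r s _ _ h1 h2 => rw [add_mul]; exact add_mem h1 h2
    | smul a r _ h1 => rw [smul_mul_assoc]; exact Submodule.smul_mem _ _ h1
  -- a two-sided ideal of `T`, as it turns out, that contains the commutators
  let E : Submodule k R :=
    { carrier := {r | ∀ a, ∀ p ∈ T, h a * p * r ∈ permDiff k h x}
      zero_mem' := fun a p _ => by simp
      add_mem' := fun h1 h2 a p hp => by rw [mul_add]; exact add_mem (h1 a p hp) (h2 a p hp)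
      smul_mem' := fun b r h1 a p hp => by
        rw [mul_smul_comm]; exact Submodule.smul_mem _ _ (h1 a p hp) }
  have hEl : ∀ r ∈ E, ∀ t ∈ T, t * r ∈ E := by
    intro r hr t ht a p hp
    rw [← mul_assoc, mul_assoc (h a)]
    exact hr a _ (mul_mem hp ht)
  have hEr : ∀ r ∈ E, ∀ t ∈ T, r * t ∈ E := by
    intro r hr t ht a p hp
    rw [← mul_assoc]
    exact hDT _ (hr a p hp) t ht
  have hcomm : ∀ u ∈ T, ∀ v ∈ T, u * v - v * u ∈ E := by
    intro u hu v hv a p hp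
    refine adjoin_range_induction (p := fun p => h a * p * (u * v - v * u) ∈ permDiff k h x) ?_
      (by simp) (fun _ _ h1 h2 => by rw [mul_add, add_mul]; exact add_mem h1 h2)
      (fun b _ h1 => by
        rw [mul_smul_comm, smul_mul_assoc]; exact Submodule.smul_mem _ _ h1) hp
    intro lp
    refine adjoin_range_induction (p := fun u => h a * _ * (u * v - v * u) ∈ permDiff k h x) ?_
      (by simp) (fun r s h1 h2 => by
        rw [add_mul, mul_add v, add_sub_add_comm, mul_add]; exact add_mem h1 h2)
      (fun b _ h1 => by
        rw [smul_mul_assoc, mul_smul_comm b v, ← smul_sub, mul_smul_comm]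
        exact Submodule.smul_mem _ _ h1) hu
    intro lu
    refine adjoin_range_induction (p := fun v => h a * _ * (_ * v - v * _) ∈ permDiff k h x) ?_
      (by simp) (fun r s h1 h2 => by
        rw [mul_add (List.prod _), add_mul r s, add_sub_add_comm, mul_add]; exact add_mem h1 h2)
      (fun b v h1 => by
        rw [smul_mul_assoc, mul_smul_comm b _ v, ← smul_sub, mul_smul_comm]
        exact Submodule.smul_mem _ _ h1) hv
    intro lv
    refine Submodule.subset_span ⟨a, lp ++ (lu ++ lv), lp ++ (lv ++ lu),
      List.perm_append_comm.append_left lp, ?_⟩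
    simp only [List.map_append, List.prod_append]
    noncomm_ring
  have hprod : ∀ l : List ℕ, (l.map x').prod ∈ T := by
    intro l
    refine Subalgebra.list_prod_mem _ fun r hr => ?_
    obtain ⟨a, -, rfl⟩ := List.mem_map.1 hr
    exact hx a
  have hperm : ∀ l l' : List ℕ, l.Perm l' → (l.map x').prod - (l'.map x').prod ∈ E := by
    intro l l' hl
    induction hl with
    | nil => simp
    | cons a _ ih =>
      simp only [List.map_cons, List.prod_cons, ← mul_sub]
      exact hEl _ ih _ (hx a)
    | swap a b l =>
      simp only [List.map_cons, List.prod_cons, ← mul_assoc, ← sub_mul]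
      exact hEr _ (hcomm _ (hx b) _ (hx a)) _ (hprod l)
    | trans _ _ h1 h2 => simpa using add_mem h1 h2
  refine Submodule.span_le.2 ?_
  rintro _ ⟨c, l, l', hl, rfl⟩
  rw [SetLike.mem_coe, ← mul_sub]
  have hd := hperm l l' hl
  generalize (l.map x').prod - (l'.map x').prod = r at *
  have hc := hh c
  generalize h' c = s at *
  induction hc using Submodule.span_induction with
  | mem s hs =>
    obtain ⟨a, t, ht, rfl⟩ := hs
    exact hd a t ht
  | zero => simp
  | add r s _ _ h1 h2 => rw [add_mul]; exact add_mem h1 h2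
  | smul a r _ h1 => rw [smul_mul_assoc]; exact Submodule.smul_mem _ _ h1

end PermDiff

/-! ### Three generating families of an algebra with two generators -/

section TwoGenerators

variable {k R : Type*} [Field k] [Ring R] [Algebra k R] (N y : R)

/-- Multiplication by `N` turns heads into block factors. -/
theorem left_mul_mem_adjoin {h : ℕ → R} {r : R}
    (hr : r ∈ headModule k h (fun c => N * h c)) :
    N * r ∈ Algebra.adjoin k (Set.range fun c => N * h c) := by
  induction hr using Submodule.span_induction with
  | mem r hr =>
    obtain ⟨c, t, ht, rfl⟩ := hr
    rw [← mul_assoc]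
    exact mul_mem (Algebra.subset_adjoin ⟨c, rfl⟩) ht
  | zero => simp
  | add r s _ _ h1 h2 => rw [mul_add]; exact add_mem h1 h2
  | smul a r _ h1 => rw [mul_smul_comm]; exact Subalgebra.smul_mem _ h1 a

theorem adjoin_le_headModule {h : ℕ → R} (h0 : h 0 = 1) {t : R}
    (ht : t ∈ Algebra.adjoin k (Set.range fun c => N * h c)) :
    t ∈ headModule k h (fun c => N * h c) :=
  Submodule.subset_span ⟨0, t, ht, by rw [h0, one_mul]⟩

/-- Every noncommutative polynomial in `N` and `y` lies in the head module of the powers of `y`. -/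
theorem mem_headModule_of_mem_adjoin_pair {r : R} (hr : r ∈ Algebra.adjoin k {N, y}) :
    r ∈ headModule k (fun c => y ^ c) (fun c => N * y ^ c) := by
  suffices ∀ s ∈ headModule k (fun c => y ^ c) (fun c => N * y ^ c),
      r * s ∈ headModule k (fun c => y ^ c) (fun c => N * y ^ c) by
    simpa using this 1 (Submodule.subset_span ⟨0, 1, one_mem _, by simp⟩)
  induction hr using Algebra.adjoin_induction with
  | mem r hr =>
    intro s hs
    rcases hr with rfl | rfl
    · exact adjoin_le_headModule (h := fun c => y ^ c) _ (pow_zero _)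
        (left_mul_mem_adjoin (h := fun c => y ^ c) _ hs)
    · induction hs using Submodule.span_induction with
      | mem s hs =>
        obtain ⟨c, t, ht, rfl⟩ := hs
        exact Submodule.subset_span ⟨c + 1, t, ht, by simp only [pow_succ', mul_assoc]⟩
      | zero => simp
      | add r s _ _ h1 h2 => rw [mul_add]; exact add_mem h1 h2
      | smul a r _ h1 => rw [mul_smul_comm]; exact Submodule.smul_mem _ _ h1
  | algebraMap a =>
    intro s hs
    rw [← Algebra.smul_def]
    exact Submodule.smul_mem _ _ hs
  | add r s _ _ h1 h2 => intro t ht; rw [add_mul]; exact add_mem (h1 t ht) (h2 t ht)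
  | mul r s _ _ h1 h2 => intro t ht; rw [mul_assoc]; exact h1 _ (h2 t ht)

theorem permDiff_le_of_mem_adjoin {h : ℕ → R} (hh : ∀ c, h c ∈ Algebra.adjoin k {N, y}) :
    permDiff k h (fun c => N * h c) ≤ permDiff k (fun c => y ^ c) (fun c => N * y ^ c) :=
  permDiff_le (fun c => mem_headModule_of_mem_adjoin_pair N y (hh c))
    (fun c => left_mul_mem_adjoin (h := fun c => y ^ c) N
      (mem_headModule_of_mem_adjoin_pair N y (hh c)))

/-- Replacing `y` by `N² - y` is an involution that does not change the algebra. -/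
theorem permDiff_sub_eq :
    permDiff k (fun c => (N * N - y) ^ c) (fun c => N * (N * N - y) ^ c) =
      permDiff k (fun c => y ^ c) (fun c => N * y ^ c) := by
  have h : ∀ (y : R) (c : ℕ), (N * N - y) ^ c ∈ Algebra.adjoin k {N, y} := by
    intro y c
    have h1 : N ∈ Algebra.adjoin k {N, y} := Algebra.subset_adjoin (by simp)
    have h2 : y ∈ Algebra.adjoin k {N, y} := Algebra.subset_adjoin (by simp)
    exact pow_mem (sub_mem (mul_mem h1 h1) h2) c
  refine le_antisymm (permDiff_le_of_mem_adjoin N y (h y)) ?_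
  have := permDiff_le_of_mem_adjoin (k := k) (h := fun c => y ^ c) N (N * N - y) (fun c => by
    have := h (N * N - y) c
    rwa [sub_sub_cancel] at this)
  exact this

/-- The homogeneous components of the inverse of `1 - N + y`, where `N` has degree `1` and `y` has
degree `2`. -/
def geomSeq : ℕ → R
  | 0 => 1
  | 1 => N
  | d + 2 => N * geomSeq (d + 1) - y * geomSeq d

theorem geomSeq_mem_adjoin (d : ℕ) : geomSeq N y d ∈ Algebra.adjoin k {N, y} := by
  have h1 : N ∈ Algebra.adjoin k {N, y} := Algebra.subset_adjoin (by simp)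
  have h2 : y ∈ Algebra.adjoin k {N, y} := Algebra.subset_adjoin (by simp)
  induction d using geomSeq.induct with
  | case1 => exact one_mem _
  | case2 => exact h1
  | case3 d ih1 ih2 =>
    rw [geomSeq]
    exact sub_mem (mul_mem h1 ih1) (mul_mem h2 ih2)

theorem mul_geomSeq (d : ℕ) :
    y * geomSeq N y d = N * geomSeq N y (d + 1) - geomSeq N y (d + 2) := by
  rw [geomSeq]; abel

/-- The power `y ^ c` is reached by trading a factor `y` at a time for a step in the index of
`geomSeq`, by means of `mul_geomSeq`. -/
theorem pow_mem_headModule_geomSeq (c : ℕ) :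
    y ^ c ∈ headModule k (fun c => geomSeq N y (2 * c)) (fun c => N * geomSeq N y (2 * c)) := by
  set H := headModule k (fun c => geomSeq N y (2 * c)) (fun c => N * geomSeq N y (2 * c))
  have hNz : ∀ r ∈ H, N * r ∈ Algebra.adjoin k (Set.range fun c => N * geomSeq N y (2 * c)) :=
    fun r hr => left_mul_mem_adjoin (h := fun c => geomSeq N y (2 * c)) N hr
  have hz : ∀ c, geomSeq N y (2 * c) ∈ H := fun c =>
    Submodule.subset_span ⟨c, 1, one_mem _, by simp⟩
  induction c using Nat.strong_induction_on with
  | _ c ih =>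
    have hodd : ∀ d a, 2 * a + (2 * d + 1) < 2 * c → y ^ a * geomSeq N y (2 * d + 1) ∈ H := by
      intro d
      induction d with
      | zero =>
        intro a ha
        have := hNz _ (hz 0)
        simp only [geomSeq, mul_one] at this
        exact mul_mem_headModule (ih a (by omega)) this
      | succ d ihd =>
        intro a ha
        have e : y ^ a * geomSeq N y (2 * (d + 1) + 1) =
            y ^ a * (N * geomSeq N y (2 * (d + 1))) - y ^ (a + 1) * geomSeq N y (2 * d + 1) := by
          rw [pow_succ, mul_assoc, mul_geomSeq, mul_sub, show 2 * (d + 1) = 2 * d + 1 + 1 by ring]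
          abel
        rw [e]
        exact sub_mem (mul_mem_headModule (ih a (by omega)) (hNz _ (hz _)))
          (ihd (a + 1) (by omega))
    have heven : ∀ j ≤ c, y ^ j * geomSeq N y (2 * (c - j)) ∈ H := by
      intro j
      induction j with
      | zero => intro _; simpa using hz c
      | succ j ihj =>
        intro hj
        obtain ⟨d, rfl⟩ : ∃ d, c = d + (j + 1) := ⟨c - (j + 1), by omega⟩
        have h1 := ihj (by omega)
        rw [show d + (j + 1) - j = d + 1 by omega] at h1
        rw [show d + (j + 1) - (j + 1) = d by omega, pow_succ, mul_assoc, mul_geomSeq, mul_sub]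
        refine sub_mem (mul_mem_headModule (ih j (by omega)) (hNz _ ?_)) h1
        simpa using hodd d 0 (by omega)
    simpa [geomSeq] using heven c le_rfl

theorem permDiff_geomSeq_eq :
    permDiff k (fun c => geomSeq N y (2 * c)) (fun c => N * geomSeq N y (2 * c)) =
      permDiff k (fun c => y ^ c) (fun c => N * y ^ c) :=
  le_antisymm (permDiff_le_of_mem_adjoin N y fun c => geomSeq_mem_adjoin N y (2 * c))
    (permDiff_le (fun c => pow_mem_headModule_geomSeq N y c)
      (fun c => left_mul_mem_adjoin (h := fun c => geomSeq N y (2 * c)) N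
        (pow_mem_headModule_geomSeq N y c)))

/-- Every noncommutative polynomial in `N` and `y` lies in the head module of the `geomSeq`. -/
theorem adjoin_pair_le_headModule_geomSeq {r : R} (hr : r ∈ Algebra.adjoin k {N, y}) :
    r ∈ headModule k (fun c => geomSeq N y (2 * c)) (fun c => N * geomSeq N y (2 * c)) := by
  have hT : Algebra.adjoin k (Set.range fun c => N * y ^ c) ≤
      Algebra.adjoin k (Set.range fun c => N * geomSeq N y (2 * c)) := by
    refine Algebra.adjoin_le ?_
    rintro _ ⟨c, rfl⟩
    exact left_mul_mem_adjoin (h := fun c => geomSeq N y (2 * c)) N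
      (pow_mem_headModule_geomSeq N y c)
  have := mem_headModule_of_mem_adjoin_pair N y hr
  refine Submodule.span_le.2 ?_ this
  rintro _ ⟨c, t, ht, rfl⟩
  exact mul_mem_headModule (pow_mem_headModule_geomSeq N y c) (hT ht)

end TwoGenerators

/-! ### The three families of spanning elements -/

theorem exists_perm_of_ofFn_perm {α : Type*} [DecidableEq α] {m : ℕ} {f g : Fin m → α}
    (h : (List.ofFn f).Perm (List.ofFn g)) : ∃ t : Equiv.Perm (Fin m), ∀ i, g (t i) = f i := by
  have hc : ∀ a, Fintype.card {i // f i = a} = Fintype.card {i // g i = a} := by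
    intro a
    have h1 : (Finset.univ.val.map f).count a = (Finset.univ.val.map g).count a := by
      rw [Fin.univ_val_map, Fin.univ_val_map, Multiset.coe_eq_coe.2 h]
    rw [Multiset.count_map, Multiset.count_map] at h1
    rw [Fintype.card_subtype, Fintype.card_subtype]
    simp only [eq_comm] at h1 ⊢
    exact h1
  exact ⟨Equiv.ofFiberEquiv fun a => Fintype.equivOfCardEq (hc a),
    fun i => Equiv.ofFiberEquiv_map _ i⟩

/-- Operators on sequences of functions of a set `G`. The value at `s` of such a sequence encodes a
sum over the ways of continuing a composition from the partial sum `s`. -/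
abbrev SeqOp (k : Type*) [Field k] := Module.End k (ℕ → Finset ℕ → k)

/-- The shift by one. -/
def shiftOp (k : Type*) [Field k] : SeqOp k where
  toFun v s G := v (s + 1) G
  map_add' _ _ := rfl
  map_smul' _ _ := rfl

/-- The shift by two, restricted at the place `s` to the sets `G` that contain `s + 1`. -/
def pairOp (k : Type*) [Field k] : SeqOp k where
  toFun v s G := if s + 1 ∈ G then v (s + 2) G else 0
  map_add' v w := by
    ext s G
    simp only [Pi.add_apply]
    split_ifs <;> simp
  map_smul' a v := by
    ext s G
    simp only [Pi.smul_apply, RingHom.id_apply]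
    split_ifs <;> simp

/-- The combination of the `P_G` whose coefficients are the values at `0` of the image of the
sequence that is `1` at `n` and `0` elsewhere. -/
noncomputable def realize (k : Type*) [Field k] (n : ℕ) :
    SeqOp k →ₗ[k] MonoidAlgebra k (Equiv.Perm (Fin n)) where
  toFun r := ∑ G ∈ sparseSubsets n, r (fun s _ => if s = n then 1 else 0) 0 G • P k n G
  map_add' r r' := by
    simp only [LinearMap.add_apply, Pi.add_apply, add_smul, Finset.sum_add_distrib]
  map_smul' a r := by
    simp only [LinearMap.smul_apply, Pi.smul_apply, smul_eq_mul, mul_smul, Finset.smul_sum,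
      RingHom.id_apply]

theorem realize_apply {k : Type*} [Field k] (n : ℕ) (r : SeqOp k) :
    realize k n r =
      ∑ G ∈ sparseSubsets n, r (fun s _ => if s = n then 1 else 0) 0 G • P k n G := rfl

theorem prod_ofFn_seqOp_apply {k : Type*} [Field k] (G : Finset ℕ) {m : ℕ} (A : Fin m → SeqOp k)
    (b : Fin m → ℕ) (w : Fin m → ℕ → k)
    (hA : ∀ i v s, A i v s G = w i s * v (s + b i) G) (v : ℕ → Finset ℕ → k) (s : ℕ) :
    (List.ofFn A).prod v s G =
      (∏ i, w i (s + ∑ j ∈ Finset.univ.filter (· < i), b j)) * v (s + ∑ i, b i) G := by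
  induction m generalizing s with
  | zero => simp
  | succ m ih =>
    rw [List.ofFn_succ, List.prod_cons, Module.End.mul_apply, hA,
      ih (fun i => A i.succ) (fun i => b i.succ) (fun i => w i.succ) (fun i => hA i.succ),
      Fin.prod_univ_succ, Fin.sum_univ_succ, mul_assoc]
    have e0 : Finset.univ.filter (fun j : Fin (m + 1) => j < 0) = ∅ := by
      ext j; simp
    have e1 : ∀ i : Fin m, ∑ j ∈ Finset.univ.filter (fun j => j < i.succ), b j =
        b 0 + ∑ j ∈ Finset.univ.filter (fun j => j < i), b j.succ := by
      intro i
      rw [Finset.sum_filter, Fin.sum_univ_succ, if_pos (Fin.succ_pos i), Finset.sum_filter]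
      simp only [Fin.succ_lt_succ_iff]
    simp only [e0, e1, Finset.sum_empty, add_zero, add_assoc]

namespace AlmostOddComp

variable {n : ℕ}

/-- The almost-odd composition `(2 c, 2 a₁ + 1, …, 2 aₘ + 1)`. -/
def ofHalves (c : ℕ) {m : ℕ} (a : Fin m → ℕ) (h : 2 * c + ∑ i, (2 * a i + 1) = n) :
    AlmostOddComp n where
  head := 2 * c
  len := m
  parts i := 2 * a i + 1
  head_even := even_two_mul c
  parts_odd i := odd_two_mul_add_one (a i)
  sum_eq := h

end AlmostOddComp

/-- The number `1` if `p` holds, and `0` otherwise. -/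
noncomputable def indic (k : Type*) [Field k] (p : Prop) : k := by
  classical exact if p then 1 else 0

section Indicator

variable {k : Type*} [Field k]

theorem indic_eq_ite (p : Prop) [Decidable p] : indic k p = if p then 1 else 0 := by
  unfold indic
  congr

theorem indic_of_true {p : Prop} (h : p) : indic k p = 1 := by
  classical rw [indic_eq_ite, if_pos h]

theorem indic_of_false {p : Prop} (h : ¬ p) : indic k p = 0 := by
  classical rw [indic_eq_ite, if_neg h]

theorem indic_mul_indic (p q : Prop) : indic k p * indic k q = indic k (p ∧ q) := by
  by_cases hp : p <;> by_cases hq : q <;> simp [indic_of_true, indic_of_false, hp, hq]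

theorem prod_indic {ι : Type*} [Fintype ι] (p : ι → Prop) :
    ∏ i, indic k (p i) = indic k (∀ i, p i) := by
  classical
  simp only [indic_eq_ite]
  rw [Finset.prod_ite_zero]
  simp

end Indicator

section Families

/-- A family of elements of the peak algebra, indexed by almost-odd compositions, whose
coefficients are indicators that factor over the blocks of the composition. -/
structure BlockFamily (k : Type*) [Field k] (n : ℕ)
    (A : AlmostOddComp n → MonoidAlgebra k (Equiv.Perm (Fin n))) (h x : ℕ → SeqOp k)
    (hp : ℕ → Finset ℕ → Prop) (xp : ℕ → ℕ → Finset ℕ → Prop) : Prop where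
  head_apply : ∀ c, ∀ G ∈ sparseSubsets n, ∀ v,
    h c v 0 G = indic k (hp c G) * v (2 * c) G
  block_apply : ∀ c, ∀ G ∈ sparseSubsets n, ∀ v s,
    x c v s G = indic k (xp c s G) * v (s + (2 * c + 1)) G
  eq_sum : ∀ γ : AlmostOddComp n, A γ = ∑ G ∈ sparseSubsets n,
    indic k (hp (γ.head / 2) G ∧ ∀ i, xp (γ.parts i / 2) (γ.psum i) G) • P k n G

variable {k : Type*} [Field k] {n : ℕ}
  {A : AlmostOddComp n → MonoidAlgebra k (Equiv.Perm (Fin n))} {h x : ℕ → SeqOp k}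
  {hp : ℕ → Finset ℕ → Prop} {xp : ℕ → ℕ → Finset ℕ → Prop}

/-- The members of a block family are realized by products of the block operators. -/
theorem BlockFamily.apply (H : BlockFamily k n A h x hp xp) (γ : AlmostOddComp n) :
    A γ = realize k n (h (γ.head / 2) * ((List.ofFn fun i => γ.parts i / 2).map x).prod) := by
  rw [H.eq_sum, realize_apply]
  refine Finset.sum_congr rfl fun G hG => ?_
  rw [List.map_ofFn, Module.End.mul_apply, H.head_apply _ G hG,
    prod_ofFn_seqOp_apply G (x ∘ fun i => γ.parts i / 2) (fun i => γ.parts i)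
      (fun i s => indic k (xp (γ.parts i / 2) s G))]
  · have h1 : 2 * (γ.head / 2) = γ.head := Nat.two_mul_div_two_of_even γ.head_even
    rw [h1, γ.sum_eq, if_pos rfl, mul_one, prod_indic, indic_mul_indic]
    rfl
  · intro i v s
    have h1 : 2 * (γ.parts i / 2) + 1 = γ.parts i := Nat.two_mul_div_two_add_one_of_odd (γ.parts_odd i)
    simp only [Function.comp]
    rw [H.block_apply _ G hG, h1]

theorem BlockFamily.realize_ofHalves (H : BlockFamily k n A h x hp xp) (c : ℕ) {m : ℕ}
    (a : Fin m → ℕ) (hs : 2 * c + ∑ i, (2 * a i + 1) = n) :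
    realize k n (h c * ((List.ofFn a).map x).prod) = A (.ofHalves c a hs) := by
  rw [H.apply]
  have h1 : ∀ i, (2 * a i + 1) / 2 = a i := fun i => by omega
  simp [AlmostOddComp.ofHalves, h1]

theorem BlockFamily.realize_eq_zero (H : BlockFamily k n A h x hp xp) (c : ℕ) {m : ℕ}
    (a : Fin m → ℕ) (hs : 2 * c + ∑ i, (2 * a i + 1) ≠ n) :
    realize k n (h c * ((List.ofFn a).map x).prod) = 0 := by
  rw [realize_apply]
  refine Finset.sum_eq_zero fun G hG => ?_
  rw [List.map_ofFn, Module.End.mul_apply, H.head_apply _ G hG,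
    prod_ofFn_seqOp_apply G (x ∘ a) (fun i => 2 * a i + 1)
      (fun i s => indic k (xp (a i) s G))
      (fun i v s => H.block_apply _ G hG v s), if_neg hs]
  simp

theorem BlockFamily.span_differences (H : BlockFamily k n A h x hp xp) :
    Submodule.span k {r | ∃ (γ : AlmostOddComp n) (t : Equiv.Perm (Fin γ.len)),
      r = A γ - A (γ.permute t)} = (permDiff k h x).map (realize k n) := by
  refine le_antisymm (Submodule.span_le.2 ?_) ?_
  · rintro _ ⟨γ, t, rfl⟩
    rw [H.apply, H.apply, ← map_sub]
    refine Submodule.mem_map_of_mem (Submodule.subset_span ⟨_, _, _, ?_, rfl⟩)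
    exact (Equiv.Perm.ofFn_comp_perm t fun i => γ.parts i / 2).symm
  · rw [permDiff, Submodule.map_span, Submodule.span_le]
    rintro _ ⟨_, ⟨c, l, l', hl, rfl⟩, rfl⟩
    have hlen := hl.length_eq
    obtain ⟨m, a, rfl⟩ : ∃ m, ∃ a : Fin m → ℕ, l = List.ofFn a := ⟨_, l.get, by simp⟩
    obtain ⟨a', rfl⟩ : ∃ a' : Fin m → ℕ, l' = List.ofFn a' := by
      rw [List.length_ofFn] at hlen
      subst hlen
      exact ⟨l'.get, by simp⟩
    obtain ⟨t, ht⟩ := exists_perm_of_ofFn_perm hl.symm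
    obtain rfl : a ∘ t = a' := funext ht
    rw [SetLike.mem_coe, map_sub]
    have hsum : ∑ i, (2 * (a ∘ t) i + 1) = ∑ i, (2 * a i + 1) :=
      Equiv.sum_comp t fun i => 2 * a i + 1
    by_cases hs : 2 * c + ∑ i, (2 * a i + 1) = n
    · rw [H.realize_ofHalves c a hs, H.realize_ofHalves c (a ∘ t) (by rw [hsum, hs])]
      exact Submodule.subset_span ⟨.ofHalves c a hs, t, rfl⟩
    · rw [H.realize_eq_zero c a hs, H.realize_eq_zero c (a ∘ t) (by rwa [hsum])]
      simp

theorem BlockFamily.span_range (H : BlockFamily k n A h x hp xp) :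
    (headModule k h x).map (realize k n) ≤ Submodule.span k (Set.range A) := by
  rw [headModule, Submodule.map_span, Submodule.span_le]
  rintro _ ⟨_, ⟨c, t, ht, rfl⟩, rfl⟩
  refine adjoin_range_induction
    (p := fun t => realize k n (h c * t) ∈ Submodule.span k (Set.range A)) ?_ (by simp)
    (fun r s h1 h2 => by rw [mul_add, map_add]; exact add_mem h1 h2)
    (fun b r h1 => by rw [mul_smul_comm, map_smul]; exact Submodule.smul_mem _ _ h1) ht
  intro l
  obtain ⟨m, a, rfl⟩ : ∃ m, ∃ a : Fin m → ℕ, l = List.ofFn a := ⟨_, l.get, by simp⟩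
  by_cases hs : 2 * c + ∑ i, (2 * a i + 1) = n
  · rw [H.realize_ofHalves c a hs]
    exact Submodule.subset_span ⟨_, rfl⟩
  · rw [H.realize_eq_zero c a hs]
    exact zero_mem _

end Families

section Operators

variable {k : Type*} [Field k]

theorem shiftOp_apply (v : ℕ → Finset ℕ → k) (s : ℕ) (G : Finset ℕ) :
    shiftOp k v s G = v (s + 1) G := rfl

theorem pairOp_apply (v : ℕ → Finset ℕ → k) (s : ℕ) (G : Finset ℕ) :
    pairOp k v s G = if s + 1 ∈ G then v (s + 2) G else 0 := rfl

theorem pow_seqOp_apply {u : SeqOp k} {G : Finset ℕ} {p : ℕ → Prop}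
    (hu : ∀ v s, u v s G = indic k (p s) * v (s + 2) G) (c : ℕ)
    (v : ℕ → Finset ℕ → k) (s : ℕ) :
    (u ^ c) v s G = indic k (∀ j < c, p (s + 2 * j)) * v (s + 2 * c) G := by
  induction c generalizing s with
  | zero => simp [indic_of_true]
  | succ c ih =>
    rw [pow_succ', Module.End.mul_apply, hu, ih, ← mul_assoc, indic_mul_indic]
    congr 1
    · congr 1
      rw [eq_iff_iff]
      constructor
      · rintro ⟨h0, h1⟩ (_ | j) hj
        · exact h0
        · have := h1 j (by omega)
          rwa [show s + 2 * (j + 1) = s + 2 + 2 * j by ring]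
      · intro h
        refine ⟨h 0 (by omega), fun j hj => ?_⟩
        have := h (j + 1) (by omega)
        rwa [show s + 2 * (j + 1) = s + 2 + 2 * j by ring] at this
    · congr 1; ring

/-- The operator `geomSeq d` shifts by `d`, restricted at `s` to the sparse sets `G` without an element
strictly between `s` and `s + d`. -/
theorem geomSeq_apply {G : Finset ℕ} (hG : IsSparse G) (d : ℕ) (v : ℕ → Finset ℕ → k) (s : ℕ) :
    geomSeq (shiftOp k) (pairOp k) d v s G =
      indic k (∀ i, s < i → i < s + d → i ∉ G) * v (s + d) G := by
  induction d using geomSeq.induct generalizing s with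
  | case1 =>
    rw [indic_of_true (by intro i h1 h2; omega)]
    simp [geomSeq]
  | case2 =>
    rw [indic_of_true (by intro i h1 h2; omega)]
    simp [geomSeq, shiftOp_apply]
  | case3 d ih1 ih2 =>
    rw [geomSeq, LinearMap.sub_apply, Pi.sub_apply, Pi.sub_apply, Module.End.mul_apply,
      Module.End.mul_apply, shiftOp_apply, pairOp_apply, ih1, ih2,
      show s + 1 + (d + 1) = s + 2 + d by ring, show s + (d + 2) = s + 2 + d by ring]
    by_cases h1 : s + 1 ∈ G
    · rw [if_pos h1, indic_of_false (p := ∀ i, s < i → i < s + 2 + d → i ∉ G) (by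
        intro h
        exact h (s + 1) (by omega) (by omega) h1), zero_mul, sub_eq_zero]
      congr 2
      rw [eq_iff_iff]
      constructor
      · intro h i hi hi'
        exact h i (by omega) hi'
      · intro h i hi hi'
        rcases Nat.lt_or_ge (s + 2) i with h' | h'
        · exact h i h' hi'
        · rw [show i = s + 1 + 1 by omega]
          exact hG _ h1
    · rw [if_neg h1, sub_zero]
      congr 2
      rw [eq_iff_iff]
      constructor
      · intro h i hi hi'
        rcases Nat.lt_or_ge (s + 1) i with h' | h'
        · exact h i h' hi'
        · rwa [show i = s + 1 by omega]
      · intro h i hi hi'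
        exact h i (by omega) hi'

end Operators

namespace AlmostOddComp

variable {n : ℕ}

theorem forall_mem_sparseSet_iff (γ : AlmostOddComp n) (p : ℕ → Prop) :
    (∀ m ∈ γ.sparseSet, p m) ↔ (∀ j < γ.head / 2, p (2 * j + 1)) ∧
      ∀ i, ∀ j < γ.parts i / 2, p (γ.psum i + 1 + 2 * j + 1) := by
  constructor
  · intro h
    refine ⟨fun j hj => h _ ((γ.mem_sparseSet _).2 (Or.inl ⟨by omega, odd_two_mul_add_one j⟩)),
      fun i j hj => h _ ((γ.mem_sparseSet _).2 (Or.inr ⟨i, by omega, ?_, ?_⟩))⟩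
    · have := Nat.odd_iff.1 (γ.parts_odd i)
      omega
    · rw [Nat.even_iff]; omega
  · rintro ⟨h1, h2⟩ m hm
    rcases (γ.mem_sparseSet m).1 hm with ⟨h, c, rfl⟩ | ⟨i, h, h', h3⟩
    · have := Nat.even_iff.1 γ.head_even
      exact h1 c (by omega)
    · have := Nat.odd_iff.1 (γ.parts_odd i)
      rw [Nat.even_iff] at h3
      have := h2 i ((m - γ.psum i) / 2 - 1) (by omega)
      rwa [show γ.psum i + 1 + 2 * ((m - γ.psum i) / 2 - 1) + 1 = m by omega] at this

theorem mem_bar_iff_J (γ : AlmostOddComp n) {m : ℕ} (h1 : 1 ≤ m) (h2 : m < n) :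
    m ∈ bar n γ.sparseSet ↔ m ∉ γ.J ∧ m - 1 ∉ γ.J := by
  have hsub := (Finset.mem_filter.1 γ.sparseSet_mem).1
  rw [Finset.mem_powerset] at hsub
  have him : ∀ m, m ∈ γ.sparseSet.image (fun m => m - 1) ↔ m + 1 ∈ γ.sparseSet := by
    intro m
    simp only [Finset.mem_image]
    constructor
    · rintro ⟨a, ha, rfl⟩
      have := Finset.mem_Icc.1 (hsub ha)
      rwa [Nat.sub_add_cancel this.1]
    · exact fun h => ⟨m + 1, h, rfl⟩
  simp only [bar, Finset.mem_filter, Finset.mem_Icc, J_eq, Finset.mem_sdiff, Finset.mem_range,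
    Finset.mem_union, him, Nat.sub_add_cancel h1]
  have : m - 1 < n := by omega
  have : m ≤ n - 1 := by omega
  tauto

theorem forall_mem_bar_iff (γ : AlmostOddComp n) (p : ℕ → Prop) :
    (∀ m ∈ bar n γ.sparseSet, p m) ↔ (∀ m, 0 < m → m < γ.head → p m) ∧
      ∀ i, ∀ m, γ.psum i + 1 < m → m < γ.psum i + γ.parts i → p m := by
  constructor
  · intro h
    refine ⟨fun m h0 hm => h m ?_, fun i m hm hm' => h m ?_⟩
    · rw [γ.mem_bar_iff_J h0 (hm.trans_le γ.head_le_n)]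
      have : ∀ m < γ.head, m ∉ γ.J := by
        intro m hm
        simp only [J, Finset.mem_image, Finset.mem_univ, true_and, not_exists]
        intro i hi
        have := γ.head_le_psum i
        omega
      exact ⟨this m hm, this (m - 1) (by omega)⟩
    · have := γ.psum_add_le_n i
      rw [γ.mem_bar_iff_J (by omega) (by omega), γ.mem_J_block (i := i) (by omega) hm',
        γ.mem_J_block (i := i) (by omega) (by omega)]
      omega
  · rintro ⟨h1, h2⟩ m hm
    have hmI := Finset.mem_Icc.1 (Finset.mem_filter.1 hm).1
    rw [γ.mem_bar_iff_J (by omega) (by omega)] at hm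
    rcases γ.cover (m := m) (by omega) with h | ⟨i, hi, hi'⟩
    · exact h1 m (by omega) h
    · rw [γ.mem_J_block hi hi'] at hm
      refine h2 i m ?_ hi'
      have h3 := hm.2
      rw [γ.mem_J_block (i := i) (by omega) (by omega)] at h3
      omega

end AlmostOddComp

section Instances

variable (k : Type*) [Field k] (n : ℕ)

theorem isSparse_of_mem {G : Finset ℕ} (hG : G ∈ sparseSubsets n) : IsSparse G :=
  (Finset.mem_filter.1 hG).2

theorem subset_sdiff_iff {G F : Finset ℕ} (hG : G ∈ sparseSubsets n) :
    G ⊆ Finset.Icc 1 (n - 1) \ F ↔ ∀ m ∈ F, m ∉ G := by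
  have := Finset.mem_powerset.1 (Finset.mem_filter.1 hG).1
  constructor
  · intro h m hm hmG
    exact (Finset.mem_sdiff.1 (h hmG)).2 hm
  · intro h m hm
    exact Finset.mem_sdiff.2 ⟨this hm, fun hF => h m hF hm⟩

theorem pairOp_weight (v : ℕ → Finset ℕ → k) (s : ℕ) (G : Finset ℕ) :
    pairOp k v s G = indic k (s + 1 ∈ G) * v (s + 2) G := by
  rw [pairOp_apply, indic_eq_ite]
  split_ifs <;> simp

theorem shift_sub_pairOp_weight (v : ℕ → Finset ℕ → k) (s : ℕ) (G : Finset ℕ) :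
    (shiftOp k * shiftOp k - pairOp k) v s G = indic k (s + 1 ∉ G) * v (s + 2) G := by
  rw [LinearMap.sub_apply, Pi.sub_apply, Pi.sub_apply, pairOp_apply, Module.End.mul_apply,
    shiftOp_apply, shiftOp_apply]
  by_cases h : s + 1 ∈ G <;> simp [h, indic_of_true, indic_of_false]

theorem blockFamily_Q : BlockFamily k n (fun γ => γ.Q k) (fun c => pairOp k ^ c)
    (fun c => shiftOp k * pairOp k ^ c) (fun c G => ∀ j < c, 2 * j + 1 ∈ G)
    (fun c s G => ∀ j < c, s + 1 + 2 * j + 1 ∈ G) where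
  head_apply c G _ v := by
    rw [pow_seqOp_apply (fun v s => pairOp_weight k v s G)]
    simp only [zero_add]
  block_apply c G _ v s := by
    rw [Module.End.mul_apply, shiftOp_apply, pow_seqOp_apply (fun v s => pairOp_weight k v s G)]
    congr 2
    ring
  eq_sum γ := by
    rw [AlmostOddComp.Q, Q, Finset.sum_filter]
    refine Finset.sum_congr rfl fun G _ => ?_
    rw [← γ.forall_mem_sparseSet_iff (· ∈ G), ← Finset.subset_iff, indic_eq_ite]
    simp

theorem blockFamily_O : BlockFamily k n (fun γ => γ.O k)
    (fun c => (shiftOp k * shiftOp k - pairOp k) ^ c)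
    (fun c => shiftOp k * (shiftOp k * shiftOp k - pairOp k) ^ c)
    (fun c G => ∀ j < c, 2 * j + 1 ∉ G) (fun c s G => ∀ j < c, s + 1 + 2 * j + 1 ∉ G) where
  head_apply c G _ v := by
    rw [pow_seqOp_apply (fun v s => shift_sub_pairOp_weight k v s G)]
    simp only [zero_add]
  block_apply c G _ v s := by
    rw [Module.End.mul_apply, shiftOp_apply,
      pow_seqOp_apply (fun v s => shift_sub_pairOp_weight k v s G)]
    congr 2
    ring
  eq_sum γ := by
    rw [AlmostOddComp.O, O, Finset.sum_filter]
    refine Finset.sum_congr rfl fun G hG => ?_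
    rw [← γ.forall_mem_sparseSet_iff (· ∉ G), ← subset_sdiff_iff n hG, indic_eq_ite]
    simp

theorem blockFamily_OBar : BlockFamily k n (fun γ => γ.OBar k)
    (fun c => geomSeq (shiftOp k) (pairOp k) (2 * c))
    (fun c => shiftOp k * geomSeq (shiftOp k) (pairOp k) (2 * c))
    (fun c G => ∀ i, 0 < i → i < 2 * c → i ∉ G)
    (fun c s G => ∀ i, s + 1 < i → i < s + (2 * c + 1) → i ∉ G) where
  head_apply c G hG v := by
    rw [geomSeq_apply (isSparse_of_mem n hG), zero_add]
  block_apply c G hG v s := by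
    rw [Module.End.mul_apply, shiftOp_apply, geomSeq_apply (isSparse_of_mem n hG),
      show s + 1 + 2 * c = s + (2 * c + 1) by ring]
  eq_sum γ := by
    rw [AlmostOddComp.OBar, OBar, Finset.sum_filter]
    refine Finset.sum_congr rfl fun G hG => ?_
    have h1 : 2 * (γ.head / 2) = γ.head := Nat.two_mul_div_two_of_even γ.head_even
    have h2 : ∀ i, 2 * (γ.parts i / 2) + 1 = γ.parts i := fun i =>
      Nat.two_mul_div_two_add_one_of_odd (γ.parts_odd i)
    simp only [h1, h2]
    rw [← γ.forall_mem_bar_iff (· ∉ G), ← subset_sdiff_iff n hG, indic_eq_ite]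
    simp

theorem span_differences_Q_eq_OBar :
    Submodule.span k {r | ∃ (γ : AlmostOddComp n) (t : Equiv.Perm (Fin γ.len)),
      r = γ.Q k - (γ.permute t).Q k} =
    Submodule.span k {r | ∃ (γ : AlmostOddComp n) (t : Equiv.Perm (Fin γ.len)),
      r = γ.OBar k - (γ.permute t).OBar k} := by
  rw [(blockFamily_Q k n).span_differences, (blockFamily_OBar k n).span_differences,
    permDiff_geomSeq_eq]

theorem span_differences_O_eq_OBar :
    Submodule.span k {r | ∃ (γ : AlmostOddComp n) (t : Equiv.Perm (Fin γ.len)),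
      r = γ.O k - (γ.permute t).O k} =
    Submodule.span k {r | ∃ (γ : AlmostOddComp n) (t : Equiv.Perm (Fin γ.len)),
      r = γ.OBar k - (γ.permute t).OBar k} := by
  rw [(blockFamily_O k n).span_differences, (blockFamily_OBar k n).span_differences,
    permDiff_geomSeq_eq, permDiff_sub_eq]

/-- `Q_F` is realized by a word in the two shifts, for every sparse `F`. -/
theorem exists_word {F : Finset ℕ} (hF : IsSparse F) (d s : ℕ) :
    ∃ r ∈ Algebra.adjoin k {shiftOp k, pairOp k}, ∀ (v : ℕ → Finset ℕ → k) (G : Finset ℕ),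
      r v s G = indic k (F ∩ Finset.Ioo s (s + d) ⊆ G) * v (s + d) G := by
  have h1 : shiftOp k ∈ Algebra.adjoin k {shiftOp k, pairOp k} := Algebra.subset_adjoin (by simp)
  have h2 : pairOp k ∈ Algebra.adjoin k {shiftOp k, pairOp k} := Algebra.subset_adjoin (by simp)
  induction d using Nat.strong_induction_on generalizing s with
  | _ d ih =>
    rcases d with _ | _ | d
    · exact ⟨1, one_mem _, fun v G => by simp [indic_of_true]⟩
    · refine ⟨shiftOp k, h1, fun v G => ?_⟩
      have : Finset.Ioo s (s + (0 + 1)) = ∅ := by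
        ext i; simp only [Finset.mem_Ioo, Finset.notMem_empty, iff_false]; omega
      rw [this, shiftOp_apply]
      simp [indic_of_true]
    · by_cases hs : s + 1 ∈ F
      · obtain ⟨r, hr, hr'⟩ := ih d (by omega) (s + 2)
        refine ⟨pairOp k * r, mul_mem h2 hr, fun v G => ?_⟩
        rw [Module.End.mul_apply, pairOp_weight, hr', ← mul_assoc, indic_mul_indic,
          show s + 2 + d = s + (d + 1 + 1) by ring]
        congr 2
        rw [eq_iff_iff]
        simp only [Finset.subset_iff, Finset.mem_inter, Finset.mem_Ioo]
        constructor
        · rintro ⟨h, h'⟩ i ⟨hiF, hi⟩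
          rcases (by omega : i = s + 1 ∨ i = s + 1 + 1 ∨ s + 2 < i) with rfl | rfl | h3
          · exact h
          · exact absurd hiF (hF _ hs)
          · exact h' ⟨hiF, by omega⟩
        · intro h
          exact ⟨h ⟨hs, by omega⟩, fun i hi => h ⟨hi.1, by omega⟩⟩
      · obtain ⟨r, hr, hr'⟩ := ih (d + 1) (by omega) (s + 1)
        refine ⟨shiftOp k * r, mul_mem h1 hr, fun v G => ?_⟩
        rw [Module.End.mul_apply, shiftOp_apply, hr',
          show s + 1 + (d + 1) = s + (d + 1 + 1) by ring]
        congr 2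
        rw [eq_iff_iff]
        simp only [Finset.subset_iff, Finset.mem_inter, Finset.mem_Ioo]
        constructor
        · rintro h i ⟨hiF, hi⟩
          refine h ⟨hiF, ?_⟩
          have : i ≠ s + 1 := by rintro rfl; exact hs hiF
          omega
        · intro h i hi
          exact h ⟨hi.1, by omega⟩

theorem Q_mem_span_OBar {F : Finset ℕ} (hF : F ∈ sparseSubsets n) :
    Q k n F ∈ Submodule.span k (Set.range fun γ : AlmostOddComp n => γ.OBar k) := by
  refine (blockFamily_OBar k n).span_range ?_
  obtain ⟨r, hr, hr'⟩ := exists_word k (isSparse_of_mem n hF) n 0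
  refine ⟨r, adjoin_pair_le_headModule_geomSeq _ _ hr, ?_⟩
  have hsub := Finset.mem_powerset.1 (Finset.mem_filter.1 hF).1
  have : F ∩ Finset.Ioo 0 (0 + n) = F := by
    rw [Finset.inter_eq_left]
    intro i hi
    have := Finset.mem_Icc.1 (hsub hi)
    rw [Finset.mem_Ioo]; omega
  rw [realize_apply, Q, Finset.sum_filter]
  refine Finset.sum_congr rfl fun G _ => ?_
  rw [hr', this, indic_eq_ite]
  simp

/-- The `P_F` are combinations of the `Q_G` by inversion, hence of the `Ō_γ`. -/
theorem peakSpace_le_span_OBar :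
    peakSpace k n ≤ Submodule.span k (Set.range fun γ : AlmostOddComp n => γ.OBar k) := by
  refine Submodule.span_le.2 ?_
  rintro _ ⟨F, hF, rfl⟩
  have key : ∀ m, ∀ F ∈ sparseSubsets n, n - F.card ≤ m →
      P k n F ∈ Submodule.span k (Set.range fun γ : AlmostOddComp n => γ.OBar k) := by
    intro m
    induction m with
    | zero =>
      intro F hF hm
      have hc := Finset.card_le_card (Finset.mem_powerset.1 (Finset.mem_filter.1 hF).1)
      rw [Nat.card_Icc] at hc
      have e : ∑ G ∈ (sparseSubsets n).filter (fun G => F ⊆ G), P k n G = P k n F := by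
        refine Finset.sum_eq_single_of_mem F (by simp [hF]) fun G hG hne => ?_
        rw [Finset.mem_filter] at hG
        have h1 := Finset.card_lt_card (hG.2.ssubset_of_ne hne.symm)
        have h2 := Finset.card_le_card (Finset.mem_powerset.1 (Finset.mem_filter.1 hG.1).1)
        rw [Nat.card_Icc] at h2
        omega
      rw [← e]
      exact Q_mem_span_OBar k n hF
    | succ m ih =>
      intro F hF hm
      have e : Q k n F = P k n F +
          ∑ G ∈ ((sparseSubsets n).filter (fun G => F ⊆ G)).erase F, P k n G :=
        (Finset.add_sum_erase _ _ (by simp [hF])).symm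
      rw [← sub_eq_iff_eq_add] at e
      rw [← e]
      refine sub_mem (Q_mem_span_OBar k n hF) (Submodule.sum_mem _ fun G hG => ?_)
      rw [Finset.mem_erase, Finset.mem_filter] at hG
      have h1 := Finset.card_lt_card (hG.2.2.ssubset_of_ne hG.1.symm)
      have h2 := Finset.card_le_card (Finset.mem_powerset.1 (Finset.mem_filter.1 hG.2.1).1)
      rw [Nat.card_Icc] at h2
      exact ih G hG.2.1 (by omega)
  exact key _ F hF le_rfl

end Instances

/-! ### A permutation with a given peak set -/

section PeakPerm

variable {n : ℕ}

theorem peak_mem_sparseSubsets (w : Equiv.Perm (Fin n)) : peak w ∈ sparseSubsets n := by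
  rw [sparseSubsets, Finset.mem_filter, Finset.mem_powerset]
  refine ⟨Finset.filter_subset _ _, fun i hi hi' => ?_⟩
  simp only [peak, Finset.mem_filter, Nat.add_sub_cancel] at hi hi'
  omega

/-- The product of the transpositions that exchange the positions `i` and `i + 1`, for `i ∈ G`. -/
def swapFun (n : ℕ) (G : Finset ℕ) (i : Fin n) : Fin n :=
  if h : (i : ℕ) + 1 ∈ G ∧ (i : ℕ) + 1 < n then ⟨i + 1, h.2⟩
  else if (i : ℕ) ∈ G then ⟨i - 1, by omega⟩ else i

theorem swapFun_involutive {G : Finset ℕ} (hG : G ∈ sparseSubsets n) :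
    Function.Involutive (swapFun n G) := by
  obtain ⟨h1, h2⟩ := Finset.mem_filter.1 hG
  rw [Finset.mem_powerset] at h1
  have hI : ∀ i ∈ G, 1 ≤ i ∧ i < n := fun i hi => by
    have := Finset.mem_Icc.1 (h1 hi); omega
  intro i
  by_cases h : (i : ℕ) + 1 ∈ G ∧ (i : ℕ) + 1 < n
  · have e : swapFun n G i = ⟨i + 1, h.2⟩ := dif_pos h
    rw [e]
    unfold swapFun
    rw [dif_neg (fun h' => h2 _ h.1 h'.1), if_pos h.1]
    simp
  · by_cases h' : (i : ℕ) ∈ G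
    · have e : swapFun n G i = ⟨i - 1, by omega⟩ := by
        unfold swapFun
        rw [dif_neg h, if_pos h']
      have := hI _ h'
      have e' : (i : ℕ) - 1 + 1 = i := by omega
      rw [e]
      unfold swapFun
      simp only [e', h', i.2, and_self, dif_pos]
    · have e : swapFun n G i = i := by
        unfold swapFun
        rw [dif_neg h, if_neg h']
      rw [e, e]

/-- A permutation with peak set `G`. -/
def peakPerm {G : Finset ℕ} (hG : G ∈ sparseSubsets n) : Equiv.Perm (Fin n) :=
  (swapFun_involutive hG).toPerm

theorem value_peakPerm {G : Finset ℕ} (hG : G ∈ sparseSubsets n) {i : ℕ} (h1 : 1 ≤ i)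
    (hn : i ≤ n) : value (peakPerm hG) i =
      if i ∈ G then i + 1 else if i - 1 ∈ G then i - 1 else i := by
  obtain ⟨h3, -⟩ := Finset.mem_filter.1 hG
  rw [Finset.mem_powerset] at h3
  have hI : ∀ i ∈ G, 1 ≤ i ∧ i < n := fun i hi => by
    have := Finset.mem_Icc.1 (h3 hi); omega
  obtain ⟨j, rfl⟩ : ∃ j, i = j + 1 := ⟨i - 1, by omega⟩
  have := value_succ (peakPerm hG) ⟨j, by omega⟩
  simp only at this
  rw [this, Nat.add_sub_cancel]
  change (swapFun n G ⟨j, by omega⟩ : ℕ) + 1 = _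
  unfold swapFun
  simp only
  by_cases hj : j + 1 ∈ G
  · rw [dif_pos ⟨hj, (hI _ hj).2⟩, if_pos hj]
  · rw [dif_neg (fun h => hj h.1), if_neg hj]
    split_ifs with h
    · have := hI _ h
      simp only
      omega
    · rfl

theorem peak_peakPerm {G : Finset ℕ} (hG : G ∈ sparseSubsets n) : peak (peakPerm hG) = G := by
  obtain ⟨h1, h2⟩ := Finset.mem_filter.1 hG
  rw [Finset.mem_powerset] at h1
  ext i
  have hs : ∀ j, j ∈ G → j + 1 ∉ G := h2
  by_cases hi : 1 ≤ i ∧ i ≤ n - 1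
  · have hpi := value_peakPerm hG hi.1 (by omega)
    have hpn := value_peakPerm hG (show 1 ≤ i + 1 by omega) (by omega)
    have hpp : value (peakPerm hG) (i - 1) ≤ i - 1 ∨ i - 1 ∈ G := by
      by_cases h : i - 1 ∈ G
      · exact Or.inr h
      · left
        rcases Nat.eq_zero_or_pos (i - 1) with h0 | h0
        · rw [h0, value_zero]
        · rw [value_peakPerm hG h0 (by omega), if_neg h]
          split_ifs <;> omega
    rw [Nat.add_sub_cancel] at hpn
    simp only [peak, Finset.mem_filter, Finset.mem_Icc, hi, true_and, and_self]
    by_cases hiG : i ∈ G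
    · rw [if_pos hiG] at hpi
      rw [if_neg (hs i hiG), if_pos hiG] at hpn
      have : i - 1 ∉ G := fun h => hs _ h (by rwa [Nat.sub_add_cancel hi.1])
      have := hpp.resolve_right this
      simp only [hiG, iff_true]
      omega
    · rw [if_neg hiG] at hpi hpn
      simp only [hiG, iff_false]
      split_ifs at hpi hpn <;> omega
  · constructor
    · intro h
      exact absurd (Finset.mem_Icc.1 (Finset.mem_filter.1 h).1) hi
    · intro h
      exact absurd (Finset.mem_Icc.1 (h1 h)) hi

end PeakPerm

/-! ### A functional that detects the number of blocks -/

section Functional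

variable (k : Type*) [Field k] (n : ℕ)

/-- The coefficient at a permutation. -/
def coeffAt (w : Equiv.Perm (Fin n)) : MonoidAlgebra k (Equiv.Perm (Fin n)) →ₗ[k] k where
  toFun x := x.coeff w
  map_add' _ _ := rfl
  map_smul' _ _ := rfl

theorem coeffAt_V (J : Finset ℕ) (w : Equiv.Perm (Fin n)) :
    coeffAt k n w (V k n J) = indic k (∀ i ∈ peak w, i ∈ J ∨ i - 1 ∈ J) := by
  rw [V, map_sum]
  have : ∀ u : Equiv.Perm (Fin n), coeffAt k n w (MonoidAlgebra.of k _ u) =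
      if u = w then 1 else 0 := by
    intro u
    exact Finsupp.single_apply
  simp only [this, Finset.sum_ite_eq', Finset.mem_filter, Finset.mem_univ, true_and]
  rw [indic_eq_ite]

/-- Up to sign, the coefficient of `Q_F` in the basis of the peak algebra formed by the `Q_G`. -/
noncomputable def coeffQ (F : Finset ℕ) : MonoidAlgebra k (Equiv.Perm (Fin n)) →ₗ[k] k :=
  ∑ G ∈ F.powerset, (-1 : k) ^ G.card •
    if hG : G ∈ sparseSubsets n then coeffAt k n (peakPerm hG) else 0

theorem sparseSubsets_mono {F G : Finset ℕ} (hF : F ∈ sparseSubsets n) (h : G ⊆ F) :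
    G ∈ sparseSubsets n := by
  obtain ⟨h1, h2⟩ := Finset.mem_filter.1 hF
  rw [Finset.mem_powerset] at h1
  exact Finset.mem_filter.2 ⟨Finset.mem_powerset.2 (h.trans h1),
    fun i hi hi' => h2 i (h hi) (h hi')⟩

/-- Evaluated at `V J`, the alternating sum over the subsets of `F` cancels as soon as `F` has an
element in `J ∪ (J + 1)`. -/
theorem coeffQ_V {F : Finset ℕ} (hF : F ∈ sparseSubsets n) (J : Finset ℕ) :
    coeffQ k n F (V k n J) = indic k (∀ i ∈ F, i ∉ J ∧ i - 1 ∉ J) := by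
  set E := F.filter (fun i => i ∈ J ∨ i - 1 ∈ J) with hE
  have h1 : coeffQ k n F (V k n J) = ∑ G ∈ E.powerset, (-1 : k) ^ G.card := by
    rw [coeffQ, LinearMap.sum_apply]
    have : E.powerset = F.powerset.filter (fun G => ∀ i ∈ G, i ∈ J ∨ i - 1 ∈ J) := by
      ext G
      simp only [hE, Finset.mem_powerset, Finset.mem_filter, Finset.subset_iff]
      exact ⟨fun h => ⟨fun i hi => (h hi).1, fun i hi => (h hi).2⟩,
        fun h i hi => ⟨h.1 hi, h.2 i hi⟩⟩
    rw [this, Finset.sum_filter]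
    refine Finset.sum_congr rfl fun G hG => ?_
    have hG' := sparseSubsets_mono n hF (Finset.mem_powerset.1 hG)
    rw [dif_pos hG', LinearMap.smul_apply, coeffAt_V, peak_peakPerm, indic_eq_ite]
    simp
  have h2 : ∑ G ∈ E.powerset, (-1 : k) ^ G.card = if E = ∅ then 1 else 0 := by
    have := congrArg (Int.cast : ℤ → k) (Finset.sum_powerset_neg_one_pow_card (x := E))
    push_cast at this
    exact this
  rw [h1, h2, indic_eq_ite]
  congr 1
  rw [eq_iff_iff, hE, Finset.filter_eq_empty_iff]
  simp only [not_or]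

end Functional

/-! ### Almost-odd compositions as block sizes -/

namespace AlmostOddComp

variable (k : Type*) [Field k] {n : ℕ}

theorem sum_filter_peak (p : Finset ℕ → Prop) [DecidablePred p] :
    ∑ G ∈ (sparseSubsets n).filter p, P k n G =
      ∑ w ∈ (Finset.univ : Finset (Equiv.Perm (Fin n))).filter (fun w => p (peak w)),
        MonoidAlgebra.of k (Equiv.Perm (Fin n)) w := by
  rw [← Finset.sum_fiberwise_of_maps_to (t := (sparseSubsets n).filter p) (g := peak)
    (fun w hw => Finset.mem_filter.2 ⟨peak_mem_sparseSubsets w, (Finset.mem_filter.1 hw).2⟩)]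
  refine Finset.sum_congr rfl fun G hG => Finset.sum_congr ?_ fun _ _ => rfl
  ext w
  simp only [Finset.mem_filter, Finset.mem_univ, true_and]
  exact ⟨fun h => ⟨h ▸ (Finset.mem_filter.1 hG).2, h⟩, fun h => h.2⟩

theorem OBar_eq_V (γ : AlmostOddComp n) : γ.OBar k = V k n γ.J := by
  rw [OBar, PeakAlg.OBar, sum_filter_peak, V]
  refine Finset.sum_congr (Finset.filter_congr fun w _ => ?_) fun _ _ => rfl
  rw [subset_sdiff_iff n (peak_mem_sparseSubsets w)]
  constructor
  · intro h i hi
    have hI := Finset.mem_Icc.1 (Finset.mem_filter.1 hi).1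
    by_contra hc
    rw [not_or] at hc
    exact h i ((γ.mem_bar_iff_J hI.1 (by omega)).2 hc) hi
  · intro h i hi hi'
    have hI := Finset.mem_Icc.1 (Finset.mem_filter.1 hi).1
    rw [γ.mem_bar_iff_J hI.1 (by omega)] at hi
    rcases h i hi' with h | h
    · exact hi.1 h
    · exact hi.2 h

theorem parts_pos (γ : AlmostOddComp n) (i : Fin γ.len) : 0 < γ.parts i := (γ.parts_odd i).pos

theorem sum_parts_le (γ : AlmostOddComp n) : ∑ i, γ.parts i ≤ n := by
  have := γ.sum_eq; omega

theorem blockStart_eq_psum (γ : AlmostOddComp n) (i : Fin γ.len) :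
    blockStart n (fun i : Fin γ.len => (i : ℕ)) γ.parts i = γ.psum i := by
  have h1 := γ.sum_eq
  have h2 := Finset.sum_filter_add_sum_filter_not Finset.univ (fun j => j < i) γ.parts
  simp only [not_lt] at h2
  have h3 : tailSize (fun i : Fin γ.len => (i : ℕ)) γ.parts i =
      ∑ j ∈ Finset.univ.filter (fun j => i ≤ j), γ.parts j := rfl
  unfold blockStart psum
  rw [h3]
  omega

/-- The sum over signed words that belongs to an almost-odd composition. -/
noncomputable def X (γ : AlmostOddComp n) : MonoidAlgebra k (Equiv.Perm (Fin n)) :=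
  PeakAlg.X k n (fun i : Fin γ.len => (i : ℕ)) γ.parts

theorem X_eq_smul_OBar (γ : AlmostOddComp n) : γ.X k = (2 : k) ^ γ.len • γ.OBar k := by
  rw [X, X_eq k Fin.val_injective γ.parts_pos γ.sum_parts_le, OBar_eq_V, Fintype.card_fin]
  have : Finset.univ.image (blockStart n (fun i : Fin γ.len => (i : ℕ)) γ.parts) = γ.J :=
    Finset.image_congr fun i _ => γ.blockStart_eq_psum i
  rw [this]

theorem X_mem_filtration (γ : AlmostOddComp n) : γ.X k ∈ filtration k n γ.len :=
  Submodule.subset_span ⟨Fin γ.len, inferInstance, inferInstance, _, _, Fin.val_injective,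
    γ.parts_pos, (Fintype.card_fin _).ge, rfl⟩

theorem card_J_le (γ : AlmostOddComp n) : γ.J.card ≤ γ.len :=
  Finset.card_image_le.trans (by simp)

theorem mem_J_of_forall (γ : AlmostOddComp n) {J : Finset ℕ} (hJ : ∀ j ∈ J, j < n)
    (h : ∀ i ∈ γ.sparseSet, i ∉ J ∧ i - 1 ∉ J) : J ⊆ γ.J := by
  intro j hj
  rw [J_eq, Finset.mem_sdiff, Finset.mem_range, Finset.mem_union, Finset.mem_image]
  refine ⟨hJ j hj, ?_⟩
  rintro (h' | ⟨i, hi, rfl⟩)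
  · exact (h j h').1 hj
  · exact (h i hi).2 hj

/-- The coefficient of `Q_γ` vanishes on the elements with more blocks than `γ`. -/
theorem coeffQ_eq_zero (γ : AlmostOddComp n) {x : MonoidAlgebra k (Equiv.Perm (Fin n))}
    (hx : x ∈ filtration k n (γ.len + 1)) : coeffQ k n γ.sparseSet x = 0 := by
  induction hx using Submodule.span_induction with
  | mem x hx =>
    obtain ⟨B, _, _, pos, c, hp, hc, hm, rfl⟩ := hx
    by_cases hs : n < ∑ b, c b
    · rw [X_eq_zero k pos hs, map_zero]
    · rw [not_lt] at hs
      have hb := blockAt_blockStart hp hc hs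
      have hinj : Function.Injective (blockStart n pos c) := by
        intro a b hab
        have h1 := hb a
        rw [hab, hb b] at h1
        exact (Option.some.inj h1).symm
      rw [X_eq k hp hc hs, map_smul, coeffQ_V k n γ.sparseSet_mem, indic_of_false, smul_zero]
      intro h
      have hsub := γ.mem_J_of_forall (by
        intro j hj
        obtain ⟨b, -, rfl⟩ := Finset.mem_image.1 hj
        have := ((blockAt_eq_some hp).1 (hb b)).2
        omega) h
      have := Finset.card_le_card hsub
      rw [Finset.card_image_of_injective _ hinj, Finset.card_univ] at this
      have := γ.card_J_le
      omega
  | zero => simp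
  | add x y _ _ h1 h2 => rw [map_add, h1, h2, add_zero]
  | smul a x _ h => rw [map_smul, h, smul_zero]

theorem coeffQ_X (γ : AlmostOddComp n) : coeffQ k n γ.sparseSet (γ.X k) = 2 ^ γ.len := by
  rw [X_eq_smul_OBar, OBar_eq_V, map_smul, coeffQ_V k n γ.sparseSet_mem, indic_of_true]
  · simp
  · intro i hi
    have hI := Finset.mem_Icc.1 (Finset.mem_powerset.1 (Finset.mem_filter.1 γ.sparseSet_mem).1 hi)
    rw [← γ.mem_bar_iff_J hI.1 (by omega)]
    exact Finset.mem_filter.2 ⟨Finset.mem_Icc.2 hI, Or.inl hi⟩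

theorem X_notMem_filtration (h2 : (2 : k) ≠ 0) (γ : AlmostOddComp n) :
    γ.X k ∉ filtration k n (γ.len + 1) := by
  intro h
  have := γ.coeffQ_eq_zero k h
  rw [coeffQ_X] at this
  exact pow_ne_zero _ h2 this

theorem OBar_eq_smul_X (h2 : (2 : k) ≠ 0) (γ : AlmostOddComp n) :
    γ.OBar k = ((2 : k) ^ γ.len)⁻¹ • γ.X k := by
  rw [X_eq_smul_OBar, smul_smul, inv_mul_cancel₀ (pow_ne_zero _ h2), one_smul]

/-- Two almost-odd compositions are equivalent if their odd parts agree up to the order. -/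
def Equivalent (γ δ : AlmostOddComp n) : Prop :=
  ∃ σ : Fin γ.len ≃ Fin δ.len, ∀ j, δ.parts (σ j) = γ.parts j

theorem Equivalent.exists_permute {γ δ : AlmostOddComp n} (h : γ.Equivalent δ) :
    ∃ t, δ = γ.permute t := by
  obtain ⟨σ, hσ⟩ := h
  have hlen : γ.len = δ.len := by simpa using Fintype.card_congr σ
  have hsum : ∑ i, δ.parts i = ∑ i, γ.parts i := by
    rw [← Equiv.sum_comp σ]
    exact Finset.sum_congr rfl fun i _ => hσ i
  have hhead : γ.head = δ.head := by
    have := γ.sum_eq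
    have := δ.sum_eq
    omega
  obtain ⟨head, len, parts, h1, h2, h3⟩ := γ
  obtain ⟨head', len', parts', h1', h2', h3'⟩ := δ
  simp only at hlen hhead σ hσ
  subst hlen hhead
  refine ⟨σ.symm, ?_⟩
  have : parts' = fun i => parts (σ.symm i) := by
    ext i
    rw [← hσ, Equiv.apply_symm_apply]
  subst this
  rfl

theorem equivalent_equivalence : Equivalence (Equivalent (n := n)) where
  refl γ := ⟨Equiv.refl _, fun _ => rfl⟩
  symm := by
    rintro γ δ ⟨σ, hσ⟩
    exact ⟨σ.symm, fun j => by rw [← hσ, Equiv.apply_symm_apply]⟩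
  trans := by
    rintro γ δ ε ⟨σ, hσ⟩ ⟨τ, hτ⟩
    exact ⟨σ.trans τ, fun j => by rw [Equiv.trans_apply, hτ, hσ]⟩

end AlmostOddComp

/-! ### The peak algebra and its radical -/

section PeakAlgebra

variable (k : Type*) [Field k] (n : ℕ)

theorem V_mem_peakSpace (J : Finset ℕ) : V k n J ∈ peakSpace k n := by
  have : V k n J = ∑ G ∈ (sparseSubsets n).filter (fun G => ∀ i ∈ G, i ∈ J ∨ i - 1 ∈ J),
      P k n G := by rw [AlmostOddComp.sum_filter_peak, V]
  rw [this]
  exact Submodule.sum_mem _ fun G hG =>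
    Submodule.subset_span ⟨G, (Finset.mem_filter.1 hG).1, rfl⟩

theorem filtration_zero_le_peakSpace : filtration k n 0 ≤ peakSpace k n := by
  refine Submodule.span_le.2 ?_
  rintro _ ⟨B, _, _, pos, c, hp, hc, -, rfl⟩
  by_cases hs : n < ∑ b, c b
  · rw [X_eq_zero k pos hs]; exact zero_mem _
  · rw [X_eq k hp hc (not_lt.1 hs)]
    exact Submodule.smul_mem _ _ (V_mem_peakSpace k n _)

theorem span_OBar_le_filtration (h2 : (2 : k) ≠ 0) :
    Submodule.span k (Set.range fun γ : AlmostOddComp n => γ.OBar k) ≤ filtration k n 0 := by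
  refine Submodule.span_le.2 ?_
  rintro _ ⟨γ, rfl⟩
  simp only
  rw [γ.OBar_eq_smul_X k h2]
  exact Submodule.smul_mem _ _ (filtration_antitone k n (Nat.zero_le _) (γ.X_mem_filtration k))

theorem filtration_zero_eq_peakSpace (h2 : (2 : k) ≠ 0) : filtration k n 0 = peakSpace k n :=
  le_antisymm (filtration_zero_le_peakSpace k n)
    ((peakSpace_le_span_OBar k n).trans (span_OBar_le_filtration k n h2))

theorem one_mem_filtration : (1 : MonoidAlgebra k (Equiv.Perm (Fin n))) ∈ filtration k n 0 := by
  refine Submodule.subset_span ⟨Empty, inferInstance, inferInstance, Empty.elim, Empty.elim,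
    fun a => a.elim, fun a => a.elim, Nat.zero_le _, ?_⟩
  have hu : words n (Empty.elim : Empty → ℕ) = {fun _ => none} := by
    ext f
    simp only [words, IsEmpty.forall_iff, Finset.filter_true, Finset.mem_univ,
      Finset.mem_singleton, true_iff]
    ext1 i
    rcases f i with _ | ⟨a, _⟩
    · rfl
    · exact a.elim
  have hs : sortPerm (code (Empty.elim : Empty → ℕ) ∘ fun _ : Fin n => none) = 1 := by
    rw [eq_sortPerm_iff]
    intro i j hij
    simp only [Function.comp, Equiv.Perm.coe_one, id, sortKey_lt_iff, code_none]
    exact Or.inr ⟨trivial, Or.inl ⟨Even.zero, hij⟩⟩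
  rw [X, hu, Finset.sum_singleton, hs, map_one]

/-- The peak algebra. -/
noncomputable def peakAlgebra : Subalgebra k (MonoidAlgebra k (Equiv.Perm (Fin n))) :=
  (filtration k n 0).toSubalgebra (one_mem_filtration k n)
    fun _ _ hx hy => filtration_mul_mem k n hx hy

/-- The span of the differences of the `Ō_γ` over the rearrangements of `γ`. -/
noncomputable def differenceSpace : Submodule k (MonoidAlgebra k (Equiv.Perm (Fin n))) :=
  Submodule.span k {x | ∃ (γ : AlmostOddComp n) (t : Equiv.Perm (Fin γ.len)),
    x = γ.OBar k - (γ.permute t).OBar k}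

variable {k n}

theorem differenceSpace_mul_mem (h2 : (2 : k) ≠ 0) {m : ℕ}
    {a x : MonoidAlgebra k (Equiv.Perm (Fin n))} (ha : a ∈ differenceSpace k n)
    (hx : x ∈ filtration k n m) : a * x ∈ filtration k n (m + 1) := by
  refine Submodule.span_induction₂ (p := fun a x _ _ => a * x ∈ filtration k n (m + 1))
    ?_ ?_ ?_ ?_ ?_ ?_ ?_ ha hx
  · rintro _ _ ⟨γ, t, rfl⟩ ⟨B, _, _, pos, d, hp, hd, hm, rfl⟩
    have e : γ.OBar k - (γ.permute t).OBar k =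
        ((2 : k) ^ γ.len)⁻¹ • (γ.X k - (γ.permute t).X k) := by
      rw [smul_sub, γ.OBar_eq_smul_X k h2, (γ.permute t).OBar_eq_smul_X k h2]
      rfl
    rw [e, smul_mul_assoc, sub_mul]
    refine Submodule.smul_mem _ _ (filtration_antitone k n (Nat.succ_le_succ hm) ?_)
    have h1 := X_mul_X_sub_mem k n (pos := fun i : Fin γ.len => (i : ℕ)) (c := γ.parts)
      Fin.val_injective hp hd
    have h3 := X_mul_X_sub_mem k n (pos := fun i : Fin γ.len => (i : ℕ))
      (c := fun i => γ.parts (t i)) Fin.val_injective hp hd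
    rw [card_couplings_comp_perm] at h3
    have := sub_mem h1 h3
    rw [sub_sub_sub_cancel_right] at this
    exact this
  · intros; simp
  · intros; simp
  · intro x y z _ _ _ h h'; rw [add_mul]; exact add_mem h h'
  · intro x y z _ _ _ h h'; rw [mul_add]; exact add_mem h h'
  · intro r x y _ _ h; rw [smul_mul_assoc]; exact Submodule.smul_mem _ _ h
  · intro r x y _ _ h; rw [mul_smul_comm]; exact Submodule.smul_mem _ _ h

theorem differenceSpace_le_filtration (h2 : (2 : k) ≠ 0) :
    differenceSpace k n ≤ filtration k n 0 := by
  refine Submodule.span_le.2 ?_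
  rintro _ ⟨γ, t, rfl⟩
  have h := span_OBar_le_filtration k n h2
  exact sub_mem (h (Submodule.subset_span ⟨_, rfl⟩)) (h (Submodule.subset_span ⟨_, rfl⟩))

theorem mem_radicalSpace {A : Subalgebra k (MonoidAlgebra k (Equiv.Perm (Fin n)))}
    {x : MonoidAlgebra k (Equiv.Perm (Fin n))} :
    x ∈ radicalSpace A ↔ ∃ a ∈ Ring.jacobson A, (a : MonoidAlgebra k (Equiv.Perm (Fin n))) = x :=
  Iff.rfl

/-- The differences raise the number of blocks, hence generate a nilpotent left ideal. -/
theorem differenceSpace_le_radicalSpace (h2 : (2 : k) ≠ 0) :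
    differenceSpace k n ≤ radicalSpace (peakAlgebra k n) := by
  intro a ha
  refine mem_radicalSpace.2 ⟨⟨a, differenceSpace_le_filtration h2 ha⟩, ?_, rfl⟩
  set a' : peakAlgebra k n := ⟨a, differenceSpace_le_filtration h2 ha⟩ with ha'
  rw [← Ideal.jacobson_bot, Ideal.mem_jacobson_iff]
  intro y
  have hraise : ∀ m, ((y * a') ^ m : peakAlgebra k n).1 ∈ filtration k n m := by
    intro m
    induction m with
    | zero => exact one_mem_filtration k n
    | succ m ih =>
      rw [pow_succ', mul_assoc]
      exact filtration_mul_mem k n y.2 (differenceSpace_mul_mem h2 ha ih)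
  have hnil : IsNilpotent (y * a') := by
    refine ⟨n + 1, Subtype.ext ?_⟩
    have := hraise (n + 1)
    rw [filtration_eq_bot k n (Nat.lt_succ_self n), Submodule.mem_bot] at this
    exact this
  obtain ⟨u, hu⟩ := hnil.isUnit_add_one
  refine ⟨↑u⁻¹, ?_⟩
  have : (↑u⁻¹ : peakAlgebra k n) * y * a' + ↑u⁻¹ = 1 := by
    rw [mul_assoc, ← mul_add_one, ← hu, Units.inv_mul]
  rw [this, sub_self]
  exact zero_mem _

/-- An element of the radical cannot act by a nonzero scalar on a quotient of the filtration: `1`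
minus a multiple of it is left invertible. -/
theorem mem_filtration_of_mem_jacobson {b : peakAlgebra k n}
    (hb : b ∈ Ring.jacobson (peakAlgebra k n))
    {s : k} (hs : s ≠ 0) {m : ℕ} {v : MonoidAlgebra k (Equiv.Perm (Fin n))}
    (hv : b.1 * v - s • v ∈ filtration k n m) : v ∈ filtration k n m := by
  rw [← Ideal.jacobson_bot] at hb
  obtain ⟨z, hz⟩ := Ideal.mem_jacobson_iff.1 hb (algebraMap k _ (-s⁻¹))
  rw [Submodule.mem_bot, sub_eq_zero] at hz
  have hz' : z.1 * (algebraMap k _ (-s⁻¹) * b.1) + z.1 = 1 := by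
    rw [← mul_assoc]
    exact congrArg Subtype.val hz
  have e : v = z.1 * (-s⁻¹ • (b.1 * v - s • v)) := by
    have h1 : -s⁻¹ • (b.1 * v - s • v) = algebraMap k _ (-s⁻¹) * b.1 * v + v := by
      rw [smul_sub, smul_smul, neg_mul, inv_mul_cancel₀ hs, neg_smul 1, one_smul, sub_neg_eq_add,
        mul_assoc, ← Algebra.smul_def]
    rw [h1, ← add_one_mul, ← mul_assoc, mul_add_one, hz', one_mul]
  rw [e]
  exact filtration_mul_mem k n z.2 (Submodule.smul_mem _ _ hv)

/-- If the compositions `ρ q` are pairwise inequivalent and `ρ q₀` is a shortest one, then only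
the term of `q₀` in a combination of the `Ō` contributes to the action on the class of `ρ q₀`. -/
theorem sum_OBar_mul_X_sub_mem (h2 : (2 : k) ≠ 0) {ι : Type*} {ρ : ι → AlmostOddComp n}
    (hρ : ∀ q q', (ρ q).Equivalent (ρ q') → q = q') (T : Finset ι) (c : ι → k) {q₀ : ι}
    (hq₀ : q₀ ∈ T) (hmin : ∀ q ∈ T, (ρ q₀).len ≤ (ρ q).len) :
    (∑ q ∈ T, c q • (ρ q).OBar k) * (ρ q₀).X k -
      (c q₀ * (((2 : k) ^ (ρ q₀).len)⁻¹ *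
        ((couplings (ρ q₀).parts (ρ q₀).parts).card : k))) • (ρ q₀).X k ∈
      filtration k n ((ρ q₀).len + 1) := by
  have hz : ∀ q ∈ T, q ≠ q₀ → couplings (ρ q₀).parts (ρ q).parts = ∅ := by
    intro q hq hne
    by_contra hem
    obtain ⟨φ, hφ⟩ := Finset.nonempty_iff_ne_empty.2 hem
    have hle := card_le_of_couplings_nonempty (ρ q).parts_pos ⟨φ, hφ⟩
    rw [Fintype.card_fin, Fintype.card_fin] at hle
    obtain ⟨σ, -, hσ⟩ := exists_equiv_of_mem_couplings (ρ q).parts_pos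
      (by rw [Fintype.card_fin, Fintype.card_fin]; exact le_antisymm hle (hmin q hq)) hφ
    exact hne (hρ q q₀ ⟨σ, hσ⟩)
  have e : (c q₀ * (((2 : k) ^ (ρ q₀).len)⁻¹ *
        ((couplings (ρ q₀).parts (ρ q₀).parts).card : k))) • (ρ q₀).X k =
      ∑ q ∈ T, (c q * (((2 : k) ^ (ρ q).len)⁻¹ *
        ((couplings (ρ q₀).parts (ρ q).parts).card : k))) • (ρ q₀).X k := by
    symm
    refine Finset.sum_eq_single_of_mem q₀ hq₀ fun q hq hne => ?_
    rw [hz q hq hne, Finset.card_empty, Nat.cast_zero, mul_zero, mul_zero, zero_smul]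
  rw [e, Finset.sum_mul, ← Finset.sum_sub_distrib]
  refine Submodule.sum_mem _ fun q _ => ?_
  have h1 := X_mul_X_sub_mem k n (pos := fun i : Fin (ρ q).len => (i : ℕ)) (c := (ρ q).parts)
    (pos' := fun i : Fin (ρ q₀).len => (i : ℕ)) Fin.val_injective Fin.val_injective
    (ρ q₀).parts_pos
  rw [Fintype.card_fin] at h1
  have h3 : (c q • (ρ q).OBar k) * (ρ q₀).X k - (c q * (((2 : k) ^ (ρ q).len)⁻¹ *
        ((couplings (ρ q₀).parts (ρ q).parts).card : k))) • (ρ q₀).X k =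
      (c q * ((2 : k) ^ (ρ q).len)⁻¹) • ((ρ q).X k * (ρ q₀).X k -
        ((couplings (ρ q₀).parts (ρ q).parts).card : k) • (ρ q₀).X k) := by
    rw [(ρ q).OBar_eq_smul_X k h2, smul_smul, smul_mul_assoc, smul_sub, smul_smul, mul_assoc]
  rw [h3]
  exact Submodule.smul_mem _ _ h1

/-- Modulo the differences, the peak algebra is spanned by the `Ō` of representatives of the
classes of rearranged compositions. -/
theorem filtration_zero_le_sup (h2 : (2 : k) ≠ 0) {ι : Type*} {ρ : ι → AlmostOddComp n}
    (hρ : ∀ γ, ∃ q, (ρ q).Equivalent γ) :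
    filtration k n 0 ≤
      differenceSpace k n ⊔ Submodule.span k (Set.range fun q => (ρ q).OBar k) := by
  rw [filtration_zero_eq_peakSpace k n h2]
  refine (peakSpace_le_span_OBar k n).trans (Submodule.span_le.2 ?_)
  rintro _ ⟨γ, rfl⟩
  obtain ⟨q, hq⟩ := hρ γ
  obtain ⟨t, rfl⟩ := hq.exists_permute
  have : ((ρ q).permute t).OBar k =
      -((ρ q).OBar k - ((ρ q).permute t).OBar k) + (ρ q).OBar k := by
    abel
  change ((ρ q).permute t).OBar k ∈ _
  rw [this]
  exact Submodule.add_mem_sup (neg_mem (Submodule.subset_span ⟨ρ q, t, rfl⟩))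
    (Submodule.subset_span ⟨q, rfl⟩)

theorem radicalSpace_le_differenceSpace (h2 : (2 : k) ≠ 0) (hn : (n.factorial : k) ≠ 0) :
    radicalSpace (peakAlgebra k n) ≤ differenceSpace k n := by
  intro a ha
  let S : Setoid (AlmostOddComp n) := ⟨_, AlmostOddComp.equivalent_equivalence⟩
  obtain ⟨ρ, hρ, hρ'⟩ : ∃ ρ : Quotient S → AlmostOddComp n,
      (∀ q q', (ρ q).Equivalent (ρ q') → q = q') ∧ ∀ γ, ∃ q, (ρ q).Equivalent γ :=
    ⟨Quotient.out, fun q q' h => Quotient.out_equiv_out.1 h,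
      fun γ => ⟨Quotient.mk S γ, Quotient.mk_out γ⟩⟩
  obtain ⟨a', ha', rfl⟩ := mem_radicalSpace.1 ha
  obtain ⟨ν, hν, b, hb, hab⟩ := Submodule.mem_sup.1 (filtration_zero_le_sup h2 hρ' a'.2)
  obtain ⟨c, rfl⟩ := Finsupp.mem_span_range_iff_exists_finsupp.1 hb
  rcases eq_or_ne c 0 with rfl | hc
  · rw [Finsupp.sum_zero_index, add_zero] at hab
    exact hab ▸ hν
  exfalso
  obtain ⟨q₀, hq₀, hmin⟩ := Finset.exists_min_image c.support (fun q => (ρ q).len)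
    (Finsupp.support_nonempty_iff.2 hc)
  obtain ⟨b', hb', hbe⟩ := mem_radicalSpace.1 (sub_mem ha
    (differenceSpace_le_radicalSpace h2 hν))
  have hact := sum_OBar_mul_X_sub_mem h2 hρ c.support c hq₀ hmin
  have hbe' : b'.1 = ∑ q ∈ c.support, c q • (ρ q).OBar k :=
    hbe.trans (sub_eq_of_eq_add' hab.symm)
  rw [← hbe'] at hact
  refine (ρ q₀).X_notMem_filtration k h2 (mem_filtration_of_mem_jacobson hb' ?_ hact)
  exact mul_ne_zero (Finsupp.mem_support_iff.1 hq₀)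
    (mul_ne_zero (inv_ne_zero (pow_ne_zero _ h2))
      (card_couplings_self_ne_zero h2 hn (ρ q₀).parts_pos (ρ q₀).sum_parts_le))

theorem radicalSpace_peakAlgebra (h2 : (2 : k) ≠ 0) (hn : (n.factorial : k) ≠ 0) :
    radicalSpace (peakAlgebra k n) = differenceSpace k n :=
  le_antisymm (radicalSpace_le_differenceSpace h2 hn) (differenceSpace_le_radicalSpace h2)

end PeakAlgebra

/-! ### The case of at most one letter -/

section Small

variable (k : Type*) [Field k] {n : ℕ}

theorem sparseSubsets_of_le_one (hn : n ≤ 1) : sparseSubsets n = {∅} := by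
  have : Finset.Icc 1 (n - 1) = ∅ := Finset.Icc_eq_empty (by omega)
  rw [sparseSubsets, this]
  rfl

theorem peakSpace_of_le_one (hn : n ≤ 1) :
    Subalgebra.toSubmodule (⊥ : Subalgebra k (MonoidAlgebra k (Equiv.Perm (Fin n)))) =
      peakSpace k n := by
  have : Subsingleton (Fin n) := Fin.subsingleton_iff_le_one.2 hn
  have h1 : ∀ w : Equiv.Perm (Fin n), peak w = ∅ := fun w => by
    have := peak_mem_sparseSubsets w
    rwa [sparseSubsets_of_le_one hn, Finset.mem_singleton] at this
  have hP : P k n ∅ = 1 := by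
    have : (Finset.univ : Finset (Equiv.Perm (Fin n))) = {1} := by
      ext w
      simp [Subsingleton.elim w 1]
    rw [P, this, Finset.filter_singleton, if_pos (h1 1), Finset.sum_singleton, map_one]
  rw [Algebra.toSubmodule_bot, peakSpace, sparseSubsets_of_le_one hn, Submodule.one_eq_span]
  congr 1
  ext x
  simp [hP]

theorem radicalSpace_bot (n : ℕ) :
    radicalSpace (⊥ : Subalgebra k (MonoidAlgebra k (Equiv.Perm (Fin n)))) = ⊥ := by
  rw [eq_bot_iff]
  intro x hx
  obtain ⟨a, ha, rfl⟩ := mem_radicalSpace.1 hx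
  obtain ⟨c, hc⟩ := Algebra.mem_bot.1 a.2
  rw [← Ideal.jacobson_bot] at ha
  by_cases h0 : c = 0
  · rw [← hc, h0, map_zero]
    exact zero_mem _
  · exfalso
    obtain ⟨z, hz⟩ := Ideal.mem_jacobson_iff.1 ha (algebraMap k _ (-c⁻¹))
    rw [Submodule.mem_bot, sub_eq_zero] at hz
    have hz' : z.1 * (algebraMap k _ (-c⁻¹) * a.1) + z.1 = 1 := by
      rw [← mul_assoc]
      exact congrArg Subtype.val hz
    rw [← hc] at hz'
    have e : algebraMap k (MonoidAlgebra k (Equiv.Perm (Fin n))) (-c⁻¹) * algebraMap k _ c = -1 := by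
      rw [← map_mul, neg_mul, inv_mul_cancel₀ h0, map_neg, map_one]
    exact zero_ne_one ((by rw [← hz']; erw [e]; rw [mul_neg, mul_one, neg_add_cancel]) :
      (0 : MonoidAlgebra k (Equiv.Perm (Fin n))) = 1)

theorem differenceSpace_of_le_one (hn : n ≤ 1) :
    differenceSpace k n = ⊥ := by
  rw [differenceSpace, Submodule.span_eq_bot]
  rintro _ ⟨γ, t, rfl⟩
  have h : ∀ δ : AlmostOddComp n, δ.sparseSet = ∅ := fun δ => by
    have := δ.sparseSet_mem
    rwa [sparseSubsets_of_le_one hn, Finset.mem_singleton] at this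
  rw [AlmostOddComp.OBar, AlmostOddComp.OBar, h, h, sub_self]

end Small

theorem two_ne_zero_of_factorial_ne_zero {k : Type*} [Field k] {n : ℕ} (hn : 2 ≤ n)
    (h : (n.factorial : k) ≠ 0) : (2 : k) ≠ 0 := by
  intro h2
  obtain ⟨q, hq⟩ := Nat.dvd_factorial two_pos hn
  apply h
  rw [hq]
  push_cast
  rw [h2, zero_mul]

end PeakAlg

theorem theorem3p2 (k : Type*) [Field k] (n : ℕ) (hn : (n.factorial : k) ≠ 0) :
    ∃ A : Subalgebra k (MonoidAlgebra k (Equiv.Perm (Fin n))),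
      Subalgebra.toSubmodule A = PeakAlg.peakSpace k n ∧
      PeakAlg.radicalSpace A = Submodule.span k
        {x | ∃ (γ : PeakAlg.AlmostOddComp n) (t : Equiv.Perm (Fin γ.len)),
          x = γ.OBar k - (γ.permute t).OBar k} ∧
      PeakAlg.radicalSpace A = Submodule.span k
        {x | ∃ (γ : PeakAlg.AlmostOddComp n) (t : Equiv.Perm (Fin γ.len)),
          x = γ.Q k - (γ.permute t).Q k} ∧
      PeakAlg.radicalSpace A = Submodule.span k
        {x | ∃ (γ : PeakAlg.AlmostOddComp n) (t : Equiv.Perm (Fin γ.len)),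
          x = γ.O k - (γ.permute t).O k} := by
  rw [PeakAlg.span_differences_Q_eq_OBar, PeakAlg.span_differences_O_eq_OBar]
  suffices ∃ A : Subalgebra k (MonoidAlgebra k (Equiv.Perm (Fin n))),
      Subalgebra.toSubmodule A = PeakAlg.peakSpace k n ∧
      PeakAlg.radicalSpace A = PeakAlg.differenceSpace k n by
    obtain ⟨A, h1, h2⟩ := this
    exact ⟨A, h1, h2, h2, h2⟩
  rcases le_or_gt n 1 with h1 | h1
  · -- here `2` may vanish in `k`, but the algebra is one-dimensional
    exact ⟨⊥, PeakAlg.peakSpace_of_le_one k h1, by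
      rw [PeakAlg.radicalSpace_bot, PeakAlg.differenceSpace_of_le_one k h1]⟩
  · have h2 := PeakAlg.two_ne_zero_of_factorial_ne_zero h1 hn
    exact ⟨PeakAlg.peakAlgebra k n, PeakAlg.filtration_zero_eq_peakSpace k n h2,
      PeakAlg.radicalSpace_peakAlgebra h2 hn⟩
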